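/- Let $PL_2^+(\mathbb R)$ be the group of orientation-preserving piecewise-linear homeomorphisms of $\mathbb R$ whose breakpoints form a closed discrete (possibly infinite) set of dyadic rationals and all of whose linear pieces have the form $x\mapsto 2^kx+c$ with $k\in\mathbb Z$, $c\in\mathbb Z[\frac12]$. Let Thompson's group $F$ be the subgroup of those $f$ for which there are $M>0$ and $k,l\in\mathbb Z$ with $f(x)=x+k$ for $x>M$ and $f(x)=x+l$ for $x<-M$. Let $\mathrm{Aut}^+F$ be the group of orientation-preserving automorphisms of $F$, i.e. those automorphisms of $F$ that are conjugation by an element of $PL_2^+(\mathbb R)$. Let $T$ be Thompson's group of homeomorphisms of the circle $\mathbb R/\mathbb Z$, i.e. those that lift to an element of $PL_2^+(\mathbb R)$ commuting with $x\mapsto x+1$. Maps are composed from left to right ($gh$ means first $g$, then $h$), a map $g$ acts on $F$ by $f\mapsto gfg^{-1}$, and $[a,b]=aba^{-1}b^{-1}$. Let $u_0:[0,1]\to[0,1]$ be $2u$ on $[0,\frac14]$, $u+\frac14$ on $[\frac14,\frac12]$, $\frac{u+1}2$ on $[\frac12,1]$, and let $u_1$ be $u$ on $[0,\frac12]$ and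 $\frac12+\frac12u_0(2u-1)$ on $[\frac12,1]$. Consider the following maps of $\mathbb R$: * $x_0(x)=x+1$; $x_1(x)=x$ for $x\le 0$, $2x$ for $0\le x\le 1$, $x+1$ for $x\ge 1$; * $y_i(x)=x$ for $x\le0$ and $y_i(x)=\lfloor x\rfloor+u_i(x-\lfloor x\rfloor)$ for $x\ge0$ ($i=0,1$); $s(x)=x$ for $x\le 0$, $2x$ for $0\le x\le\frac12$, $x+\frac12$ for $x\ge\frac12$; * $z_i(x)=x$ for $x\ge0$ and $z_i(x)=\lfloor x\rfloor+u_i(x-\lfloor x\rfloor)$ for $x\le0$ ($i=0,1$); $t(x)=-s(-x)$. **Proposition.** There is a short exact sequence $1\to F\to\mathrm{Aut}^+F\xrightarrow{\ \pi\ }T\times T\to1$, where $F\to \mathrm{Aut}^+F$ is $f\mapsto$ conjugation by $f$, and $\pi$ sends the automorphism given by conjugation by $h$ to the pair of circle maps induced by $h$ near $+\infty$ and near $-\infty$. The group $\mathrm{Aut}^+F$ is presented by the generators $x_0,x_1,y_0,y_1,s,z_0,z_1,t$ (the automorphisms of $F$ given by the maps above), subject to the following 35 (pairwise distinct) relators.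 Write $f_1(a,b)=[ab^{-1},a^{-1}ba]$, $f_2(a,b)=[ab^{-1},a^{-2}ba^2]$, $t_1(a,b,r)=b^{-1}ra^2b^{-1}a^{-1}r$, $t_2(a,b,r)=b^{-1}ra^2b^{-1}rara$, $t_3(a,b,r)=b^{-2}ra^3b^{-1}a^{-2}rba^{-1}ba$, $t_4(r)=r^2$ (an equation $u=v$ stands for the relator $uv^{-1}$). 1. Kernel relators (2): $f_1(x_0,x_1)$, $f_2(x_0,x_1)$. 2. Lifts of the relators of $T\times T$. (a) Commutation (9): $[g,h]$ for $g\in\{y_0,y_1,s\}$, $h\in\{z_0,z_1,t\}$. (b) Lifts of the relators of the two copies of $T$ (12): $f_1(y_0,y_1)$, $f_2(y_0,y_1)$, $f_1(z_0,z_1)$, $f_2(z_0,z_1)$, and $t_1(y_0,y_1,s)=x_1^4x_0^{-3}x_1^{-1}x_0^2x_1^{-1}x_0x_1^{-1}$, $t_2(y_0,y_1,s)=x_1^8x_0^{-7}x_1^{-1}x_0^2x_1^{-1}x_0x_1^{-1}x_0x_1^{-1}x_0^2x_1^{-1}x_0x_1^{-1}$, $t_3(y_0,y_1,s)=x_1^5x_0^{-3}x_1^2x_0^{-1}x_1x_0^{-3}x_1^{-1}x_0^2x_1^{-1}x_0x_1^{-1}x_0x_1^{-1}x_0^2x_1^{-1}x_0x_1^{-2}$,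 $t_4(s)=x_1^2x_0^{-1}x_1^{-1}x_0$, $t_1(z_0,z_1,t)=x_0x_1x_0^{-1}x_1^2x_0^{-2}x_1x_0x_1^{-1}x_0x_1^{-1}x_0x_1^{-1}x_0^{-2}$, $t_2(z_0,z_1,t)=x_0x_1x_0^{-1}x_1x_0x_1^{-1}x_0^{-1}x_1^2x_0^{-1}x_1^{-1}x_0x_1^{-1}x_0^{-1}$, $t_3(z_0,z_1,t)=x_0x_1x_0^{-1}x_1^2x_0^{-2}x_1x_0^{-1}x_1x_0^{-1}x_1x_0^{-1}x_1^2x_0^{-1}x_1x_0^{-1}x_1^{-1}x_0x_1^{-1}x_0x_1^{-1}x_0x_1^{-1}x_0^2x_1^{-1}x_0x_1^{-1}x_0x_1^{-1}x_0x_1^{-1}x_0^{-2}$, $t_4(t)=x_0x_1x_0^{-1}x_1x_0x_1^{-1}x_0^{-2}$. 3. Conjugation action (12): $y_0x_0y_0^{-1}=x_0x_1x_0^{-1}x_1x_0x_1^{-2}$, $y_0x_1y_0^{-1}=x_1^3x_0^{-1}x_1x_0^{-3}x_1x_0x_1^{-2}x_0^3x_1^{-2}$, $y_1x_0y_1^{-1}=x_0x_1x_0^{-1}x_1x_0^{-1}x_1x_0x_1^{-2}x_0x_1^{-1}$,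 $y_1x_1y_1^{-1}=x_1^2x_0^{-1}x_1x_0^{-1}x_1x_0^{-2}x_1^2x_0^{-2}x_1x_0x_1^{-2}x_0x_1^{-1}x_0^3x_1^{-2}x_0x_1^{-1}$, $sx_0s^{-1}=x_1^2x_0^{-1}x_1^{-1}x_0^2x_1^{-1}$, $sx_1s^{-1}=x_1^2x_0^{-1}x_1x_0x_1^{-1}x_0^{-1}x_1^{-1}x_0$, $z_0x_0z_0^{-1}=x_0x_1^2x_0^{-1}x_1^{-1}x_0x_1^{-1}$, $z_1x_0z_1^{-1}=x_0x_1x_0^{-1}x_1^2x_0^{-1}x_1^{-1}x_0x_1^{-1}x_0x_1^{-1}$, $tx_0t^{-1}=x_0x_1x_0x_1x_0^{-1}x_1^{-1}x_0x_1^{-1}x_0^{-1}$, and $z_0x_1z_0^{-1}=x_1$, $z_1x_1z_1^{-1}=x_1$, $tx_1t^{-1}=x_1$. -/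

import Mathlib

namespace ThompsonAut

/-- Dyadic rationals, the elements of `ℤ[1/2]`. -/
def IsDyadic (x : ℝ) : Prop := ∃ (m : ℤ) (n : ℕ), x = (m : ℝ) / 2 ^ n

/-- Piecewise linear with a locally finite set `B` of dyadic breakpoints, and, between breakpoints,
of the form `x ↦ 2 ^ k * x + c` with `k ∈ ℤ` and `c ∈ ℤ[1/2]`. -/
def IsPL2 (f : ℝ → ℝ) : Prop :=
  ∃ B : Set ℝ, (∀ b ∈ B, IsDyadic b) ∧ (∀ a b : ℝ, (B ∩ Set.Icc a b).Finite) ∧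
    ∀ a b : ℝ, a ≤ b → Disjoint B (Set.Ioo a b) →
      ∃ (k : ℤ) (c : ℝ), IsDyadic c ∧ ∀ x ∈ Set.Icc a b, f x = (2 : ℝ) ^ k * x + c

theorem IsDyadic.add {x y : ℝ} (hx : IsDyadic x) (hy : IsDyadic y) : IsDyadic (x + y) := by
  obtain ⟨m, n, rfl⟩ := hx
  obtain ⟨p, q, rfl⟩ := hy
  refine ⟨m * 2 ^ q + p * 2 ^ n, n + q, ?_⟩
  push_cast
  field_simp
  ring

theorem IsDyadic.neg {x : ℝ} (hx : IsDyadic x) : IsDyadic (-x) := by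
  obtain ⟨m, n, rfl⟩ := hx
  exact ⟨-m, n, by push_cast; ring⟩

theorem IsDyadic.two_zpow_mul {x : ℝ} (k : ℤ) (hx : IsDyadic x) :
    IsDyadic ((2 : ℝ) ^ k * x) := by
  obtain ⟨m, n, rfl⟩ := hx
  obtain ⟨j, rfl | rfl⟩ := k.eq_nat_or_neg
  · exact ⟨2 ^ j * m, n, by push_cast; rw [zpow_natCast]; ring⟩
  · refine ⟨m, n + j, ?_⟩
    rw [zpow_neg, zpow_natCast]
    field_simp
    ring

theorem IsPL2.isDyadic_iff {f : ℝ → ℝ} (hf : IsPL2 f) (x : ℝ) :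
    IsDyadic (f x) ↔ IsDyadic x := by
  obtain ⟨B, -, -, h⟩ := hf
  obtain ⟨k, c, hc, hx⟩ := h x x le_rfl (by simp)
  have hx := hx x (by simp)
  constructor
  · intro H
    have := (H.add hc.neg).two_zpow_mul (-k)
    rw [hx] at this
    convert this using 1
    rw [zpow_neg]
    field_simp
    ring
  · intro H
    rw [hx]
    exact (H.two_zpow_mul k).add hc

theorem isPL2_id : IsPL2 (fun x => x) := by
  refine ⟨∅, by simp, by simp, fun a b _ _ => ⟨0, 0, ⟨0, 0, by simp⟩, by simp⟩⟩

theorem IsPL2.comp {f : ℝ → ℝ} {g : ℝ ≃o ℝ} (hf : IsPL2 f) (hg : IsPL2 g) :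
    IsPL2 (fun x => f (g x)) := by
  have hgd := hg.isDyadic_iff
  obtain ⟨B, hB, hBf, h⟩ := hf
  obtain ⟨C, hC, hCf, h'⟩ := hg
  refine ⟨C ∪ g ⁻¹' B, ?_, ?_, ?_⟩
  · rintro b (hb | hb)
    · exact hC b hb
    · exact (hgd b).1 (hB _ hb)
  · intro a b
    rw [Set.union_inter_distrib_right]
    refine (hCf a b).union (((hBf (g a) (g b)).preimage g.injective.injOn).subset ?_)
    rintro x ⟨hx, hx1, hx2⟩
    exact ⟨hx, g.monotone hx1, g.monotone hx2⟩
  · intro a b hab hd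
    rw [Set.disjoint_union_left] at hd
    obtain ⟨k, c, hc, hk⟩ := h' a b hab hd.1
    obtain ⟨l, d, hd', hl⟩ := h (g a) (g b) (g.monotone hab) (by
      rw [Set.disjoint_left]
      intro y hy hy'
      refine (Set.disjoint_left.1 hd.2 : ∀ ⦃a⦄, _ → _) (show g.symm y ∈ g ⁻¹' B by simpa using hy) ⟨?_, ?_⟩
      · rw [← g.lt_iff_lt]; simpa using hy'.1
      · rw [← g.lt_iff_lt]; simpa using hy'.2)
    refine ⟨l + k, (2 : ℝ) ^ l * c + d, (hc.two_zpow_mul l).add hd', fun x hx => ?_⟩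
    show f (g x) = _
    rw [hl (g x) ⟨g.monotone hx.1, g.monotone hx.2⟩, hk x hx, zpow_add₀ (by norm_num)]
    ring

theorem IsPL2.symm {g : ℝ ≃o ℝ} (hg : IsPL2 g) : IsPL2 g.symm := by
  have hgd := hg.isDyadic_iff
  obtain ⟨C, hC, hCf, h⟩ := hg
  refine ⟨g.symm ⁻¹' C, ?_, ?_, ?_⟩
  · intro b hb
    have := (hgd (g.symm b)).2 (hC _ hb)
    simpa using this
  · intro a b
    refine ((hCf (g.symm a) (g.symm b)).preimage g.symm.injective.injOn).subset ?_
    rintro x ⟨hx, hx1, hx2⟩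
    exact ⟨hx, g.symm.monotone hx1, g.symm.monotone hx2⟩
  · intro a b hab hd
    obtain ⟨k, c, hc, hk⟩ := h (g.symm a) (g.symm b) (g.symm.monotone hab) (by
      rw [Set.disjoint_left]
      intro y hy hy'
      refine (Set.disjoint_left.1 hd : ∀ ⦃a⦄, _ → _) (show g y ∈ g.symm ⁻¹' C by simpa using hy) ⟨?_, ?_⟩
      · rw [← g.symm.lt_iff_lt]; simpa using hy'.1
      · rw [← g.symm.lt_iff_lt]; simpa using hy'.2)
    refine ⟨-k, (2 : ℝ) ^ (-k) * (-c), hc.neg.two_zpow_mul _, fun x hx => ?_⟩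
    have := hk (g.symm x) ⟨g.symm.monotone hx.1, g.symm.monotone hx.2⟩
    rw [OrderIso.apply_symm_apply] at this
    have h2 : (2 : ℝ) ^ (-k) * 2 ^ k = 1 := by rw [← zpow_add₀ (by norm_num)]; simp
    linear_combination (-(2 : ℝ) ^ (-k)) * this - g.symm x * h2

/-- The orientation-preserving part of `PL₂(ℝ)`. An order automorphism of `ℝ` is the same thing as
an orientation-preserving homeomorphism of `ℝ`; the product is composition, `(f * g) x = f (g x)`. -/
def PL2Plus : Subgroup (ℝ ≃o ℝ) where
  carrier := {f | IsPL2 f}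
  one_mem' := isPL2_id
  mul_mem' := fun hf hg => hf.comp hg
  inv_mem' := fun hf => hf.symm

/-- `f` is a translation by an integer near `∞` and a translation by an integer near `-∞`. -/
def IsEventuallyTranslation (f : ℝ → ℝ) : Prop :=
  ∃ (M : ℝ) (k l : ℤ), 0 < M ∧ (∀ x : ℝ, M < x → f x = x + k) ∧ ∀ x : ℝ, x < -M → f x = x + l

theorem IsEventuallyTranslation.comp {f g : ℝ → ℝ} (hf : IsEventuallyTranslation f)
    (hg : IsEventuallyTranslation g) : IsEventuallyTranslation (fun x => f (g x)) := by
  obtain ⟨M, k, l, hM, h1, h2⟩ := hf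
  obtain ⟨N, p, q, hN, h3, h4⟩ := hg
  refine ⟨M + N + |(p : ℝ)| + |(q : ℝ)|, k + p, l + q, by positivity, fun x hx => ?_, fun x hx => ?_⟩
  · have := abs_nonneg (p : ℝ); have := abs_nonneg (q : ℝ); have := neg_abs_le (p : ℝ)
    show f (g x) = _
    rw [h3 x (by linarith), h1 _ (by linarith)]
    push_cast; ring
  · have := abs_nonneg (p : ℝ); have := abs_nonneg (q : ℝ); have := le_abs_self (q : ℝ)
    show f (g x) = _
    rw [h4 x (by linarith), h2 _ (by linarith)]
    push_cast; ring

theorem IsEventuallyTranslation.symm {g : ℝ ≃o ℝ} (hg : IsEventuallyTranslation g) :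
    IsEventuallyTranslation g.symm := by
  obtain ⟨N, p, q, hN, h3, h4⟩ := hg
  refine ⟨N + |(p : ℝ)| + |(q : ℝ)|, -p, -q, by positivity, fun x hx => ?_, fun x hx => ?_⟩
  · have := abs_nonneg (q : ℝ); have := le_abs_self (p : ℝ)
    rw [OrderIso.symm_apply_eq, h3 _ (by push_cast; linarith)]
    push_cast; ring
  · have := abs_nonneg (p : ℝ); have := neg_abs_le (q : ℝ)
    rw [OrderIso.symm_apply_eq, h4 _ (by push_cast; linarith)]
    push_cast; ring

/-- Thompson's group `F`, in its realization on the real line. -/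
def ThompsonF : Subgroup (ℝ ≃o ℝ) where
  carrier := {f | IsPL2 f ∧ IsEventuallyTranslation f}
  one_mem' := ⟨isPL2_id, 1, 0, 0, one_pos, by simp, by simp⟩
  mul_mem' := fun hf hg => ⟨hf.1.comp hg.1, hf.2.comp hg.2⟩
  inv_mem' := fun hf => ⟨hf.1.symm, hf.2.symm⟩

/-- `φ` is conjugation by `h`. -/
def InducedBy (φ : MulAut ThompsonF) (h : ℝ ≃o ℝ) : Prop :=
  ∀ f : ThompsonF, (φ f : ℝ ≃o ℝ) = h * (f : ℝ ≃o ℝ) * h⁻¹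

/-- The group `Aut⁺ F` of orientation-preserving automorphisms of `F`: the automorphisms of `F`
that are conjugation by an orientation-preserving element of `PL₂(ℝ)`. -/
def AutPlusF : Subgroup (MulAut ThompsonF) where
  carrier := {φ | ∃ h ∈ PL2Plus, InducedBy φ h}
  one_mem' := ⟨1, PL2Plus.one_mem, fun f => by simp⟩
  mul_mem' := by
    rintro φ ψ ⟨g, hg, hφ⟩ ⟨h, hh, hψ⟩
    refine ⟨g * h, PL2Plus.mul_mem hg hh, fun f => ?_⟩
    rw [MulAut.mul_apply, hφ, hψ]
    group
  inv_mem' := by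
    rintro φ ⟨g, hg, hφ⟩
    refine ⟨g⁻¹, PL2Plus.inv_mem hg, fun f => ?_⟩
    have := hφ (φ⁻¹ f)
    rw [MulAut.apply_inv_self] at this
    rw [this]
    group

/-- Thompson's group `T`, acting on the circle `ℝ / ℤ`: the homeomorphisms of the circle that lift
to an element of `PL₂⁺(ℝ)` commuting with `x ↦ x + 1`. -/
def ThompsonT : Subgroup (AddCircle (1 : ℝ) ≃ₜ AddCircle (1 : ℝ)) where
  carrier := {g | ∃ f ∈ PL2Plus, (∀ x : ℝ, f (x + 1) = f x + 1) ∧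
    ∀ x : ℝ, g (x : AddCircle (1 : ℝ)) = (f x : AddCircle (1 : ℝ))}
  one_mem' := ⟨1, PL2Plus.one_mem, fun _ => rfl, fun _ => rfl⟩
  mul_mem' := by
    rintro g g' ⟨f, hf, h1, h2⟩ ⟨f', hf', h1', h2'⟩
    refine ⟨f * f', PL2Plus.mul_mem hf hf', fun x => ?_, fun x => ?_⟩
    · rw [RelIso.mul_apply, RelIso.mul_apply, h1', h1]
    · rw [RelIso.mul_apply, ← h2, ← h2']
      rfl
  inv_mem' := by
    rintro g ⟨f, hf, h1, h2⟩
    refine ⟨f⁻¹, PL2Plus.inv_mem hf, fun x => ?_, fun x => ?_⟩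
    · apply f.injective
      rw [h1, RelIso.apply_inv_self, RelIso.apply_inv_self]
    · have := h2 (f⁻¹ x)
      rw [RelIso.apply_inv_self] at this
      rw [← this]
      exact g.symm_apply_apply _

/-- The symbols for the eight generators. -/
inductive Gen
  | x0 | x1 | y0 | y1 | s | z0 | z1 | t

/-- On `[0, 1]`: the generator `x₀` of `F`. -/
noncomputable def unit0 (u : ℝ) : ℝ :=
  if u ≤ 1 / 4 then 2 * u else if u ≤ 1 / 2 then u + 1 / 4 else (u + 1) / 2

/-- On `[0, 1]`: the generator `x₁` of `F`, the identity on `[0, 1/2]` and a half-size copy of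
`x₀` on `[1/2, 1]`. -/
noncomputable def unit1 (u : ℝ) : ℝ :=
  if u ≤ 1 / 2 then u else 1 / 2 + unit0 (2 * u - 1) / 2

/-- The maps of the real line named by the eight generators. `y₀, y₁, s` are supported on `[0, ∞)`
and `z₀, z₁, t` on `(-∞, 0]`. -/
noncomputable def genMap : Gen → ℝ → ℝ
  | .x0, x => x + 1
  | .x1, x => if x ≤ 0 then x else if x ≤ 1 then 2 * x else x + 1
  | .y0, x => if x ≤ 0 then x else ⌊x⌋ + unit0 (Int.fract x)
  | .y1, x => if x ≤ 0 then x else ⌊x⌋ + unit1 (Int.fract x)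
  | .s, x => if x ≤ 0 then x else if x ≤ 1 / 2 then 2 * x else x + 1 / 2
  | .z0, x => if 0 ≤ x then x else ⌊x⌋ + unit0 (Int.fract x)
  | .z1, x => if 0 ≤ x then x else ⌊x⌋ + unit1 (Int.fract x)
  | .t, x => if 0 ≤ x then x else if -1 / 2 ≤ x then 2 * x else x - 1 / 2

/-- The commutator `[a, b]`. -/
def comm {G : Type*} [Group G] (a b : G) : G := a * b * a⁻¹ * b⁻¹

/-- The first of the two relators of `F`. -/
def f1 {G : Type*} [Group G] (a b : G) : G := comm (a * b⁻¹) (a⁻¹ * b * a)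

/-- The second relator of `F`. -/
def f2 {G : Type*} [Group G] (a b : G) : G := comm (a * b⁻¹) (a⁻¹ ^ 2 * b * a ^ 2)

/-- The four further relators of `T`, on generators `a, b` of `F` and the half turn `r`. -/
def t1 {G : Type*} [Group G] (a b r : G) : G := b⁻¹ * r * a ^ 2 * b⁻¹ * a⁻¹ * r

/-- See `t1`. -/
def t2 {G : Type*} [Group G] (a b r : G) : G := b⁻¹ * r * a ^ 2 * b⁻¹ * r * a * r * a

/-- See `t1`. -/
def t3 {G : Type*} [Group G] (a b r : G) : G :=
  b⁻¹ ^ 2 * r * a ^ 3 * b⁻¹ * a⁻¹ ^ 2 * r * b * a⁻¹ * b * a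

/-- See `t1`. -/
def t4 {G : Type*} [Group G] (r : G) : G := r ^ 2

abbrev x₀ : FreeGroup Gen := FreeGroup.of Gen.x0
abbrev x₁ : FreeGroup Gen := FreeGroup.of Gen.x1
abbrev y₀ : FreeGroup Gen := FreeGroup.of Gen.y0
abbrev y₁ : FreeGroup Gen := FreeGroup.of Gen.y1
abbrev s : FreeGroup Gen := FreeGroup.of Gen.s
abbrev z₀ : FreeGroup Gen := FreeGroup.of Gen.z0
abbrev z₁ : FreeGroup Gen := FreeGroup.of Gen.z1
abbrev t : FreeGroup Gen := FreeGroup.of Gen.t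

/-- The relators of the kernel `F` (2 relators). -/
def kernelRelators : Set (FreeGroup Gen) := {f1 x₀ x₁, f2 x₀ x₁}

/-- The generators `y₀, y₁, s` commute with `z₀, z₁, t` (9 relators). -/
def commutationRelators : Set (FreeGroup Gen) :=
  {comm y₀ z₀, comm y₀ z₁, comm y₀ t,
   comm y₁ z₀, comm y₁ z₁, comm y₁ t,
   comm s z₀, comm s z₁, comm s t}

/-- The relators of the two copies of `T`, each lifted to `(relator) = (word in x₀, x₁)`
(12 relators). -/
def liftedRelators : Set (FreeGroup Gen) :=
  {f1 y₀ y₁,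
   f2 y₀ y₁,
   t1 y₀ y₁ s * (x₁ ^ 4 * x₀⁻¹ ^ 3 * x₁⁻¹ * x₀ ^ 2 * x₁⁻¹ * x₀ * x₁⁻¹)⁻¹,
   t2 y₀ y₁ s * (x₁ ^ 8 * x₀⁻¹ ^ 7 * x₁⁻¹ * x₀ ^ 2 * x₁⁻¹ * x₀ * x₁⁻¹ * x₀ * x₁⁻¹ * x₀ ^ 2 *
     x₁⁻¹ * x₀ * x₁⁻¹)⁻¹,
   t3 y₀ y₁ s * (x₁ ^ 5 * x₀⁻¹ ^ 3 * x₁ ^ 2 * x₀⁻¹ * x₁ * x₀⁻¹ ^ 3 * x₁⁻¹ * x₀ ^ 2 * x₁⁻¹ * x₀ *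
     x₁⁻¹ * x₀ * x₁⁻¹ * x₀ ^ 2 * x₁⁻¹ * x₀ * x₁⁻¹ ^ 2)⁻¹,
   t4 s * (x₁ ^ 2 * x₀⁻¹ * x₁⁻¹ * x₀)⁻¹,
   f1 z₀ z₁,
   f2 z₀ z₁,
   t1 z₀ z₁ t * (x₀ * x₁ * x₀⁻¹ * x₁ ^ 2 * x₀⁻¹ ^ 2 * x₁ * x₀ * x₁⁻¹ * x₀ * x₁⁻¹ * x₀ * x₁⁻¹ *
     x₀⁻¹ ^ 2)⁻¹,
   t2 z₀ z₁ t * (x₀ * x₁ * x₀⁻¹ * x₁ * x₀ * x₁⁻¹ * x₀⁻¹ * x₁ ^ 2 * x₀⁻¹ * x₁⁻¹ * x₀ * x₁⁻¹ *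
     x₀⁻¹)⁻¹,
   t3 z₀ z₁ t * (x₀ * x₁ * x₀⁻¹ * x₁ ^ 2 * x₀⁻¹ ^ 2 * x₁ * x₀⁻¹ * x₁ * x₀⁻¹ * x₁ * x₀⁻¹ *
     x₁ ^ 2 * x₀⁻¹ * x₁ * x₀⁻¹ * x₁⁻¹ * x₀ * x₁⁻¹ * x₀ * x₁⁻¹ * x₀ * x₁⁻¹ * x₀ ^ 2 * x₁⁻¹ * x₀ *
     x₁⁻¹ * x₀ * x₁⁻¹ * x₀ * x₁⁻¹ * x₀⁻¹ ^ 2)⁻¹,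
   t4 t * (x₀ * x₁ * x₀⁻¹ * x₁ * x₀ * x₁⁻¹ * x₀⁻¹ ^ 2)⁻¹}

/-- The conjugation action of `y₀, y₁, s, z₀, z₁, t` on `x₀, x₁`, each in the form
`g x g⁻¹ = (word in x₀, x₁)` (12 relators). -/
def actionRelators : Set (FreeGroup Gen) :=
  {y₀ * x₀ * y₀⁻¹ * (x₀ * x₁ * x₀⁻¹ * x₁ * x₀ * x₁⁻¹ ^ 2)⁻¹,
   y₀ * x₁ * y₀⁻¹ * (x₁ ^ 3 * x₀⁻¹ * x₁ * x₀⁻¹ ^ 3 * x₁ * x₀ * x₁⁻¹ ^ 2 * x₀ ^ 3 * x₁⁻¹ ^ 2)⁻¹,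
   y₁ * x₀ * y₁⁻¹ * (x₀ * x₁ * x₀⁻¹ * x₁ * x₀⁻¹ * x₁ * x₀ * x₁⁻¹ ^ 2 * x₀ * x₁⁻¹)⁻¹,
   y₁ * x₁ * y₁⁻¹ * (x₁ ^ 2 * x₀⁻¹ * x₁ * x₀⁻¹ * x₁ * x₀⁻¹ ^ 2 * x₁ ^ 2 * x₀⁻¹ ^ 2 * x₁ * x₀ *
     x₁⁻¹ ^ 2 * x₀ * x₁⁻¹ * x₀ ^ 3 * x₁⁻¹ ^ 2 * x₀ * x₁⁻¹)⁻¹,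
   s * x₀ * s⁻¹ * (x₁ ^ 2 * x₀⁻¹ * x₁⁻¹ * x₀ ^ 2 * x₁⁻¹)⁻¹,
   s * x₁ * s⁻¹ * (x₁ ^ 2 * x₀⁻¹ * x₁ * x₀ * x₁⁻¹ * x₀⁻¹ * x₁⁻¹ * x₀)⁻¹,
   z₀ * x₀ * z₀⁻¹ * (x₀ * x₁ ^ 2 * x₀⁻¹ * x₁⁻¹ * x₀ * x₁⁻¹)⁻¹,
   z₀ * x₁ * z₀⁻¹ * x₁⁻¹,
   z₁ * x₀ * z₁⁻¹ * (x₀ * x₁ * x₀⁻¹ * x₁ ^ 2 * x₀⁻¹ * x₁⁻¹ * x₀ * x₁⁻¹ * x₀ * x₁⁻¹)⁻¹,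
   z₁ * x₁ * z₁⁻¹ * x₁⁻¹,
   t * x₀ * t⁻¹ * (x₀ * x₁ * x₀ * x₁ * x₀⁻¹ * x₁⁻¹ * x₀ * x₁⁻¹ * x₀⁻¹)⁻¹,
   t * x₁ * t⁻¹ * x₁⁻¹}

/-- All relators. -/
def relators : Set (FreeGroup Gen) :=
  kernelRelators ∪ commutationRelators ∪ liftedRelators ∪ actionRelators

end ThompsonAut

open Filter Topology

namespace ThompsonAut


/-! ### Dyadic numbers -/

/-! Exact sequence. `F` acts transitively on the dyadic points, so only the identity commutes with
it (`eq_one_of_commute`), and an automorphism determines the map `h` that induces it. Conjugating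
`x₀` by `h` and by `h⁻¹` must give integer translations near the ends; comparing their lengths
forces `h` to commute with `x ↦ x + 1` there (`mem_evPer_of_conj`). Hence `Aut⁺ F` is the group
`EndPer` (`endPerEquiv`). Each `h` in it induces a circle map at either end, and both are trivial
exactly when `h` lies in `F`.

Presentation. The relators hold for the maps by a finite computation on dyadic intervals
(`checkZ_relList`), so the presented group `P` maps to `EndPer` (`toEndPer`). The kernel relators
present `F` (`exists_hom_of_relators`), which gives `inclF : F → P`. The action relators make its
image normal (`conj_inclF`). In the quotient the words in `x₀, x₁` vanish, so the quotient is the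
product of two commuting subgroups, generated by `y₀, y₁, s` and by `z₀, z₁, t`, each of which
satisfies the six relators of `T`. These relators present `T` (`eq_one_of_map_thompsonT_eq_one`) and
the generators generate it (`exists_map_eq`), so the quotient is `T × T`. As `toEndPer` is bijective
on `F` and on the quotients by `F`, it is an isomorphism (`toEndPer_bijective`).

The presentation of `F` rests on normal forms: the two relators imply `x_j x_i = x_i x_{j+1}` for
all `i < j`, every element becomes a quotient of two ordered positive words, and the exponents of
such a word can be read off from its action on the line. The presentation of `T` rests on a double
coset decomposition: the relators show that `F ∪ F r F` is closed under multiplication, where `F` is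
the stabilizer of `0` in `T` by way of the map `psi` from the line to the open unit interval. An
element of `F r F` moves `0`, and `F` acts faithfully.

Products of order automorphisms are read from right to left, words from left to right. For this
reason each generator acts through the inverse of its map. -/

theorem isDyadic_int (n : ℤ) : IsDyadic (n : ℝ) := ⟨n, 0, by simp⟩

theorem IsDyadic.sub {x y : ℝ} (hx : IsDyadic x) (hy : IsDyadic y) : IsDyadic (x - y) := by
  simpa [sub_eq_add_neg] using hx.add hy.neg

/-! ### A local characterization of piecewise linear maps -/

/-- Along the filter `l`, the map `f` is given by one admissible linear formula. -/
def AffGerm (f : ℝ → ℝ) (l : Filter ℝ) : Prop :=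
  ∃ (k : ℤ) (c : ℝ), IsDyadic c ∧ ∀ᶠ y in l, f y = (2 : ℝ) ^ k * y + c

/-- A choice, at every point, of a one-sided or two-sided neighbourhood filter that is respected by
increasing affine maps. -/
structure IsSide (σ : ℝ → Filter ℝ) : Prop where
  pure_le : ∀ x, pure x ≤ σ x
  tendsto : ∀ (k : ℤ) (c x : ℝ),
    Tendsto (fun y => (2 : ℝ) ^ k * y + c) (σ x) (σ ((2 : ℝ) ^ k * x + c))

theorem isSide_nhds : IsSide 𝓝 where
  pure_le := pure_le_nhds
  tendsto k c x := Continuous.tendsto (by fun_prop) x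

theorem isSide_nhdsGE : IsSide (fun x => 𝓝[≥] x) where
  pure_le x := pure_le_nhdsWithin Set.self_mem_Ici
  tendsto k c x := by
    refine tendsto_nhdsWithin_iff.2 ⟨tendsto_nhdsWithin_of_tendsto_nhds
      (Continuous.tendsto (by fun_prop) x), ?_⟩
    filter_upwards [self_mem_nhdsWithin] with y hy
    have : (0 : ℝ) < 2 ^ k := by positivity
    simp only [Set.mem_Ici] at hy ⊢
    gcongr

theorem isSide_nhdsLE : IsSide (fun x => 𝓝[≤] x) where
  pure_le x := pure_le_nhdsWithin Set.self_mem_Iic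
  tendsto k c x := by
    refine tendsto_nhdsWithin_iff.2 ⟨tendsto_nhdsWithin_of_tendsto_nhds
      (Continuous.tendsto (by fun_prop) x), ?_⟩
    filter_upwards [self_mem_nhdsWithin] with y hy
    have : (0 : ℝ) < 2 ^ k := by positivity
    simp only [Set.mem_Iic] at hy ⊢
    gcongr

namespace AffGerm

theorem congr {f g : ℝ → ℝ} {l : Filter ℝ} (h : AffGerm f l) (hg : ∀ᶠ y in l, g y = f y) :
    AffGerm g l := by
  obtain ⟨k, c, hc, h⟩ := h
  exact ⟨k, c, hc, by filter_upwards [h, hg] with y h1 h2; rw [h2, h1]⟩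

/-- Increasing affine maps respect the chosen sides, so the germ of `f` at `g x` pulls back to the
same side of `x`. Neither map has to be a bijection of the line. -/
theorem comp {σ : ℝ → Filter ℝ} (hσ : IsSide σ) {f g : ℝ → ℝ} {x : ℝ} (hg : AffGerm g (σ x))
    (hf : AffGerm f (σ (g x))) : AffGerm (fun y => f (g y)) (σ x) := by
  obtain ⟨k, c, hc, h⟩ := hg
  obtain ⟨l, d, hd, h'⟩ := hf
  refine ⟨l + k, (2 : ℝ) ^ l * c + d, (hc.two_zpow_mul l).add hd, ?_⟩
  have hx : g x = (2 : ℝ) ^ k * x + c := hσ.pure_le x h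
  rw [hx] at h'
  filter_upwards [h, hσ.tendsto k c x h'] with y h1 h2
  rw [h1]
  refine (h2 : f _ = _).trans ?_
  rw [zpow_add₀ (by norm_num)]
  ring

/-- Near `f x` the inverse affine formula produces preimages under `f`, and a left inverse recovers
them. This covers the inverse of `psi`, which is meaningful on the open unit interval only. -/
theorem inverse {σ : ℝ → Filter ℝ} (hσ : IsSide σ) {f g : ℝ → ℝ} (hgf : ∀ y, g (f y) = y) {x : ℝ}
    (hf : AffGerm f (σ x)) : AffGerm g (σ (f x)) := by
  obtain ⟨k, c, hc, h⟩ := hf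
  have hx : f x = (2 : ℝ) ^ k * x + c := hσ.pure_le x h
  have h2 : (2 : ℝ) ^ k * 2 ^ (-k) = 1 := by rw [← zpow_add₀ (by norm_num)]; simp
  refine ⟨-k, (2 : ℝ) ^ (-k) * (-c), hc.neg.two_zpow_mul _, ?_⟩
  have h3 := hσ.tendsto (-k) ((2 : ℝ) ^ (-k) * (-c)) (f x)
  have h4 : (2 : ℝ) ^ (-k) * f x + (2 : ℝ) ^ (-k) * (-c) = x := by
    rw [hx]; linear_combination x * h2
  rw [h4] at h3
  filter_upwards [h3 h] with z hz
  have hz : f _ = _ := hz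
  have h5 : f ((2 : ℝ) ^ (-k) * z + (2 : ℝ) ^ (-k) * (-c)) = z := by
    rw [hz]; linear_combination (z - c) * h2
  conv_lhs => rw [← h5]
  exact hgf _

end AffGerm

/-- A map that is given by admissible linear formulas on both sides of every point, and by one
such formula near every point that is not dyadic. -/
structure LocPL2 (f : ℝ → ℝ) : Prop where
  right : ∀ x, AffGerm f (𝓝[≥] x)
  left : ∀ x, AffGerm f (𝓝[≤] x)
  full : ∀ x, ¬ IsDyadic x → AffGerm f (𝓝 x)

theorem eq_of_affine_eq {m m' c c' y z : ℝ} (hyz : y ≠ z) (hy : m * y + c = m' * y + c')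
    (hz : m * z + c = m' * z + c') : m = m' ∧ c = c' := by
  have h : (m - m') * (y - z) = 0 := by linear_combination hy - hz
  have h1 : m = m' := by
    rcases mul_eq_zero.1 h with h | h
    · linarith
    · exact absurd (by linarith) hyz
  subst h1
  exact ⟨rfl, by linarith⟩

theorem IsPL2.locPL2 {f : ℝ → ℝ} (hf : IsPL2 f) : LocPL2 f := by
  obtain ⟨B, hB, hfin, h⟩ := hf
  -- Local finiteness: around every point at most the point itself is a breakpoint.
  have key : ∀ x : ℝ, ∃ ε > 0, ∀ y ∈ B, |y - x| < ε → y = x := by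
    intro x
    have h1 : ((B ∩ Set.Icc (x - 1) (x + 1)) \ {x}).Finite := (hfin _ _).subset Set.sdiff_subset
    obtain ⟨ε, hε, h2⟩ := Metric.isOpen_iff.1 h1.isClosed.isOpen_compl x (by simp)
    refine ⟨min ε 1, by positivity, fun y hy hyx => ?_⟩
    by_contra hne
    have h3 := h2 (show y ∈ Metric.ball x ε from by
      rw [Metric.mem_ball, Real.dist_eq]; exact hyx.trans_le (min_le_left _ _))
    have h4 := abs_lt.1 (hyx.trans_le (min_le_right _ _))
    exact h3 ⟨⟨hy, by constructor <;> linarith⟩, hne⟩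
  refine ⟨fun x => ?_, fun x => ?_, fun x hx => ?_⟩
  · obtain ⟨ε, hε, hk⟩ := key x
    obtain ⟨k, c, hc, hkc⟩ := h x (x + ε) (by linarith) (by
      rw [Set.disjoint_left]
      intro y hy hy'
      have := hk y hy (by rw [abs_lt]; constructor <;> linarith [hy'.1, hy'.2])
      linarith [hy'.1])
    refine ⟨k, c, hc, ?_⟩
    filter_upwards [Icc_mem_nhdsGE (show x < x + ε by linarith)] with y hy using hkc y hy
  · obtain ⟨ε, hε, hk⟩ := key x
    obtain ⟨k, c, hc, hkc⟩ := h (x - ε) x (by linarith) (by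
      rw [Set.disjoint_left]
      intro y hy hy'
      have := hk y hy (by rw [abs_lt]; constructor <;> linarith [hy'.1, hy'.2])
      linarith [hy'.2])
    refine ⟨k, c, hc, ?_⟩
    filter_upwards [Icc_mem_nhdsLE (show x - ε < x by linarith)] with y hy using hkc y hy
  · obtain ⟨ε, hε, hk⟩ := key x
    obtain ⟨k, c, hc, hkc⟩ := h (x - ε) (x + ε) (by linarith) (by
      rw [Set.disjoint_left]
      intro y hy hy'
      have := hk y hy (by rw [abs_lt]; constructor <;> linarith [hy'.1, hy'.2])
      exact hx (this ▸ hB y hy))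
    refine ⟨k, c, hc, ?_⟩
    filter_upwards [Icc_mem_nhds (show x - ε < x by linarith) (show x < x + ε by linarith)] with
      y hy using hkc y hy

/-- The breakpoints are the points without a two-sided affine germ. One-sided germs isolate them,
compactness makes them locally finite, and connectedness makes the formula constant between them. -/
theorem LocPL2.isPL2 {f : ℝ → ℝ} (hf : LocPL2 f) : IsPL2 f := by
  refine ⟨{x | ¬ AffGerm f (𝓝 x)}, ?_, ?_, ?_⟩
  · intro x hx
    by_contra h
    exact hx (hf.full x h)
  · intro a b
    have h1 : ∀ x : ℝ, ∃ U ∈ 𝓝 x, ∀ y ∈ U, ¬ AffGerm f (𝓝 y) → y = x := by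
      intro x
      obtain ⟨k, c, hc, h⟩ := hf.right x
      obtain ⟨k', c', hc', h'⟩ := hf.left x
      obtain ⟨u, hu, hu'⟩ := mem_nhdsGE_iff_exists_Ico_subset.1 h
      obtain ⟨v, hv, hv'⟩ := mem_nhdsLE_iff_exists_Ioc_subset.1 h'
      refine ⟨Set.Ioo v u, Ioo_mem_nhds hv hu, fun y hy hy' => ?_⟩
      by_contra hne
      rcases lt_or_gt_of_ne hne with hlt | hlt
      · refine hy' ⟨k', c', hc', ?_⟩
        filter_upwards [Ioo_mem_nhds hy.1 hlt] with z hz using hv' ⟨hz.1, hz.2.le⟩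
      · refine hy' ⟨k, c, hc, ?_⟩
        filter_upwards [Ioo_mem_nhds hlt hy.2] with z hz using hu' ⟨hz.1.le, hz.2⟩
    choose U hU hU' using h1
    obtain ⟨t, -, ht⟩ := (isCompact_Icc (a := a) (b := b)).elim_nhds_subcover U fun x _ => hU x
    refine t.finite_toSet.subset fun y hy => ?_
    obtain ⟨x, hx, hyx⟩ := Set.mem_iUnion₂.1 (ht hy.2)
    rw [hU' x y hyx hy.1]
    exact hx
  · intro a b hab hd
    rcases hab.eq_or_lt with rfl | hab
    · obtain ⟨k, c, hc, h⟩ := hf.right a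
      refine ⟨k, c, hc, fun x hx => ?_⟩
      rw [Set.Icc_self, Set.mem_singleton_iff] at hx
      subst hx
      exact isSide_nhdsGE.pure_le x h
    have hg : ∀ x ∈ Set.Ioo a b, AffGerm f (𝓝 x) := by
      intro x hx
      by_contra h
      exact (Set.disjoint_left.1 hd : ∀ ⦃a⦄, _ → _) h hx
    have hm : (a + b) / 2 ∈ Set.Ioo a b := by constructor <;> linarith
    obtain ⟨k, c, hc, h⟩ := hg _ hm
    -- The points with the germ `(k, c)` form an open set. It is also closed in the interval,
    -- because two affine formulas that agree near some point coincide.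
    have hsub : Set.Ioo a b ⊆ {x | ∀ᶠ y in 𝓝 x, f y = (2 : ℝ) ^ k * y + c} := by
      refine isPreconnected_Ioo.subset_of_closure_inter_subset isOpen_setOfPred_eventually_nhds
        ⟨_, hm, h⟩ ?_
      rintro x ⟨hx, hxab⟩
      obtain ⟨k', c', -, h'⟩ := hg x hxab
      obtain ⟨z, hz, hz'⟩ := mem_closure_iff_nhds.1 hx _ (eventually_eventually_nhds.2 h')
      have h3 : ∀ᶠ y in 𝓝 z, f y = (2 : ℝ) ^ k' * y + c' := hz
      have h4 : ∀ᶠ y in 𝓝 z, f y = (2 : ℝ) ^ k * y + c := hz'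
      obtain ⟨ε, hε, h5⟩ := Metric.eventually_nhds_iff.1 (h3.and h4)
      obtain ⟨h6, h7⟩ := h5 (y := z) (by simpa using hε)
      obtain ⟨h8, h9⟩ := h5 (y := z + ε / 2) (by
        rw [Real.dist_eq, add_sub_cancel_left, abs_of_pos] <;> linarith)
      obtain ⟨h10, h11⟩ := eq_of_affine_eq (show z ≠ z + ε / 2 by linarith)
        (h7.symm.trans h6) (h9.symm.trans h8)
      rw [← h10, ← h11] at h'
      exact h'
    have hIoo : ∀ x ∈ Set.Ioo a b, f x = (2 : ℝ) ^ k * x + c := fun x hx => (hsub hx).self_of_nhds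
    refine ⟨k, c, hc, fun x hx => ?_⟩
    rcases hx.1.eq_or_lt with rfl | hxa
    · obtain ⟨k', c', -, h'⟩ := hf.right a
      obtain ⟨u, hu, hu'⟩ := mem_nhdsGE_iff_exists_Ico_subset.1 h'
      obtain ⟨v, hv1, hv2⟩ := exists_between (show a < min u b from lt_min hu hab)
      obtain ⟨w, hw1, hw2⟩ := exists_between hv1
      have e1 := hIoo v ⟨hv1, hv2.trans_le (min_le_right _ _)⟩
      have e2 := hIoo w ⟨hw1, hw2.trans (hv2.trans_le (min_le_right _ _))⟩
      have e3 := hu' ⟨hv1.le, hv2.trans_le (min_le_left _ _)⟩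
      have e4 := hu' ⟨hw1.le, hw2.trans (hv2.trans_le (min_le_left _ _))⟩
      obtain ⟨h10, h11⟩ := eq_of_affine_eq hw2.ne (e2.symm.trans e4) (e1.symm.trans e3)
      rw [h10, h11]
      exact hu' ⟨le_rfl, hu⟩
    rcases hx.2.eq_or_lt with rfl | hxb
    · obtain ⟨k', c', -, h'⟩ := hf.left x
      obtain ⟨u, hu, hu'⟩ := mem_nhdsLE_iff_exists_Ioc_subset.1 h'
      obtain ⟨v, hv1, hv2⟩ := exists_between (show max u a < x from max_lt hu hab)
      obtain ⟨w, hw1, hw2⟩ := exists_between hv2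
      have hu1 := le_max_left u a
      have hu2 := le_max_right u a
      have e1 := hIoo v ⟨by linarith, hv2⟩
      have e2 := hIoo w ⟨by linarith, hw2⟩
      have e3 := hu' (show v ∈ Set.Ioc u x from ⟨by linarith, hv2.le⟩)
      have e4 := hu' (show w ∈ Set.Ioc u x from ⟨by linarith, hw2.le⟩)
      obtain ⟨h10, h11⟩ := eq_of_affine_eq hw1.ne' (e2.symm.trans e4) (e1.symm.trans e3)
      rw [h10, h11]
      exact hu' ⟨hu, le_rfl⟩
    exact hIoo x ⟨hxa, hxb⟩

/-- A map that near every point agrees with some admissible map is admissible. -/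
theorem isPL2_of_eventuallyEq {f : ℝ → ℝ}
    (h : ∀ x, ∃ g : ℝ → ℝ, IsPL2 g ∧ ∀ᶠ y in 𝓝 x, f y = g y) : IsPL2 f := by
  refine LocPL2.isPL2 ⟨fun x => ?_, fun x => ?_, fun x hx => ?_⟩ <;> obtain ⟨g, hg, hfg⟩ := h x
  · exact (hg.locPL2.right x).congr (hfg.filter_mono nhdsWithin_le_nhds)
  · exact (hg.locPL2.left x).congr (hfg.filter_mono nhdsWithin_le_nhds)
  · exact (hg.locPL2.full x hx).congr hfg

/-- At a dyadic point it suffices to have an admissible map on either side. -/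
theorem isPL2_of_eventuallyEq_sides {f : ℝ → ℝ}
    (h : ∀ x, (∃ g : ℝ → ℝ, IsPL2 g ∧ ∀ᶠ y in 𝓝 x, f y = g y) ∨
      (IsDyadic x ∧ (∃ g : ℝ → ℝ, IsPL2 g ∧ ∀ᶠ y in 𝓝[≤] x, f y = g y) ∧
        ∃ g : ℝ → ℝ, IsPL2 g ∧ ∀ᶠ y in 𝓝[≥] x, f y = g y)) : IsPL2 f := by
  refine LocPL2.isPL2 ⟨fun x => ?_, fun x => ?_, fun x hx => ?_⟩ <;>
    obtain ⟨g, hg, hfg⟩ | ⟨hd, ⟨g, hg, hfg⟩, g', hg', hfg'⟩ := h x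
  · exact (hg.locPL2.right x).congr (hfg.filter_mono nhdsWithin_le_nhds)
  · exact (hg'.locPL2.right x).congr hfg'
  · exact (hg.locPL2.left x).congr (hfg.filter_mono nhdsWithin_le_nhds)
  · exact (hg.locPL2.left x).congr hfg
  · exact (hg.locPL2.full x hx).congr hfg
  · exact absurd hd hx

theorem isPL2_affine (k : ℤ) {c : ℝ} (hc : IsDyadic c) : IsPL2 (fun x => (2 : ℝ) ^ k * x + c) :=
  ⟨∅, by simp, by simp, fun _ _ _ _ => ⟨k, c, hc, fun _ _ => rfl⟩⟩


/-! ### Constructions of order automorphisms of the line -/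

/-- The affine map `x ↦ 2 ^ k * x + c`. -/
noncomputable def affIso (k : ℤ) (c : ℝ) : ℝ ≃o ℝ :=
  StrictMono.orderIsoOfRightInverse (fun x => (2 : ℝ) ^ k * x + c)
    (fun x y h => by have : (0 : ℝ) < 2 ^ k := by positivity
                     simp only; gcongr)
    (fun y => (y - c) / 2 ^ k) (fun y => by field_simp; ring)

@[simp] theorem affIso_apply (k : ℤ) (c x : ℝ) : affIso k c x = (2 : ℝ) ^ k * x + c := rfl

theorem affIso_mem (k : ℤ) {c : ℝ} (hc : IsDyadic c) : affIso k c ∈ PL2Plus := isPL2_affine k hc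

/-- Conjugation by `x ↦ -x`. -/
def reflect : (ℝ ≃o ℝ) →* (ℝ ≃o ℝ) where
  toFun f :=
    { toFun := fun x => -f (-x)
      invFun := fun x => -f.symm (-x)
      left_inv := fun x => by simp
      right_inv := fun x => by simp
      map_rel_iff' := fun {a b} => by simp }
  map_one' := by ext x; simp
  map_mul' f g := by ext x; simp

@[simp] theorem reflect_apply (f : ℝ ≃o ℝ) (x : ℝ) : reflect f x = -f (-x) := rfl

@[simp] theorem reflect_reflect (f : ℝ ≃o ℝ) : reflect (reflect f) = f := by ext x; simp

theorem reflect_mem {f : ℝ ≃o ℝ} (hf : f ∈ PL2Plus) : reflect f ∈ PL2Plus := by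
  obtain ⟨B, hB, hfin, h⟩ := hf
  refine ⟨(fun x => -x) ⁻¹' B, fun b hb => by simpa using (hB _ hb).neg, fun a b => ?_,
    fun a b hab hd => ?_⟩
  · refine ((hfin (-b) (-a)).preimage neg_injective.injOn).subset ?_
    rintro x ⟨hx, hx1, hx2⟩
    exact ⟨hx, neg_le_neg hx2, neg_le_neg hx1⟩
  · obtain ⟨k, c, hc, hk⟩ := h (-b) (-a) (by linarith) (by
      rw [Set.disjoint_left]
      intro y hy hy'
      exact (Set.disjoint_left.1 hd : ∀ ⦃a⦄, _ → _) (show -y ∈ (fun x => -x) ⁻¹' B by simpa using hy)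
        ⟨by linarith [hy'.2], by linarith [hy'.1]⟩)
    refine ⟨k, -c, hc.neg, fun x hx => ?_⟩
    rw [reflect_apply, hk (-x) ⟨by linarith [hx.2], by linarith [hx.1]⟩]
    ring

/-- The map that is `f` to the left of `p` and `g` to the right of `p`. -/
noncomputable def glue (p : ℝ) (f g : ℝ ≃o ℝ) (h : f p = g p) : ℝ ≃o ℝ :=
  StrictMono.orderIsoOfRightInverse (fun x => if x ≤ p then f x else g x)
    (by
      intro x y hxy
      simp only
      split_ifs with h1 h2 h2
      · exact f.strictMono hxy
      · exact (f.monotone h1).trans_lt (h ▸ g.strictMono (not_le.1 h2))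
      · exact absurd (hxy.le.trans h2) h1
      · exact g.strictMono hxy)
    (fun y => if y ≤ f p then f.symm y else g.symm y)
    (by
      intro y
      simp only
      by_cases hy : y ≤ f p
      · rw [if_pos hy, if_pos (by rw [← f.le_iff_le]; simpa using hy)]; simp
      · rw [if_neg hy, if_neg (by rw [← g.le_iff_le]; simpa [← h] using hy)]; simp)

theorem glue_apply (p : ℝ) (f g : ℝ ≃o ℝ) (h : f p = g p) (x : ℝ) :
    glue p f g h x = if x ≤ p then f x else g x := rfl

theorem glue_of_le {p : ℝ} {f g : ℝ ≃o ℝ} (h : f p = g p) {x : ℝ} (hx : x ≤ p) :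
    glue p f g h x = f x := if_pos hx

theorem glue_of_ge {p : ℝ} {f g : ℝ ≃o ℝ} (h : f p = g p) {x : ℝ} (hx : p ≤ x) :
    glue p f g h x = g x := by
  rcases hx.eq_or_lt with rfl | hx
  · rw [glue_of_le h le_rfl, h]
  · exact if_neg (not_le.2 hx)

theorem glue_mem {p : ℝ} {f g : ℝ ≃o ℝ} (h : f p = g p) (hp : IsDyadic p) (hf : f ∈ PL2Plus)
    (hg : g ∈ PL2Plus) : glue p f g h ∈ PL2Plus := by
  refine isPL2_of_eventuallyEq_sides fun x => ?_
  rcases lt_trichotomy x p with hx | rfl | hx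
  · exact Or.inl ⟨f, hf, by filter_upwards [Iio_mem_nhds hx] with y hy using glue_of_le h hy.le⟩
  · refine Or.inr ⟨hp, ⟨f, hf, ?_⟩, ⟨g, hg, ?_⟩⟩
    · filter_upwards [self_mem_nhdsWithin] with y hy using glue_of_le h hy
    · filter_upwards [self_mem_nhdsWithin] with y hy using glue_of_ge h hy
  · exact Or.inl ⟨g, hg, by filter_upwards [Ioi_mem_nhds hx] with y hy using glue_of_ge h hy.le⟩

/-- The map that acts on every interval `[n, n + 1]` like `U` on `[0, 1]`. -/
noncomputable def perIso (U : ℝ ≃o ℝ) (h0 : U 0 = 0) (h1 : U 1 = 1) : ℝ ≃o ℝ :=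
  StrictMono.orderIsoOfRightInverse (fun x => ⌊x⌋ + U (Int.fract x))
    (by
      intro x y hxy
      have hx0 : U (Int.fract x) < 1 := h1 ▸ U.strictMono (Int.fract_lt_one x)
      have hy0 : 0 ≤ U (Int.fract y) := h0 ▸ U.monotone (Int.fract_nonneg y)
      rcases (Int.floor_le_floor hxy.le).eq_or_lt with h | h
      · have : Int.fract x < Int.fract y := by rw [Int.fract, Int.fract, h]; linarith
        have := U.strictMono this
        simp only [h]; linarith
      · have : (⌊x⌋ : ℝ) + 1 ≤ ⌊y⌋ := by exact_mod_cast h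
        simp only; linarith)
    (fun y => ⌊y⌋ + U.symm (Int.fract y))
    (by
      intro y
      have h0' : U.symm 0 = 0 := by rw [OrderIso.symm_apply_eq, h0]
      have h1' : U.symm 1 = 1 := by rw [OrderIso.symm_apply_eq, h1]
      have a1 : U.symm (Int.fract y) < 1 := h1' ▸ U.symm.strictMono (Int.fract_lt_one y)
      have a0 : 0 ≤ U.symm (Int.fract y) := h0' ▸ U.symm.monotone (Int.fract_nonneg y)
      have e1 : ⌊(⌊y⌋ : ℝ) + U.symm (Int.fract y)⌋ = ⌊y⌋ := by
        rw [Int.floor_intCast_add, Int.floor_eq_zero_iff.2 ⟨a0, a1⟩, add_zero]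
      have e2 : Int.fract ((⌊y⌋ : ℝ) + U.symm (Int.fract y)) = U.symm (Int.fract y) := by
        rw [Int.fract, e1]; ring
      simp only [e1, e2]
      simp)

theorem perIso_apply (U : ℝ ≃o ℝ) (h0 : U 0 = 0) (h1 : U 1 = 1) (x : ℝ) :
    perIso U h0 h1 x = ⌊x⌋ + U (Int.fract x) := rfl

theorem perIso_of_mem {U : ℝ ≃o ℝ} (h0 : U 0 = 0) (h1 : U 1 = 1) (n : ℤ) {x : ℝ} (hx : n ≤ x)
    (hx' : x ≤ n + 1) : perIso U h0 h1 x = n + U (x - n) := by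
  rw [perIso_apply]
  rcases hx'.eq_or_lt with rfl | hx'
  · have : ⌊(n : ℝ) + 1⌋ = n + 1 := by simp
    rw [Int.fract, this]
    push_cast
    rw [sub_self, h0, add_sub_cancel_left, h1]; ring
  · have : ⌊x⌋ = n := Int.floor_eq_iff.2 ⟨hx, hx'⟩
    rw [Int.fract, this]

theorem perIso_add_one {U : ℝ ≃o ℝ} (h0 : U 0 = 0) (h1 : U 1 = 1) (x : ℝ) :
    perIso U h0 h1 (x + 1) = perIso U h0 h1 x + 1 := by
  simp only [perIso_apply, Int.floor_add_one, Int.fract_add_one]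
  push_cast; ring

theorem perIso_mem {U : ℝ ≃o ℝ} (h0 : U 0 = 0) (h1 : U 1 = 1) (hU : U ∈ PL2Plus) :
    perIso U h0 h1 ∈ PL2Plus := by
  have key : ∀ n : ℤ, IsPL2 (fun x : ℝ => n + U (x - n)) := by
    intro n
    have := PL2Plus.mul_mem (PL2Plus.mul_mem (affIso_mem 0 (isDyadic_int n)) hU)
      (affIso_mem 0 (isDyadic_int n).neg)
    have e : (fun x : ℝ => n + U (x - n)) = (affIso 0 n * U * affIso 0 (-n) : ℝ ≃o ℝ) := by
      ext x; simp [add_comm, sub_eq_add_neg]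
    rw [e]
    exact this
  refine isPL2_of_eventuallyEq_sides fun x => ?_
  have hfl := Int.floor_le x
  have hlt := Int.lt_floor_add_one x
  rcases hfl.eq_or_lt with hx | hx
  · refine Or.inr ⟨hx ▸ isDyadic_int _, ⟨_, key (⌊x⌋ - 1), ?_⟩, ⟨_, key ⌊x⌋, ?_⟩⟩
    · filter_upwards [Icc_mem_nhdsLE (show x - 1 < x by linarith)] with y hy
      refine perIso_of_mem h0 h1 _ ?_ ?_ <;> push_cast <;> linarith [hy.1, hy.2]
    · filter_upwards [Icc_mem_nhdsGE (show x < x + 1 by linarith)] with y hy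
      exact perIso_of_mem h0 h1 _ (by linarith [hy.1]) (by linarith [hy.2])
  · refine Or.inl ⟨_, key ⌊x⌋, ?_⟩
    filter_upwards [Ioo_mem_nhds hx hlt] with y hy
    exact perIso_of_mem h0 h1 _ hy.1.le hy.2.le

/-! ### The eight generators -/

theorem isDyadic_half : IsDyadic (1 / 2) := ⟨1, 1, by norm_num⟩

theorem isDyadic_quarter : IsDyadic (1 / 4) := ⟨1, 2, by norm_num⟩

/-- The order automorphism that restricts to `unit0` on `[0, 1]`. -/
noncomputable def unit0Iso : ℝ ≃o ℝ :=
  glue (1 / 4) (affIso 1 0)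
    (glue (1 / 2) (affIso 0 (1 / 4)) (affIso (-1) (1 / 2)) (by norm_num [affIso_apply]))
    (by norm_num [glue_apply])

theorem unit0Iso_apply (u : ℝ) : unit0Iso u = unit0 u := by
  simp only [unit0Iso, glue_apply, affIso_apply, unit0, zpow_one, zpow_zero, zpow_neg]
  split_ifs <;> ring

theorem unit0Iso_mem : unit0Iso ∈ PL2Plus :=
  glue_mem _ isDyadic_quarter (affIso_mem _ (by simpa using isDyadic_int 0))
    (glue_mem _ isDyadic_half (affIso_mem _ isDyadic_quarter) (affIso_mem _ isDyadic_half))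

/-- The order automorphism that restricts to `unit1` on `[0, 1]`. -/
noncomputable def unit1Iso : ℝ ≃o ℝ :=
  glue (1 / 2) 1 (affIso (-1) (1 / 2) * unit0Iso * affIso 1 (-1)) (by
    norm_num [unit0Iso_apply, unit0])

theorem unit1Iso_apply (u : ℝ) : unit1Iso u = unit1 u := by
  simp only [unit1Iso, glue_apply, unit1, RelIso.mul_apply, affIso_apply, unit0Iso_apply,
    RelIso.one_apply, zpow_one, zpow_neg]
  split_ifs
  · rfl
  · rw [← sub_eq_add_neg]; ring

theorem unit1Iso_mem : unit1Iso ∈ PL2Plus :=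
  glue_mem _ isDyadic_half (PL2Plus.one_mem) (PL2Plus.mul_mem (PL2Plus.mul_mem
    (affIso_mem _ isDyadic_half) unit0Iso_mem)
    (affIso_mem _ (by simpa using (isDyadic_int 1).neg)))

/-- The lift of the first generator of `T`. -/
noncomputable def per0 : ℝ ≃o ℝ :=
  perIso unit0Iso (by norm_num [unit0Iso_apply, unit0]) (by norm_num [unit0Iso_apply, unit0])

/-- The lift of the second generator of `T`. -/
noncomputable def per1 : ℝ ≃o ℝ :=
  perIso unit1Iso (by norm_num [unit1Iso_apply, unit1])
    (by norm_num [unit1Iso_apply, unit1, unit0])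

theorem per0_mem : per0 ∈ PL2Plus := perIso_mem _ _ unit0Iso_mem

theorem per1_mem : per1 ∈ PL2Plus := perIso_mem _ _ unit1Iso_mem

theorem per0_apply (x : ℝ) : per0 x = ⌊x⌋ + unit0 (Int.fract x) := by
  rw [per0, perIso_apply, unit0Iso_apply]

theorem per1_apply (x : ℝ) : per1 x = ⌊x⌋ + unit1 (Int.fract x) := by
  rw [per1, perIso_apply, unit1Iso_apply]

theorem per0_zero : per0 0 = 0 := by norm_num [per0_apply, unit0]

theorem per1_zero : per1 0 = 0 := by norm_num [per1_apply, unit1]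

/-- The order automorphisms of the line named by the generators. -/
noncomputable def genIso : Gen → ℝ ≃o ℝ
  | .x0 => affIso 0 1
  | .x1 => glue 0 (affIso 0 0) (glue 1 (affIso 1 0) (affIso 0 1) (by norm_num)) (by norm_num [glue_apply])
  | .y0 => glue 0 (affIso 0 0) per0 (by simp [per0_zero])
  | .y1 => glue 0 (affIso 0 0) per1 (by simp [per1_zero])
  | .s => glue 0 (affIso 0 0) (glue (1 / 2) (affIso 1 0) (affIso 0 (1 / 2)) (by norm_num))
      (by norm_num [glue_apply])
  | .z0 => glue 0 per0 (affIso 0 0) (by simp [per0_zero])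
  | .z1 => glue 0 per1 (affIso 0 0) (by simp [per1_zero])
  | .t => glue 0 (glue (-1 / 2) (affIso 0 (-1 / 2)) (affIso 1 0) (by norm_num)) (affIso 0 0)
      (by norm_num [glue_apply])

theorem genIso_apply (i : Gen) (x : ℝ) : genIso i x = genMap i x := by
  cases i
  · simp [genIso, genMap]
  · simp [genIso, genMap, glue_apply]
  · simp [genIso, genMap, glue_apply, per0_apply]
  · simp [genIso, genMap, glue_apply, per1_apply]
  · simp [genIso, genMap, glue_apply]
  · simp only [genIso, genMap, glue_apply, affIso_apply, zpow_zero, one_mul, add_zero]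
    rcases lt_trichotomy x 0 with h | rfl | h
    · rw [if_pos h.le, if_neg (not_le.2 h), per0_apply]
    · simp [per0_zero]
    · rw [if_neg (not_le.2 h), if_pos h.le]
  · simp only [genIso, genMap, glue_apply, affIso_apply, zpow_zero, one_mul, add_zero]
    rcases lt_trichotomy x 0 with h | rfl | h
    · rw [if_pos h.le, if_neg (not_le.2 h), per1_apply]
    · simp [per1_zero]
    · rw [if_neg (not_le.2 h), if_pos h.le]
  · simp only [genIso, genMap, glue_apply, affIso_apply, zpow_zero, one_mul, add_zero]
    split_ifs <;> norm_num at * <;> linarith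

theorem genIso_mem (i : Gen) : genIso i ∈ PL2Plus := by
  have d0 : IsDyadic 0 := by simpa using isDyadic_int 0
  have d1 : IsDyadic 1 := by simpa using isDyadic_int 1
  have d2 : IsDyadic (-1 / 2) := by convert isDyadic_half.neg using 1; norm_num
  have hI := affIso_mem 0 d0
  cases i <;> unfold genIso
  · exact affIso_mem _ d1
  · refine glue_mem ?_ d0 hI (glue_mem ?_ d1 (affIso_mem _ d0) (affIso_mem _ d1))
    norm_num
  · refine glue_mem ?_ d0 hI per0_mem
  · refine glue_mem ?_ d0 hI per1_mem
  · refine glue_mem ?_ d0 hI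
      (glue_mem ?_ isDyadic_half (affIso_mem _ d0) (affIso_mem _ isDyadic_half))
    norm_num
  · refine glue_mem ?_ d0 per0_mem hI
  · refine glue_mem ?_ d0 per1_mem hI
  · refine glue_mem ?_ d0 (glue_mem ?_ d2 (affIso_mem _ d2) (affIso_mem _ d0)) hI
    norm_num

/-- The last breakpoint that breaks periodicity is the one of `x₁` at `1`; the one of `s` is at `1 /
2`. -/
theorem genIso_add_one_of_le (i : Gen) {x : ℝ} (hx : 1 ≤ x) :
    genIso i (x + 1) = genIso i x + 1 := by
  have a1 : ¬ x ≤ 0 := by linarith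
  have a2 : ¬ x + 1 ≤ 0 := by linarith
  have a4 : ¬ x ≤ 1 / 2 := by linarith
  have a5 : ¬ x + 1 ≤ 1 / 2 := by linarith
  cases i
  · simp [genIso]
  · simp only [genIso]
    rw [glue_of_ge _ (by linarith : 0 ≤ x + 1), glue_of_ge _ (by linarith : 0 ≤ x),
      glue_of_ge _ (by linarith : 1 ≤ x + 1), glue_of_ge _ hx]
    simp
  · simp only [genIso, glue_apply, if_neg a1, if_neg a2]; exact perIso_add_one _ _ _
  · simp only [genIso, glue_apply, if_neg a1, if_neg a2]; exact perIso_add_one _ _ _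
  · simp only [genIso, glue_apply, if_neg a1, if_neg a2, if_neg a4, if_neg a5]
    simp; ring
  all_goals simp only [genIso, glue_apply, if_neg a1, if_neg a2, affIso_apply, zpow_zero, one_mul, add_zero]

theorem genIso_sub_one_of_le (i : Gen) {x : ℝ} (hx : x ≤ -1) :
    genIso i (x - 1) = genIso i x - 1 := by
  have a1 : x ≤ 0 := by linarith
  have a2 : x - 1 ≤ 0 := by linarith
  have a4 : x ≤ -1 / 2 := by linarith
  have a5 : x - 1 ≤ -1 / 2 := by linarith
  have hp : ∀ U h0 h1, perIso U h0 h1 (x - 1) = perIso U h0 h1 x - 1 := by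
    intro U h0 h1
    have := perIso_add_one h0 h1 (x - 1)
    rw [sub_add_cancel] at this
    linarith
  cases i
  · simp [genIso]
  · simp only [genIso, glue_apply, if_pos a1, if_pos a2, affIso_apply, zpow_zero, one_mul, add_zero]
  · simp only [genIso, glue_apply, if_pos a1, if_pos a2, affIso_apply, zpow_zero, one_mul, add_zero]
  · simp only [genIso, glue_apply, if_pos a1, if_pos a2, affIso_apply, zpow_zero, one_mul, add_zero]
  · simp only [genIso, glue_apply, if_pos a1, if_pos a2, affIso_apply, zpow_zero, one_mul, add_zero]
  · simp only [genIso, glue_apply, if_pos a1, if_pos a2]; exact hp _ _ _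
  · simp only [genIso, glue_apply, if_pos a1, if_pos a2]; exact hp _ _ _
  · simp only [genIso, glue_apply, if_pos a1, if_pos a2, if_pos a4, if_pos a5]
    simp; ring


/-! ### The infinite family of generators of `F` and normal forms -/

section NormalForm

variable {G : Type*} [Group G] {a b : G}

theorem comm_eq_one_iff {x y : G} : comm x y = 1 ↔ Commute x y := by
  rw [comm, mul_inv_eq_one, mul_inv_eq_iff_eq_mul]; rfl

/-- The generators `a, b, a⁻¹ b a, a⁻² b a², …`. -/
def fgen (a b : G) : ℕ → G
  | 0 => a
  | n + 1 => a⁻¹ ^ n * b * a ^ n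

theorem fgen_shift (a b : G) (n : ℕ) : fgen a b (n + 1) * a = a * fgen a b (n + 2) := by
  simp only [fgen, pow_succ' a⁻¹ n, pow_succ a n]; group

theorem fgen_shift' (a b : G) (n : ℕ) : fgen a b (n + 2) = a⁻¹ * fgen a b (n + 1) * a := by
  rw [mul_assoc, fgen_shift]; group

theorem fgen_one (a b : G) : fgen a b 1 = b := by simp [fgen]

/-- The case `n = 0` is the first relator; conjugation by `a` shifts all indices and gives the rest.
-/
theorem fgen_succ_mul (h1 : f1 a b = 1) (n : ℕ) :
    fgen a b (n + 2) * fgen a b (n + 1) = fgen a b (n + 1) * fgen a b (n + 3) := by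
  induction n with
  | zero =>
    have h := comm_eq_one_iff.1 h1
    have h2 : fgen a b 2 = a⁻¹ * b * a := by simp [fgen]
    have h3 : fgen a b 3 = a⁻¹ * fgen a b 2 * a := fgen_shift' a b 1
    rw [← h2] at h
    simp only [zero_add]
    rw [h3, fgen_one]
    have h4 : a * b⁻¹ * fgen a b 2 = fgen a b 2 * (a * b⁻¹) := h
    calc fgen a b 2 * b = b * a⁻¹ * (a * b⁻¹ * fgen a b 2) * b := by group
      _ = _ := by rw [h4]; group
  | succ n ih =>
    calc _ = (a⁻¹ * fgen a b (n + 2) * a) * (a⁻¹ * fgen a b (n + 1) * a) :=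
          congrArg₂ (· * ·) (fgen_shift' a b (n + 1)) (fgen_shift' a b n)
      _ = a⁻¹ * (fgen a b (n + 2) * fgen a b (n + 1)) * a := by group
      _ = (a⁻¹ * fgen a b (n + 1) * a) * (a⁻¹ * fgen a b (n + 3) * a) := by rw [ih]; group
      _ = _ := (congrArg₂ (· * ·) (fgen_shift' a b n) (fgen_shift' a b (n + 2))).symm

/-- The two relators are the cases `n = 0, 1`. Since `x_{n+4} = x_{n+2}⁻¹ x_{n+3} x_{n+2}` by the
first relator, the centralizer of `a b⁻¹` contains all later generators. This is why two relators
replace infinitely many. -/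
theorem commute_fgen (h1 : f1 a b = 1) (h2 : f2 a b = 1) (n : ℕ) :
    Commute (a * b⁻¹) (fgen a b (n + 2)) := by
  induction n using Nat.twoStepInduction with
  | zero => simpa [fgen] using comm_eq_one_iff.1 h1
  | one => simpa [fgen] using comm_eq_one_iff.1 h2
  | more n ih1 ih2 =>
    have : fgen a b (n + 2 + 2) = (fgen a b (n + 2))⁻¹ * (fgen a b (n + 1 + 2)) * fgen a b (n + 2) := by
      rw [mul_assoc]
      exact eq_inv_mul_of_mul_eq (fgen_succ_mul h1 (n + 1)).symm
    rw [this]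
    exact (ih1.inv_right.mul_right ih2).mul_right ih1

/-- For `i = 0` this is the definition of the family, for `i = 1` it says that `a b⁻¹` commutes with
`x_j`, and conjugation by `a` raises both indices. -/
theorem fgen_mul (h1 : f1 a b = 1) (h2 : f2 a b = 1) {i j : ℕ} (hij : i < j) :
    fgen a b j * fgen a b i = fgen a b i * fgen a b (j + 1) := by
  obtain ⟨d, rfl⟩ := Nat.exists_eq_add_of_lt hij
  rcases i with _ | i
  · rw [zero_add]; exact fgen_shift a b d
  · induction i with
    | zero =>
      have h : a * b⁻¹ * fgen a b (d + 2) = fgen a b (d + 2) * (a * b⁻¹) := commute_fgen h1 h2 d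
      have e : 0 + 1 + d + 1 = d + 2 := by ring
      rw [e, fgen_shift' a b (d + 1), fgen_one]
      calc fgen a b (d + 2) * b = b * a⁻¹ * (a * b⁻¹ * fgen a b (d + 2)) * b := by group
        _ = _ := by rw [h]; group
    | succ n ih =>
      have ih := ih (by omega)
      have e1 : n + 1 + 1 + d + 1 = (n + 1 + d) + 2 := by ring
      rw [e1, fgen_shift' a b n, fgen_shift' a b (n + 1 + d), fgen_shift' a b (n + 1 + d + 1)]
      calc _ = a⁻¹ * (fgen a b (n + 1 + d + 1) * fgen a b (n + 1)) * a := by group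
        _ = _ := by rw [ih]; group

theorem fgen_mul_pow (h1 : f1 a b = 1) (h2 : f2 a b = 1) {i j : ℕ} (hij : i < j) (e : ℕ) :
    fgen a b j * fgen a b i ^ e = fgen a b i ^ e * fgen a b (j + e) := by
  induction e with
  | zero => simp
  | succ e ih =>
    rw [pow_succ, ← mul_assoc, ih, mul_assoc, fgen_mul h1 h2 (show i < j + e by omega), mul_assoc]
    rfl

/-- The positive normal form `x_k ^ l₀ * x_{k+1} ^ l₁ * ⋯`. -/
def posNF (a b : G) : ℕ → List ℕ → G
  | _, [] => 1
  | k, e :: l => fgen a b k ^ e * posNF a b (k + 1) l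

theorem posNF_eq (a b : G) (k : ℕ) (l : List ℕ) :
    posNF a b k l = fgen a b k ^ l.headD 0 * posNF a b (k + 1) l.tail := by
  cases l <;> simp [posNF]

theorem exists_posNF_fgen (a b : G) (d k : ℕ) : ∃ l, fgen a b (k + d) = posNF a b k l := by
  induction d generalizing k with
  | zero => exact ⟨[1], by simp [posNF]⟩
  | succ d ih =>
    obtain ⟨l, hl⟩ := ih (k + 1)
    exact ⟨0 :: l, by rw [posNF, pow_zero, one_mul, ← hl]; congr 1; ring⟩

/-- A letter `x_j` with `k < j` moves to the right past `x_k ^ e` and becomes `x_{j+e}`, until it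
meets its own index or the end of the word. -/
theorem exists_posNF_mul (h1 : f1 a b = 1) (h2 : f2 a b = 1) (l : List ℕ) {k j : ℕ} (hkj : k ≤ j) :
    ∃ l', fgen a b j * posNF a b k l = posNF a b k l' := by
  induction l generalizing k j with
  | nil =>
    obtain ⟨d, rfl⟩ := Nat.exists_eq_add_of_le hkj
    simpa [posNF] using exists_posNF_fgen a b d k
  | cons e l ih =>
    rcases hkj.eq_or_lt with rfl | hlt
    · exact ⟨(e + 1) :: l, by simp only [posNF, pow_succ', mul_assoc]⟩
    · obtain ⟨l', hl'⟩ := ih (show k + 1 ≤ j + e by omega)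
      exact ⟨e :: l', by
        simp only [posNF]
        rw [← mul_assoc, fgen_mul_pow h1 h2 hlt, mul_assoc, hl']⟩

theorem exists_posNF_mul_posNF (h1 : f1 a b = 1) (h2 : f2 a b = 1) (l l' : List ℕ) (k : ℕ) :
    ∃ l'', posNF a b k l * posNF a b 0 l' = posNF a b 0 l'' := by
  induction l generalizing k with
  | nil => exact ⟨l', by simp [posNF]⟩
  | cons e l ih =>
    induction e with
    | zero => simpa [posNF] using ih (k + 1)
    | succ e ihe =>
      obtain ⟨m, hm⟩ := ihe
      obtain ⟨m', hm'⟩ := exists_posNF_mul h1 h2 m (Nat.zero_le k)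
      refine ⟨m', ?_⟩
      rw [← hm', ← hm]
      simp only [posNF, pow_succ', mul_assoc]

/-- An inverse letter moves to the right through a positive word: `x_i⁻¹ x_k` is `x_{k+1} x_i⁻¹` for
`i < k` and `x_k x_{i+1}⁻¹` for `k < i`. It either cancels or comes out at the end. -/
theorem exists_inv_mul_posNF (h1 : f1 a b = 1) (h2 : f2 a b = 1) (l : List ℕ) (k i : ℕ) :
    ∃ l', (fgen a b i)⁻¹ * posNF a b k l = posNF a b 0 l' ∨
      ∃ j, (fgen a b i)⁻¹ * posNF a b k l = posNF a b 0 l' * (fgen a b j)⁻¹ := by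
  induction l generalizing k i with
  | nil => exact ⟨[], Or.inr ⟨i, by simp [posNF]⟩⟩
  | cons e l ih =>
    induction e generalizing i with
    | zero => simpa [posNF] using ih (k + 1) i
    | succ e ihe =>
      have hs : posNF a b k ((e + 1) :: l) = fgen a b k * posNF a b k (e :: l) := by
        simp only [posNF, pow_succ', mul_assoc]
      rw [hs]
      have pos : ∀ (m : ℕ) (w : G), (∃ l', w = posNF a b 0 l' ∨
          ∃ j, w = posNF a b 0 l' * (fgen a b j)⁻¹) →
          ∃ l', fgen a b m * w = posNF a b 0 l' ∨
            ∃ j, fgen a b m * w = posNF a b 0 l' * (fgen a b j)⁻¹ := by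
        rintro m w ⟨l', h⟩
        obtain ⟨l'', hl''⟩ := exists_posNF_mul h1 h2 l' (Nat.zero_le m)
        refine ⟨l'', ?_⟩
        rcases h with rfl | ⟨j, rfl⟩
        · exact Or.inl hl''
        · exact Or.inr ⟨j, by rw [← mul_assoc, hl'']⟩
      have nonneg : ∀ (l : List ℕ) (k : ℕ), ∃ l', posNF a b k l = posNF a b 0 l' := by
        intro l k
        refine ⟨List.replicate k 0 ++ l, ?_⟩
        have : ∀ k m, posNF a b (m + k) l = posNF a b m (List.replicate k 0 ++ l) := by
          intro k
          induction k with
          | zero => simp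
          | succ k ih =>
            intro m
            rw [List.replicate_succ, List.cons_append, posNF, ← ih]
            simp only [pow_zero, one_mul]
            congr 1; ring
        simpa using this k 0
      rcases lt_trichotomy i k with hik | rfl | hki
      · have e1 : (fgen a b i)⁻¹ * (fgen a b k * posNF a b k (e :: l)) =
            fgen a b (k + 1) * ((fgen a b i)⁻¹ * posNF a b k (e :: l)) := by
          rw [inv_mul_eq_iff_eq_mul, ← mul_assoc, ← mul_assoc, ← fgen_mul h1 h2 hik]
          group
        rw [e1]
        exact pos _ _ (ihe i)
      · obtain ⟨l', hl'⟩ := nonneg (e :: l) i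
        exact ⟨l', Or.inl (by rw [inv_mul_cancel_left, hl'])⟩
      · have e1 : (fgen a b i)⁻¹ * (fgen a b k * posNF a b k (e :: l)) =
            fgen a b k * ((fgen a b (i + 1))⁻¹ * posNF a b k (e :: l)) := by
          rw [inv_mul_eq_iff_eq_mul, ← mul_assoc, ← mul_assoc, fgen_mul h1 h2 hki]
          group
        rw [e1]
        exact pos _ _ (ihe (i + 1))

theorem exists_posNF_mul_inv (h1 : f1 a b = 1) (h2 : f2 a b = 1) {g : G}
    (hg : g ∈ Subgroup.closure {a, b}) :
    ∃ l l', g = posNF a b 0 l * (posNF a b 0 l')⁻¹ := by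
  -- The quotients of positive words are stable under left multiplication by generators and by their
  -- inverses.
  have key : ∀ (i : ℕ) (g : G), (∃ l l', g = posNF a b 0 l * (posNF a b 0 l')⁻¹) →
      (∃ l l', fgen a b i * g = posNF a b 0 l * (posNF a b 0 l')⁻¹) ∧
      ∃ l l', (fgen a b i)⁻¹ * g = posNF a b 0 l * (posNF a b 0 l')⁻¹ := by
    rintro i g ⟨l, l', rfl⟩
    constructor
    · obtain ⟨l'', h⟩ := exists_posNF_mul h1 h2 l (Nat.zero_le i)
      exact ⟨l'', l', by rw [← mul_assoc, h]⟩
    · obtain ⟨l'', h | ⟨j, h⟩⟩ := exists_inv_mul_posNF h1 h2 l 0 i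
      · exact ⟨l'', l', by rw [← mul_assoc, h]⟩
      · obtain ⟨m', hm'⟩ := exists_posNF_fgen a b j 0
        obtain ⟨m, hm⟩ := exists_posNF_mul_posNF h1 h2 l' m' 0
        rw [zero_add] at hm'
        exact ⟨l'', m, by rw [← mul_assoc, h, ← hm, ← hm', mul_inv_rev, mul_assoc]⟩
  have hgen : ∀ x ∈ ({a, b} : Set G), ∃ i, x = fgen a b i := by
    rintro x (rfl | rfl)
    · exact ⟨0, rfl⟩
    · exact ⟨1, (fgen_one _ _).symm⟩
  induction hg using Subgroup.closure_induction_left with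
  | one => exact ⟨[], [], by simp [posNF]⟩
  | mul_left x hx y hy ih =>
    obtain ⟨i, rfl⟩ := hgen x hx
    exact (key i y ih).1
  | inv_mul_cancel x hx y hy ih =>
    obtain ⟨i, rfl⟩ := hgen x hx
    exact (key i y ih).2

end NormalForm

/-! ### Faithfulness of the normal form -/

section Faithful

variable {G : Type*} [Group G] {a b : G} (Φ : G →* (ℝ ≃o ℝ))

theorem genIso_x1_of_nonpos {x : ℝ} (hx : x ≤ 0) : genIso .x1 x = x := by
  rw [genIso_apply, genMap, if_pos hx]

theorem genIso_x1_of_mem {x : ℝ} (hx : 0 ≤ x) (hx' : x ≤ 1) : genIso .x1 x = 2 * x := by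
  rw [genIso_apply, genMap, if_pos hx']
  split_ifs with h
  · linarith
  · rfl

theorem genIso_x1_of_ge {x : ℝ} (hx : 1 ≤ x) : genIso .x1 x = x + 1 := by
  rw [genIso_apply, genMap, if_neg (by linarith)]
  split_ifs with h
  · linarith
  · rfl

theorem genIso_x0 (x : ℝ) : genIso .x0 x = x + 1 := by rw [genIso_apply, genMap]

theorem inv_apply_eq_iff {f : ℝ ≃o ℝ} {x y : ℝ} : f⁻¹ x = y ↔ x = f y :=
  f.toEquiv.symm_apply_eq

theorem genIso_x0_pow (n : ℕ) (x : ℝ) : (genIso .x0 ^ n) x = x + n := by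
  induction n generalizing x with
  | zero => simp
  | succ n ih => rw [pow_succ, RelIso.mul_apply, ih, genIso_x0]; push_cast; ring

theorem genIso_x0_inv_pow (n : ℕ) (x : ℝ) : ((genIso .x0)⁻¹ ^ n) x = x - n := by
  rw [inv_pow, inv_apply_eq_iff, genIso_x0_pow]; ring

variable (hΦa : Φ a = (genIso .x0)⁻¹) (hΦb : Φ b = (genIso .x1)⁻¹)

include hΦa hΦb

theorem map_fgen_succ (k : ℕ) (x : ℝ) :
    Φ (fgen a b (k + 1)) x = (genIso .x1)⁻¹ (x - k) + k := by
  simp only [fgen, map_mul, map_pow, map_inv, hΦa, hΦb, inv_inv, RelIso.mul_apply]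
  rw [genIso_x0_inv_pow, genIso_x0_pow]

theorem map_fgen_succ_of_le {k : ℕ} {x : ℝ} (hx : x ≤ k) : Φ (fgen a b (k + 1)) x = x := by
  rw [map_fgen_succ Φ hΦa hΦb, inv_apply_eq_iff.2 (genIso_x1_of_nonpos (sub_nonpos.2 hx)).symm]
  ring

theorem map_fgen_succ_pow_of_le {k : ℕ} {x : ℝ} (hx : x ≤ k) (e : ℕ) :
    (Φ (fgen a b (k + 1)) ^ e) x = x := by
  induction e with
  | zero => simp
  | succ e ih => rw [pow_succ, RelIso.mul_apply, map_fgen_succ_of_le Φ hΦa hΦb hx, ih]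

theorem map_fgen_succ_pow (k e : ℕ) :
    (Φ (fgen a b (k + 1)) ^ e) (k + 1 : ℝ) = k + (1 / 2) ^ e := by
  induction e with
  | zero => simp
  | succ e ih =>
    have h0 : (0 : ℝ) < (1 / 2) ^ e := by positivity
    have h1 : ((1 : ℝ) / 2) ^ e ≤ 1 := pow_le_one₀ (by norm_num) (by norm_num)
    have h2 : (genIso .x1)⁻¹ ((1 / 2 : ℝ) ^ e) = (1 / 2) ^ (e + 1) := by
      rw [inv_apply_eq_iff, genIso_x1_of_mem (by positivity) (by rw [pow_succ]; linarith),
        pow_succ]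
      ring
    rw [pow_succ', RelIso.mul_apply, ih, map_fgen_succ Φ hΦa hΦb, add_sub_cancel_left, h2]
    ring

/-- All letters of index above `k` fix the half-line up to `k`. -/
theorem map_posNF_succ_of_le (l : List ℕ) {k : ℕ} {x : ℝ} (hx : x ≤ k) :
    Φ (posNF a b (k + 1) l) x = x := by
  induction l generalizing k with
  | nil => simp [posNF]
  | cons e l ih =>
    rw [posNF, map_mul, map_pow, RelIso.mul_apply, ih (by push_cast; linarith),
      map_fgen_succ_pow_of_le Φ hΦa hΦb hx]

/-- At the point `k` the later letters have no effect, and the leading power moves it to `-e` if `k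
= 0` and to `k - 1 + 2 ^ (-e)` otherwise. This determines the exponent `e`. -/
theorem map_posNF_head (k : ℕ) {l l' : List ℕ}
    (h : Φ (posNF a b k l) = Φ (posNF a b k l')) : l.headD 0 = l'.headD 0 := by
  have h3 := DFunLike.congr_fun h (k : ℝ)
  rw [posNF_eq a b k l, posNF_eq a b k l', map_mul, map_mul, map_pow, map_pow, RelIso.mul_apply,
    RelIso.mul_apply, map_posNF_succ_of_le Φ hΦa hΦb _ le_rfl,
    map_posNF_succ_of_le Φ hΦa hΦb _ le_rfl] at h3
  rcases k with _ | k
  · simp only [fgen, hΦa, genIso_x0_inv_pow] at h3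
    simpa using h3
  · push_cast at h3
    rw [map_fgen_succ_pow Φ hΦa hΦb, map_fgen_succ_pow Φ hΦa hΦb, add_right_inj] at h3
    exact pow_right_injective₀ (by norm_num) (by norm_num) h3

/-- The leading exponents agree and cancel. The lists themselves may differ by trailing zeros, so
the group elements are compared. -/
theorem posNF_injective (n : ℕ) {k : ℕ} {l l' : List ℕ} (hl : l.length ≤ n) (hl' : l'.length ≤ n)
    (h : Φ (posNF a b k l) = Φ (posNF a b k l')) : posNF a b k l = posNF a b k l' := by
  induction n generalizing k l l' with
  | zero =>
    rw [List.length_eq_zero_iff.1 (Nat.le_zero.1 hl), List.length_eq_zero_iff.1 (Nat.le_zero.1 hl')]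
  | succ n ih =>
    have hh := map_posNF_head Φ hΦa hΦb k h
    rw [posNF_eq a b k l, posNF_eq a b k l', hh] at h ⊢
    rw [map_mul, map_mul, mul_right_inj] at h
    rw [ih (by simp; omega) (by simp; omega) h]

/-- The two relators of `F` suffice: a group generated by `a, b` that satisfy them and that act on
the line like the generators of `F` acts faithfully. -/
theorem eq_one_of_map_eq_one (h1 : f1 a b = 1) (h2 : f2 a b = 1) {g : G}
    (hg : g ∈ Subgroup.closure {a, b}) (h : Φ g = 1) : g = 1 := by
  obtain ⟨l, l', rfl⟩ := exists_posNF_mul_inv h1 h2 hg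
  rw [map_mul, map_inv, mul_inv_eq_one] at h
  rw [mul_inv_eq_one]
  exact posNF_injective Φ hΦa hΦb (max l.length l'.length) (le_max_left _ _) (le_max_right _ _) h

end Faithful


/-! ### Generation of `F` -/

/-- The map that doubles `[i, i + 1]` and is the identity to the left of it. -/
noncomputable def dbl (i : ℤ) : ℝ ≃o ℝ := affIso 0 i * genIso .x1 * affIso 0 (-i)

theorem dbl_apply (i : ℤ) (x : ℝ) : dbl i x = genIso .x1 (x - i) + i := by
  simp [dbl, sub_eq_add_neg]

theorem dbl_of_le {i : ℤ} {x : ℝ} (hx : x ≤ i) : dbl i x = x := by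
  rw [dbl_apply, genIso_x1_of_nonpos (by linarith)]; ring

theorem dbl_of_mem {i : ℤ} {x : ℝ} (hx : i ≤ x) (hx' : x ≤ i + 1) : dbl i x = 2 * x - i := by
  rw [dbl_apply, genIso_x1_of_mem (by linarith) (by linarith)]; ring

theorem dbl_of_ge {i : ℤ} {x : ℝ} (hx : i + 1 ≤ x) : dbl i x = x + 1 := by
  rw [dbl_apply, genIso_x1_of_ge (by linarith)]; ring

theorem dbl_inv_of_le {i : ℤ} {x : ℝ} (hx : x ≤ i) : (dbl i)⁻¹ x = x :=
  inv_apply_eq_iff.2 (dbl_of_le hx).symm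

theorem dbl_inv_of_mem {i : ℤ} {x : ℝ} (hx : i ≤ x) (hx' : x ≤ i + 2) :
    (dbl i)⁻¹ x = (x + i) / 2 :=
  inv_apply_eq_iff.2 (by rw [dbl_of_mem (by linarith) (by linarith)]; ring)

theorem dbl_inv_of_ge {i : ℤ} {x : ℝ} (hx : i + 2 ≤ x) : (dbl i)⁻¹ x = x - 1 :=
  inv_apply_eq_iff.2 (by rw [dbl_of_ge (by linarith)]; ring)

theorem dbl_zero : dbl 0 = genIso .x1 := by ext x; simp [dbl_apply]

/-- Beyond `1` the map `dbl 0` is the unit translation, so conjugation by it shifts the doublings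
supported there. Hence `dbl 0` and `dbl 1` generate all of them. -/
theorem dbl_zero_mul (j : ℕ) : dbl 0 * dbl (j + 1 : ℕ) = dbl (j + 2 : ℕ) * dbl 0 := by
  ext x
  simp only [RelIso.mul_apply]
  have hj : (0 : ℝ) ≤ j := by positivity
  rcases le_total x 1 with h1 | h1
  · rw [dbl_of_le (i := (j + 1 : ℕ)) (by push_cast; linarith), dbl_of_le (i := (j + 2 : ℕ))]
    push_cast
    rcases le_total x 0 with h0 | h0
    · rw [dbl_of_le (by simpa using h0)]; linarith
    · rw [dbl_of_mem (by simpa using h0) (by simpa using h1)]; push_cast; linarith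
  · rw [dbl_of_ge (i := 0) (x := x) (by simpa using h1)]
    have h3 : x ≤ dbl (j + 1 : ℕ) x := by
      rw [dbl_apply]
      rcases le_total (x - ((j + 1 : ℕ) : ℤ)) 0 with h | h
      · rw [genIso_x1_of_nonpos h]; linarith
      · rcases le_total (x - ((j + 1 : ℕ) : ℤ)) 1 with h' | h'
        · rw [genIso_x1_of_mem h h']; linarith
        · rw [genIso_x1_of_ge h']; linarith
    rw [dbl_of_ge (i := 0) (by simpa using h1.trans h3), dbl_apply, dbl_apply]
    push_cast
    rw [show x + 1 - ((j : ℝ) + 2) = x - (j + 1) by ring]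
    ring

/-- The subgroup generated by the doubling maps at `0` and at `1`. -/
noncomputable def posF : Subgroup (ℝ ≃o ℝ) := Subgroup.closure {dbl 0, dbl 1}

theorem dbl_mem_posF (n : ℕ) : dbl n ∈ posF := by
  rcases n with _ | n
  · exact Subgroup.subset_closure (by simp)
  induction n with
  | zero => exact Subgroup.subset_closure (by simp)
  | succ n ih =>
    have h := eq_mul_inv_of_mul_eq (dbl_zero_mul n).symm
    have h0 : dbl 0 ∈ posF := Subgroup.subset_closure (by simp)
    change dbl (n + 2 : ℕ) ∈ posF
    rw [h]
    exact posF.mul_mem (posF.mul_mem h0 ih) (posF.inv_mem h0)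

theorem posF_apply_of_nonpos {f : ℝ ≃o ℝ} (hf : f ∈ posF) {x : ℝ} (hx : x ≤ 0) : f x = x := by
  induction hf using Subgroup.closure_induction with
  | mem f hf =>
    rcases hf with rfl | rfl
    · exact dbl_of_le (by simpa using hx)
    · exact dbl_of_le (by push_cast; linarith)
  | one => rfl
  | mul f g _ _ hf hg => rw [RelIso.mul_apply, hg, hf]
  | inv f _ hf => rw [inv_apply_eq_iff, hf]

/-- The map `e` is affine with slope a power of `2` that is at least `1` on every interval between
consecutive natural numbers. -/
def Expanding (e : ℝ → ℝ) : Prop :=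
  ∀ i : ℕ, ∃ r : ℕ, ∀ x ∈ Set.Icc (i : ℝ) (i + 1), e x = e i + 2 ^ r * (x - i)

theorem Expanding.le {e : ℝ → ℝ} (he : Expanding e) (i : ℕ) {j : ℕ} (hij : i ≤ j) :
    e i + (j - i) ≤ e j := by
  induction j, hij using Nat.le_induction with
  | base => simp
  | succ j _ ih =>
    obtain ⟨r, hr⟩ := he j
    have h := hr (j + 1) (by simp)
    have h2 : (1 : ℝ) ≤ 2 ^ r := one_le_pow₀ (by norm_num)
    push_cast
    rw [h]
    ring_nf at ih ⊢
    linarith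

/-- Induction on the translation length `n` near infinity: splitting off one doubling lowers it by
one, and for length zero no slope can exceed `1`. -/
theorem Expanding.mem_posF (n : ℕ) {e : ℝ ≃o ℝ} (he : Expanding e) (h0 : ∀ x ≤ 0, e x = x)
    (hM : ∃ M : ℕ, ∀ x : ℝ, M ≤ x → e x = x + n) : e ∈ posF := by
  induction n generalizing e with
  | zero =>
    obtain ⟨M, hM⟩ := hM
    have e1 : ∀ i : ℕ, e i = i := by
      intro i
      have h1 := he.le 0 (Nat.zero_le i)
      have h2 := he.le i (le_max_left i M)
      rw [hM ((max i M : ℕ) : ℝ) (by exact_mod_cast le_max_right i M)] at h2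
      have h3 := h0 0 le_rfl
      push_cast at h1 h2
      linarith
    have : e = 1 := by
      ext x
      rw [RelIso.one_apply]
      rcases le_total x 0 with hx | hx
      · exact h0 x hx
      · obtain ⟨r, hr⟩ := he ⌊x⌋₊
        have h1 := hr x ⟨Nat.floor_le hx, (Nat.lt_floor_add_one x).le⟩
        have h2 := hr (⌊x⌋₊ + 1) (by simp)
        have h3 := e1 (⌊x⌋₊ + 1)
        push_cast at h3
        rw [h3, e1] at h2
        have h4 : (2 : ℝ) ^ r = 1 := by linarith
        rw [h1, e1, h4]; ring
    rw [this]; exact posF.one_mem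
  | succ n ih =>
    obtain ⟨M, hM⟩ := hM
    -- If the slope on `[i, i + 1]` is `2 ^ (r + 1)`, then `e * (dbl i)⁻¹` has slope `2 ^ r` on both
    -- halves of `[i, i + 2]`, and everything further right is shifted by one. If there is no such
    -- interval, `e` fixes every natural number, which contradicts the length `n + 1`.
    by_cases hall : ∃ i : ℕ, ∃ r : ℕ, ∀ x ∈ Set.Icc (i : ℝ) (i + 1), e x = e i + 2 ^ (r + 1) * (x - i)
    · obtain ⟨i, r, hr⟩ := hall
      have key : e * (dbl i)⁻¹ ∈ posF := by
        refine ih ?_ ?_ ?_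
        · intro j
          simp only [RelIso.mul_apply]
          rcases lt_trichotomy j i with hji | rfl | hij
          · obtain ⟨r', hr'⟩ := he j
            have hc : (j : ℝ) + 1 ≤ i := by exact_mod_cast hji
            refine ⟨r', fun x hx => ?_⟩
            rw [dbl_inv_of_le (by push_cast; linarith [hx.2]), dbl_inv_of_le (by push_cast; linarith)]
            exact hr' x hx
          · refine ⟨r, fun x hx => ?_⟩
            rw [dbl_inv_of_mem (by simpa using hx.1) (by push_cast; linarith [hx.2]),
              dbl_inv_of_le (by simp), hr _ ⟨by push_cast; linarith [hx.1],
                by push_cast; linarith [hx.2]⟩]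
            push_cast; ring
          · rcases (Nat.succ_le_of_lt hij).eq_or_lt with rfl | hij
            · refine ⟨r, fun x hx => ?_⟩
              have hx1 := hx.1
              have hx2 := hx.2
              push_cast at hx1 hx2 ⊢
              rw [dbl_inv_of_mem (by push_cast; linarith) (by push_cast; linarith),
                dbl_inv_of_mem (by push_cast; linarith) (by push_cast; linarith),
                Int.cast_natCast, hr ((x + i) / 2) ⟨by linarith, by linarith⟩,
                hr (((i : ℝ) + 1 + i) / 2) ⟨by linarith, by linarith⟩]
              ring
            · obtain ⟨m, rfl⟩ := Nat.exists_eq_add_of_lt hij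
              obtain ⟨r', hr'⟩ := he (i.succ + m)
              refine ⟨r', fun x hx => ?_⟩
              have hx1 := hx.1
              have hx2 := hx.2
              have hm : (0 : ℝ) ≤ m := by positivity
              push_cast at hx1 hx2 hr' ⊢
              rw [dbl_inv_of_ge (by push_cast; linarith), dbl_inv_of_ge (by push_cast; linarith),
                hr' _ ⟨by linarith, by linarith⟩, add_sub_cancel_right]
              ring
        · intro x hx
          rw [RelIso.mul_apply, dbl_inv_of_le (hx.trans (by positivity)), h0 x hx]
        · refine ⟨M + i + 2, fun x hx => ?_⟩
          push_cast at hx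
          have h1 : (0 : ℝ) ≤ M := by positivity
          have h2 : (0 : ℝ) ≤ i := by positivity
          rw [RelIso.mul_apply, dbl_inv_of_ge (by push_cast; linarith), hM _ (by linarith)]
          push_cast; ring
      have := posF.mul_mem key (dbl_mem_posF i)
      rwa [inv_mul_cancel_right] at this
    · exfalso
      have e1 : ∀ i : ℕ, e i = i := by
        intro i
        induction i with
        | zero => simpa using h0 0 le_rfl
        | succ i ihi =>
          obtain ⟨r, hr⟩ := he i
          rcases r with _ | r
          · have := hr (i + 1) (by simp)
            push_cast
            rw [this, ihi]; simp
          · exact absurd ⟨i, r, hr⟩ hall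
      have h1 := hM M le_rfl
      rw [e1] at h1
      push_cast at h1
      have : (0 : ℝ) ≤ n := by positivity
      linarith

/-- Doubling `[m, m + 1]` first and then `[0, m]` doubles all of `[0, m + 1]`. -/
theorem exists_posF_double (m : ℕ) : ∃ q ∈ posF, (∀ x ∈ Set.Icc (0 : ℝ) m, q x = 2 * x) ∧
    ∀ x : ℝ, m ≤ x → q x = x + m := by
  induction m with
  | zero =>
    refine ⟨1, posF.one_mem, fun x hx => ?_, fun x _ => by simp⟩
    have : x = 0 := le_antisymm (by simpa using hx.2) hx.1
    simp [this]
  | succ m ih =>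
    obtain ⟨q, hq, h1, h2⟩ := ih
    refine ⟨q * dbl m, posF.mul_mem hq (dbl_mem_posF m), fun x hx => ?_, fun x hx => ?_⟩
    · rw [RelIso.mul_apply]
      have hx2 := hx.2
      push_cast at hx2
      rcases le_total x m with h | h
      · rw [dbl_of_le (by simpa using h), h1 x ⟨hx.1, h⟩]
      · rw [dbl_of_mem (by simpa using h) (by simpa using hx2), h2 _ (by push_cast; linarith)]
        push_cast; ring
    · push_cast at hx
      rw [RelIso.mul_apply, dbl_of_ge (by simpa using hx), h2 _ (by linarith)]
      push_cast; ring

theorem exists_posF_scale (m N : ℕ) : ∃ q ∈ posF, (∀ x ∈ Set.Icc (0 : ℝ) m, q x = 2 ^ N * x) ∧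
    ∀ x : ℝ, m ≤ x → q x = x + (2 ^ N - 1) * m := by
  induction N with
  | zero => exact ⟨1, posF.one_mem, by simp, by simp⟩
  | succ N ih =>
    obtain ⟨q, hq, h1, h2⟩ := ih
    obtain ⟨p, hp, h3, h4⟩ := exists_posF_double (2 ^ N * m)
    have hm : (0 : ℝ) ≤ m := by positivity
    refine ⟨p * q, posF.mul_mem hp hq, fun x hx => ?_, fun x hx => ?_⟩
    · rw [RelIso.mul_apply, h1 x hx, h3 _ ⟨by have := hx.1; positivity, ?_⟩]
      · ring
      · push_cast; have := hx.2; gcongr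
    · rw [RelIso.mul_apply, h2 x hx, h4]
      · push_cast; ring
      · push_cast; linarith

theorem exists_common_denominator {S : Set ℝ} (hS : S.Finite) (hd : ∀ x ∈ S, IsDyadic x) :
    ∃ N : ℕ, ∀ x ∈ S, ∃ m : ℤ, (2 : ℝ) ^ N * x = m := by
  induction S, hS using Set.Finite.induction_on with
  | empty => exact ⟨0, by simp⟩
  | @insert a S _ _ ih =>
    obtain ⟨N, hN⟩ := ih fun x hx => hd x (Set.mem_insert_of_mem _ hx)
    obtain ⟨p, k, hp⟩ := hd a (Set.mem_insert _ _)
    refine ⟨N + k, ?_⟩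
    rintro x (rfl | hx)
    · exact ⟨2 ^ N * p, by rw [hp, pow_add]; push_cast; field_simp⟩
    · obtain ⟨m, hm⟩ := hN x hx
      exact ⟨2 ^ k * m, by rw [pow_add]; push_cast; rw [← hm]; ring⟩

/-- Rescaling the source by `2 ^ N` moves the breakpoints to integers, and rescaling the target by
`2 ^ N'` makes all slopes at least `1`. Both rescalings lie in `posF`, and the rescaled map is a
product of doublings by `Expanding.mem_posF`. -/
theorem mem_posF {f : ℝ ≃o ℝ} (hf : f ∈ ThompsonF) (h0 : ∀ x ≤ 0, f x = x) : f ∈ posF := by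
  obtain ⟨⟨B, hB, hfin, haff⟩, M, k, -, -, hM, -⟩ := hf
  obtain ⟨m, hm⟩ := exists_nat_gt (max M 0)
  have hm0 : (0 : ℝ) < m := (le_max_right _ _).trans_lt hm
  have hfm : ∀ x : ℝ, m ≤ x → f x = x + k := fun x hx =>
    hM x (((le_max_left _ _).trans_lt hm).trans_le hx)
  obtain ⟨m', hm'⟩ : ∃ m' : ℕ, (m' : ℝ) = m + k := by
    have h1 : f 0 < f m := f.strictMono hm0
    rw [h0 0 le_rfl, hfm m le_rfl] at h1
    have h2 : 0 ≤ (m : ℤ) + k := by exact_mod_cast h1.le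
    obtain ⟨m', h3⟩ := Int.eq_ofNat_of_zero_le h2
    exact ⟨m', by exact_mod_cast h3.symm⟩
  obtain ⟨N, hN⟩ := exists_common_denominator (hfin 0 m) fun x hx => hB x hx.1
  have hpiece : ∀ j : ℕ, ∃ (k : ℤ) (c : ℝ), j < m * 2 ^ N →
      ∀ x ∈ Set.Icc ((j : ℝ) / 2 ^ N) ((j + 1) / 2 ^ N), f x = (2 : ℝ) ^ k * x + c := by
    intro j
    by_cases hj : j < m * 2 ^ N
    · obtain ⟨k, c, -, h⟩ := haff ((j : ℝ) / 2 ^ N) ((j + 1) / 2 ^ N) (by gcongr; linarith) (by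
        rw [Set.disjoint_left]
        rintro y hy ⟨hy1, hy2⟩
        have hy0 : 0 ≤ y := le_trans (by positivity) hy1.le
        have hym : y ≤ m := by
          refine hy2.le.trans ?_
          rw [div_le_iff₀ (by positivity)]
          exact_mod_cast hj
        obtain ⟨p, hp⟩ := hN y ⟨hy, hy0, hym⟩
        rw [div_lt_iff₀ (by positivity), mul_comm, hp] at hy1
        rw [lt_div_iff₀ (by positivity), mul_comm, hp] at hy2
        norm_cast at hy1 hy2
        omega)
      exact ⟨k, c, fun _ => h⟩
    · exact ⟨0, 0, fun h => absurd h hj⟩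
  choose K C hKC using hpiece
  -- On `[j, j + 1]` the rescaled map has slope `2 ^ (K j + N' - N)`.
  obtain ⟨N', hN'⟩ : ∃ N' : ℕ, ∀ j < m * 2 ^ N, 0 ≤ K j + N' - N := by
    refine ⟨(Finset.range (m * 2 ^ N)).sup (fun j => (N - K j).toNat), fun j hj => ?_⟩
    have := Finset.le_sup (f := fun j => (N - K j).toNat) (Finset.mem_range.2 hj)
    omega
  obtain ⟨p, hp, hp1, hp2⟩ := exists_posF_scale m N
  obtain ⟨q, hq, hq1, hq2⟩ := exists_posF_scale m' N'
  have hpinv1 : ∀ x : ℝ, 0 ≤ x → x ≤ m * 2 ^ N → p⁻¹ x = x / 2 ^ N := by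
    intro x hx hx'
    rw [inv_apply_eq_iff, hp1 _ ⟨by positivity, by rwa [div_le_iff₀ (by positivity)]⟩]
    field_simp
  have hpinv2 : ∀ x : ℝ, m * 2 ^ N ≤ x → p⁻¹ x = x - (2 ^ N - 1) * m := by
    intro x hx
    rw [inv_apply_eq_iff, hp2 _ (by linarith)]
    ring
  have hfar : ∀ x : ℝ, m * 2 ^ N ≤ x → (q * f * p⁻¹) x = x + (2 ^ N' * m' - 2 ^ N * m) := by
    intro x hx
    rw [RelIso.mul_apply, RelIso.mul_apply, hpinv2 x hx, hfm _ (by linarith),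
      hq2 _ (by rw [hm']; linarith), hm']
    ring
  have hexp : Expanding (q * f * p⁻¹ : ℝ ≃o ℝ) := by
    intro j
    rcases lt_or_ge j (m * 2 ^ N) with hj | hj
    · obtain ⟨r, hr⟩ := Int.eq_ofNat_of_zero_le (hN' j hj)
      have hj' : (j : ℝ) + 1 ≤ m * 2 ^ N := by exact_mod_cast hj
      have hval : ∀ x ∈ Set.Icc (j : ℝ) (j + 1),
          (q * f * p⁻¹) x = 2 ^ r * x + 2 ^ N' * C j := by
        intro x hx
        have hx0 : 0 ≤ x := le_trans (by positivity) hx.1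
        have hy : x / 2 ^ N ∈ Set.Icc ((j : ℝ) / 2 ^ N) ((j + 1) / 2 ^ N) :=
          ⟨by have := hx.1; gcongr, by have := hx.2; gcongr⟩
        have hym : x / 2 ^ N ≤ m := by
          rw [div_le_iff₀ (by positivity)]; linarith [hx.2]
        have hf1 : 0 ≤ f (x / 2 ^ N) := by
          have := f.monotone (show 0 ≤ x / 2 ^ N by positivity)
          rwa [h0 0 le_rfl] at this
        have hf2 : f (x / 2 ^ N) ≤ m' := by
          have := f.monotone hym
          rwa [hfm m le_rfl, ← hm'] at this
        rw [RelIso.mul_apply, RelIso.mul_apply, hpinv1 x hx0 (by linarith [hx.2]),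
          hq1 _ ⟨hf1, hf2⟩, hKC j hj _ hy]
        have h2 : (2 : ℝ) ^ r = 2 ^ (K j) * 2 ^ N' / 2 ^ N := by
          rw [← zpow_natCast (2 : ℝ) r, ← zpow_natCast (2 : ℝ) N', ← zpow_natCast (2 : ℝ) N,
            ← zpow_add₀ (by norm_num), ← zpow_sub₀ (by norm_num), hr]
        rw [h2]
        field_simp
      refine ⟨r, fun x hx => ?_⟩
      rw [hval x hx, hval j (by simp)]
      ring
    · refine ⟨0, fun x hx => ?_⟩
      have hj' : (m : ℝ) * 2 ^ N ≤ j := by exact_mod_cast hj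
      rw [hfar x (hj'.trans hx.1), hfar j hj']
      ring
  have hneg : ∀ x ≤ 0, (q * f * p⁻¹) x = x := by
    intro x hx
    rw [RelIso.mul_apply, RelIso.mul_apply, posF_apply_of_nonpos (posF.inv_mem hp) hx, h0 x hx,
      posF_apply_of_nonpos hq hx]
  -- The translation length near infinity is an integer, and it is nonnegative because expanding
  -- maps do not shorten distances between natural numbers.
  obtain ⟨n, hn⟩ : ∃ n : ℕ, (n : ℝ) = 2 ^ N' * m' - 2 ^ N * m := by
    have h1 := hexp.le 0 (Nat.zero_le (m * 2 ^ N))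
    push_cast at h1
    rw [hneg 0 le_rfl, hfar _ le_rfl] at h1
    have h2 : 0 ≤ 2 ^ N' * (m' : ℤ) - 2 ^ N * m := by
      have : (0 : ℝ) ≤ 2 ^ N' * m' - 2 ^ N * m := by linarith
      exact_mod_cast this
    obtain ⟨n, h3⟩ := Int.eq_ofNat_of_zero_le h2
    exact ⟨n, by exact_mod_cast h3.symm⟩
  have hmem := hexp.mem_posF n hneg ⟨m * 2 ^ N, fun x hx => by
    rw [hn]; exact hfar x (by exact_mod_cast hx)⟩
  have := posF.mul_mem (posF.mul_mem (posF.inv_mem hq) hmem) hp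
  convert this using 1
  group

/-- The subgroup generated by the mirror images of the doubling maps at `0` and at `1`. -/
noncomputable def negF : Subgroup (ℝ ≃o ℝ) := Subgroup.closure {reflect (dbl 0), reflect (dbl 1)}

theorem reflect_mem_thompsonF {f : ℝ ≃o ℝ} (hf : f ∈ ThompsonF) : reflect f ∈ ThompsonF := by
  refine ⟨reflect_mem hf.1, ?_⟩
  obtain ⟨-, M, k, l, hM, h1, h2⟩ := hf
  refine ⟨M, -l, -k, hM, fun x hx => ?_, fun x hx => ?_⟩
  · rw [reflect_apply, h2 _ (by linarith)]; push_cast; ring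
  · rw [reflect_apply, h1 _ (by linarith)]; push_cast; ring

theorem mem_negF {f : ℝ ≃o ℝ} (hf : f ∈ ThompsonF) (h0 : ∀ x, 0 ≤ x → f x = x) : f ∈ negF := by
  have h1 : reflect f ∈ posF := mem_posF (reflect_mem_thompsonF hf) fun x hx => by
    rw [reflect_apply, h0 _ (by linarith)]; ring
  have h2 : f ∈ posF.map reflect := ⟨_, h1, reflect_reflect f⟩
  rwa [posF, MonoidHom.map_closure, Set.image_pair] at h2

theorem genIso_x0_mem : genIso .x0 ∈ ThompsonF :=
  ⟨genIso_mem _, 1, 1, 1, one_pos, fun x _ => by rw [genIso_x0]; simp,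
    fun x _ => by rw [genIso_x0]; simp⟩

theorem genIso_x1_mem : genIso .x1 ∈ ThompsonF :=
  ⟨genIso_mem _, 1, 1, 0, one_pos, fun x hx => by rw [genIso_x1_of_ge hx.le]; simp,
    fun x hx => by rw [genIso_x1_of_nonpos (by linarith)]; simp⟩

/-- The subgroup generated by `x₀` and `x₁`; it is all of `F`. -/
noncomputable def genF : Subgroup (ℝ ≃o ℝ) := Subgroup.closure {(genIso .x0)⁻¹, (genIso .x1)⁻¹}

theorem affIso_eq_zpow (n : ℤ) : affIso 0 n = genIso .x0 ^ n := by
  have h : ∀ n : ℕ, affIso 0 n = genIso .x0 ^ n := fun n => by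
    ext x; rw [genIso_x0_pow]; simp
  obtain ⟨m, rfl | rfl⟩ := n.eq_nat_or_neg
  · simpa using h m
  · rw [zpow_neg, zpow_natCast, ← h]
    ext x
    rw [eq_comm, inv_apply_eq_iff]; simp

theorem x0_mem_genF : genIso .x0 ∈ genF :=
  inv_mem_iff.1 (Subgroup.subset_closure (by simp))

theorem x1_mem_genF : genIso .x1 ∈ genF :=
  inv_mem_iff.1 (Subgroup.subset_closure (by simp))

theorem translation_mem_genF (n : ℤ) : affIso 0 n ∈ genF := by
  rw [affIso_eq_zpow]; exact genF.zpow_mem x0_mem_genF n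

theorem dbl_mem_genF (n : ℤ) : dbl n ∈ genF :=
  genF.mul_mem (genF.mul_mem (translation_mem_genF n) x1_mem_genF)
    (by simpa using translation_mem_genF (-n))

theorem posF_le_genF : posF ≤ genF := by
  rw [posF, Subgroup.closure_le]
  rintro f (rfl | rfl) <;> exact dbl_mem_genF _

theorem genF_eq : genF = ThompsonF := by
  apply le_antisymm
  · rw [genF, Subgroup.closure_le]
    rintro f (rfl | rfl)
    · exact ThompsonF.inv_mem genIso_x0_mem
    · exact ThompsonF.inv_mem genIso_x1_mem
  · intro f hf
    obtain ⟨-, M, k, l, hM0, -, hM⟩ := id hf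
    obtain ⟨m, hm⟩ := exists_nat_gt M
    have htr : ∀ n : ℤ, affIso 0 n ∈ ThompsonF := fun n => by
      rw [affIso_eq_zpow]; exact ThompsonF.zpow_mem genIso_x0_mem n
    -- For `x ≤ 0` the point `x - (m + 1)` lies where `f` is the translation by `l`, so the
    -- composite is the identity there.
    have h1 : affIso 0 (m + 1 - l : ℤ) * f * affIso 0 (-(m + 1) : ℤ) ∈ posF := by
      refine mem_posF (ThompsonF.mul_mem (ThompsonF.mul_mem (htr _) hf) (htr _)) fun x hx => ?_
      simp only [RelIso.mul_apply, affIso_apply, zpow_zero, one_mul]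
      push_cast
      rw [hM _ (by linarith)]
      ring
    have h2 := genF.mul_mem (genF.mul_mem (genF.inv_mem (translation_mem_genF (m + 1 - l)))
      (posF_le_genF h1)) (genF.inv_mem (translation_mem_genF (-(m + 1))))
    convert h2 using 1
    group

/-! ### Transitivity on dyadic points and the trivial centralizer of `F` -/

theorem posF_le : posF ≤ ThompsonF := genF_eq ▸ posF_le_genF

/-- Scaling by the denominator takes `d` to a positive integer `n + 1`, and `dbl 0 ^ n` takes `1` to
`n + 1`. -/
theorem exists_posF_eq_one {d : ℝ} (hd : IsDyadic d) (hd0 : 0 < d) : ∃ f ∈ posF, f d = 1 := by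
  obtain ⟨m, N, hmN⟩ := hd
  obtain ⟨M, hM⟩ := exists_nat_ge d
  obtain ⟨q, hq, h1, -⟩ := exists_posF_scale M N
  have h2 : q d = m := by
    rw [h1 d ⟨hd0.le, hM⟩, hmN]; field_simp
  have hm : 0 < m := by
    have : (0 : ℝ) < m := by rw [← h2, h1 d ⟨hd0.le, hM⟩]; positivity
    exact_mod_cast this
  obtain ⟨n, rfl⟩ : ∃ n : ℕ, m = n + 1 := ⟨(m - 1).toNat, by omega⟩
  have h3 : ∀ n : ℕ, (dbl 0 ^ n) 1 = (n : ℝ) + 1 := by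
    intro n
    induction n with
    | zero => simp
    | succ n ih =>
      rw [pow_succ', RelIso.mul_apply, ih, dbl_of_ge (by push_cast; linarith [n.cast_nonneg (α := ℝ)])]
      push_cast; ring
  refine ⟨(dbl 0 ^ n)⁻¹ * q, posF.mul_mem (posF.inv_mem (posF.pow_mem (dbl_mem_posF 0) n)) hq, ?_⟩
  rw [RelIso.mul_apply, h2, inv_apply_eq_iff, h3]
  push_cast; ring

theorem exists_thompsonF_apply_zero {d : ℝ} (hd : IsDyadic d) : ∃ f ∈ ThompsonF, f 0 = d := by
  obtain ⟨m, hm⟩ := exists_nat_gt (-d)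
  have hd' : IsDyadic (d + m) := hd.add (by simpa using isDyadic_int m)
  obtain ⟨f, hf, h⟩ := exists_posF_eq_one hd' (by linarith)
  have htr : ∀ n : ℤ, affIso 0 n ∈ ThompsonF := fun n => genF_eq ▸ translation_mem_genF n
  refine ⟨affIso 0 (-m : ℤ) * f⁻¹ * affIso 0 (1 : ℤ), ThompsonF.mul_mem (ThompsonF.mul_mem (htr _)
    (ThompsonF.inv_mem (posF_le hf))) (htr _), ?_⟩
  have : f⁻¹ 1 = d + m := inv_apply_eq_iff.2 h.symm
  simp [this]

/-- An order automorphism that commutes with `F` is trivial. -/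
theorem eq_one_of_commute {c : ℝ ≃o ℝ} (hc : ∀ f ∈ ThompsonF, c * f = f * c) : c = 1 := by
  -- A map that commutes with `x₁` preserves its fixed points, which are the numbers `≤ 0`. Applied
  -- to `c` and to `c⁻¹` this shows that `c` fixes `0`; transitivity and density do the rest.
  have h0 : ∀ c : ℝ ≃o ℝ, (∀ f ∈ ThompsonF, c * f = f * c) → c 0 ≤ 0 := by
    intro c hc
    by_contra h
    have h1 := DFunLike.congr_fun (hc _ genIso_x1_mem) 0
    rw [RelIso.mul_apply, RelIso.mul_apply, genIso_x1_of_nonpos le_rfl] at h1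
    rcases le_total (c 0) 1 with h2 | h2
    · rw [genIso_x1_of_mem (by linarith) h2] at h1; linarith
    · rw [genIso_x1_of_ge h2] at h1; linarith
  have h0' : c 0 = 0 := by
    refine le_antisymm (h0 c hc) ?_
    have h1 := h0 c⁻¹ fun f hf => by
      rw [inv_mul_eq_iff_eq_mul, ← mul_assoc, eq_mul_inv_iff_mul_eq]
      exact (hc f hf).symm
    have h2 := c.monotone h1
    rwa [RelIso.apply_inv_self] at h2
  have hd : ∀ d, IsDyadic d → c d = d := by
    intro d hd
    obtain ⟨f, hf, rfl⟩ := exists_thompsonF_apply_zero hd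
    have := DFunLike.congr_fun (hc f hf) 0
    rwa [RelIso.mul_apply, RelIso.mul_apply, h0'] at this
  have hdense : ∀ x y : ℝ, x < y → ∃ d, IsDyadic d ∧ x < d ∧ d < y := by
    intro x y hxy
    obtain ⟨n, hn⟩ := pow_unbounded_of_one_lt (1 / (y - x)) (one_lt_two (α := ℝ))
    have hn' : 1 < (y - x) * 2 ^ n := by
      rw [div_lt_iff₀ (by linarith)] at hn; linarith
    refine ⟨(⌊x * 2 ^ n⌋ + 1 : ℤ) / 2 ^ n, ⟨_, _, rfl⟩, ?_, ?_⟩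
    · rw [lt_div_iff₀ (by positivity)]; push_cast; exact Int.lt_floor_add_one _
    · rw [div_lt_iff₀ (by positivity)]; push_cast; linarith [Int.floor_le (x * 2 ^ n)]
  ext x
  rw [RelIso.one_apply]
  rcases lt_trichotomy (c x) x with h | h | h
  · obtain ⟨d, h1, h2, h3⟩ := hdense _ _ h
    have := c.strictMono h3
    rw [hd d h1] at this
    linarith
  · exact h
  · obtain ⟨d, h1, h2, h3⟩ := hdense _ _ h
    have := c.strictMono h2
    rw [hd d h1] at this
    linarith


/-! ### Maps that commute with the unit translation near the ends of the line -/

/-- The order automorphisms that commute with `x ↦ x + 1` near `∞`. -/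
def evPer : Subgroup (ℝ ≃o ℝ) where
  carrier := {h | ∃ M : ℝ, ∀ x, M < x → h (x + 1) = h x + 1}
  one_mem' := ⟨0, fun x _ => rfl⟩
  mul_mem' := by
    rintro g h ⟨M, hM⟩ ⟨N, hN⟩
    refine ⟨max N (h⁻¹ M), fun x hx => ?_⟩
    have h1 : M < h x := by
      have := h.strictMono ((le_max_right _ _).trans_lt hx)
      rwa [RelIso.apply_inv_self] at this
    rw [RelIso.mul_apply, RelIso.mul_apply, hN x ((le_max_left _ _).trans_lt hx), hM _ h1]
  inv_mem' := by
    rintro h ⟨M, hM⟩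
    refine ⟨h M, fun x hx => ?_⟩
    have h1 : M < h⁻¹ x := by
      rw [← h.lt_iff_lt, RelIso.apply_inv_self]; exact hx
    rw [inv_apply_eq_iff, hM _ h1, RelIso.apply_inv_self]

/-- A common bound beyond which `h` commutes with all integer translations. -/
theorem evPer_add_int {h : ℝ ≃o ℝ} (hh : h ∈ evPer) :
    ∃ M : ℝ, ∀ (x : ℝ) (n : ℤ), M < x → M < x + n → h (x + n) = h x + n := by
  obtain ⟨M, hM⟩ := hh
  have key : ∀ (n : ℕ) (x : ℝ), M < x → h (x + n) = h x + n := by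
    intro n
    induction n with
    | zero => simp
    | succ n ih =>
      intro x hx
      have hn : (0 : ℝ) ≤ n := by positivity
      push_cast
      rw [← add_assoc, hM _ (by linarith), ih x hx, add_assoc]
  refine ⟨M, fun x n hx hxn => ?_⟩
  obtain ⟨m, rfl | rfl⟩ := n.eq_nat_or_neg
  · simpa using key m x hx
  · have := key m _ hxn
    push_cast at this ⊢
    rw [neg_add_cancel_right] at this
    linarith

/-- `f` is a translation by an integer near `∞`. -/
def EvTrans (f : ℝ ≃o ℝ) : Prop := ∃ (M : ℝ) (k : ℤ), ∀ x, M < x → f x = x + k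

theorem isEventuallyTranslation_iff {f : ℝ ≃o ℝ} :
    IsEventuallyTranslation f ↔ EvTrans f ∧ EvTrans (reflect f) := by
  constructor
  · rintro ⟨M, k, l, -, h1, h2⟩
    refine ⟨⟨M, k, h1⟩, ⟨M, -l, fun x hx => ?_⟩⟩
    rw [reflect_apply, h2 _ (by linarith)]; push_cast; ring
  · rintro ⟨⟨M, k, h1⟩, ⟨N, l, h2⟩⟩
    refine ⟨max 1 (max M N), k, -l, by positivity, fun x hx => h1 x ?_, fun x hx => ?_⟩
    · exact ((le_max_left M N).trans (le_max_right _ _)).trans_lt hx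
    · have h3 : N ≤ max 1 (max M N) := (le_max_right M N).trans (le_max_right _ _)
      have := h2 (-x) (by linarith)
      rw [reflect_apply, neg_neg] at this
      push_cast
      linarith

theorem EvTrans.mem_evPer {f : ℝ ≃o ℝ} (hf : EvTrans f) : f ∈ evPer := by
  obtain ⟨M, k, h⟩ := hf
  exact ⟨M, fun x hx => by rw [h x hx, h _ (by linarith)]; ring⟩

theorem EvTrans.conj {f h : ℝ ≃o ℝ} (hf : EvTrans f) (hh : h ∈ evPer) :
    EvTrans (h * f * h⁻¹) := by
  obtain ⟨M, k, hM⟩ := hf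
  obtain ⟨N, hN⟩ := evPer_add_int hh
  -- The bound `N - k` keeps the translated point beyond `N` also for negative `k`.
  refine ⟨h (max M (max N (N - k))), k, fun x hx => ?_⟩
  have h1 : max M (max N (N - k)) < h⁻¹ x := by
    rw [← h.lt_iff_lt, RelIso.apply_inv_self]; exact hx
  have h2 : M < h⁻¹ x := (le_max_left _ _).trans_lt h1
  have h3 : N < h⁻¹ x := ((le_max_left _ _).trans (le_max_right _ _)).trans_lt h1
  have h4 : N - k < h⁻¹ x := ((le_max_right _ _).trans (le_max_right _ _)).trans_lt h1
  rw [RelIso.mul_apply, RelIso.mul_apply, hM _ h2, hN _ _ h3 (by linarith), RelIso.apply_inv_self]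

/-- Far out, `h (x + 1) = h x + k` and `h x + 1 = h (x + l)` with integers `k` and `l`. The second
forces `l ≥ 1`, hence `k = h (x + 1) - h x ≤ h (x + l) - h x = 1`, while `k > 0` by monotonicity.
Both directions of conjugation are needed. -/
theorem mem_evPer_of_conj {h : ℝ ≃o ℝ} (h1 : EvTrans (h * genIso .x0 * h⁻¹))
    (h2 : EvTrans (h⁻¹ * genIso .x0 * h)) : h ∈ evPer := by
  obtain ⟨M, k, hM⟩ := h1
  obtain ⟨N, l, hN⟩ := h2
  have e1 : ∀ x, h⁻¹ M < x → h (x + 1) = h x + k := by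
    intro x hx
    have hx' : M < h x := by
      have := h.strictMono hx
      rwa [RelIso.apply_inv_self] at this
    have := hM _ hx'
    rwa [RelIso.mul_apply, RelIso.mul_apply, RelIso.inv_apply_self, genIso_x0] at this
  have e2 : ∀ x, N < x → h x + 1 = h (x + l) := by
    intro x hx
    have := hN _ hx
    rwa [RelIso.mul_apply, RelIso.mul_apply, genIso_x0, inv_apply_eq_iff] at this
  have key : k = 1 := by
    obtain ⟨x, hx⟩ := exists_gt (max (h⁻¹ M) N)
    have a1 := e1 x ((le_max_left _ _).trans_lt hx)
    have a2 := e2 x ((le_max_right _ _).trans_lt hx)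
    have a3 : h x < h (x + l) := by linarith
    have a4 : 0 < l := by
      have := h.lt_iff_lt.1 a3
      have : (0 : ℝ) < l := by linarith
      exact_mod_cast this
    have a5 : h (x + 1) ≤ h (x + l) := h.monotone (by
      have : (1 : ℝ) ≤ l := by exact_mod_cast a4
      linarith)
    have a6 : h x < h (x + 1) := h.strictMono (by linarith)
    have a7 : (0 : ℝ) < k := by linarith
    have a8 : (k : ℝ) ≤ 1 := by linarith
    have a9 : 0 < k := by exact_mod_cast a7
    have a10 : k ≤ 1 := by exact_mod_cast a8
    omega
  refine ⟨h⁻¹ M, fun x hx => ?_⟩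
  rw [e1 x hx, key]; simp

/-- The elements of `PL₂⁺(ℝ)` that commute with `x ↦ x + 1` near both ends of the line. -/
def EndPer : Subgroup (ℝ ≃o ℝ) := PL2Plus ⊓ (evPer ⊓ evPer.comap reflect)

theorem mem_thompsonF_iff {f : ℝ ≃o ℝ} :
    f ∈ ThompsonF ↔ f ∈ PL2Plus ∧ EvTrans f ∧ EvTrans (reflect f) :=
  and_congr Iff.rfl isEventuallyTranslation_iff

theorem thompsonF_le_endPer : ThompsonF ≤ EndPer := fun f hf => by
  obtain ⟨h1, h2, h3⟩ := mem_thompsonF_iff.1 hf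
  exact ⟨h1, h2.mem_evPer, h3.mem_evPer⟩

theorem conj_mem_thompsonF {h f : ℝ ≃o ℝ} (hh : h ∈ EndPer) (hf : f ∈ ThompsonF) :
    h * f * h⁻¹ ∈ ThompsonF := by
  obtain ⟨h1, h2, h3⟩ := mem_thompsonF_iff.1 hf
  obtain ⟨h4, h5, h6⟩ := hh
  refine mem_thompsonF_iff.2 ⟨PL2Plus.mul_mem (PL2Plus.mul_mem h4 h1) (PL2Plus.inv_mem h4),
    h2.conj h5, ?_⟩
  rw [map_mul, map_mul, map_inv]
  exact h3.conj h6

/-- Since `φ` is bijective, `h⁻¹` conjugates `F` into itself as well. The end at `-∞` is the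
reflected statement, with `x₀` as the mirror image of `x₀⁻¹`. -/
theorem mem_endPer_of_inducedBy {φ : MulAut ThompsonF} {h : ℝ ≃o ℝ} (hh : h ∈ PL2Plus)
    (hφ : InducedBy φ h) : h ∈ EndPer := by
  have a1 : ∀ f ∈ ThompsonF, h * f * h⁻¹ ∈ ThompsonF := fun f hf => by
    rw [← hφ ⟨f, hf⟩]; exact (φ _).2
  have a2 : ∀ f ∈ ThompsonF, h⁻¹ * f * h ∈ ThompsonF := fun f hf => by
    have := hφ (φ⁻¹ ⟨f, hf⟩)
    rw [MulAut.apply_inv_self] at this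
    have e : h⁻¹ * f * h = (φ⁻¹ ⟨f, hf⟩ : ThompsonF) := by
      have this : f = h * (φ⁻¹ ⟨f, hf⟩ : ThompsonF) * h⁻¹ := this
      calc h⁻¹ * f * h = h⁻¹ * (h * (φ⁻¹ ⟨f, hf⟩ : ThompsonF) * h⁻¹) * h :=
            congrArg (fun u => h⁻¹ * u * h) this
        _ = _ := by group
    rw [e]
    exact (φ⁻¹ ⟨f, hf⟩).2
  have hx := genIso_x0_mem
  have hx' := ThompsonF.inv_mem genIso_x0_mem
  have hr : reflect (genIso .x0)⁻¹ = genIso .x0 := by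
    ext x
    rw [reflect_apply, neg_eq_iff_eq_neg, inv_apply_eq_iff, genIso_x0, genIso_x0]; ring
  refine ⟨hh, mem_evPer_of_conj (mem_thompsonF_iff.1 (a1 _ hx)).2.1
    (mem_thompsonF_iff.1 (a2 _ hx)).2.1, mem_evPer_of_conj ?_ ?_⟩
  · have := (mem_thompsonF_iff.1 (a1 _ hx')).2.2
    rwa [map_mul, map_mul, hr, map_inv] at this
  · have := (mem_thompsonF_iff.1 (a2 _ hx')).2.2
    rwa [map_mul, map_mul, hr, map_inv] at this

/-- Conjugation by an element of `EndPer`, as an automorphism of `F`. -/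
def conjAut (h : EndPer) : MulAut ThompsonF where
  toFun f := ⟨h * f * (h : ℝ ≃o ℝ)⁻¹, conj_mem_thompsonF h.2 f.2⟩
  invFun f := ⟨(h : ℝ ≃o ℝ)⁻¹ * f * h, by
    simpa using conj_mem_thompsonF (EndPer.inv_mem h.2) f.2⟩
  left_inv f := Subtype.ext (by simp only; group)
  right_inv f := Subtype.ext (by simp only; group)
  map_mul' f g := Subtype.ext (by simp only [Subgroup.coe_mul]; group)

theorem inducedBy_conjAut (h : EndPer) : InducedBy (conjAut h) h := fun _ => rfl

theorem inducedBy_unique {φ : MulAut ThompsonF} {g h : ℝ ≃o ℝ} (hg : InducedBy φ g)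
    (hh : InducedBy φ h) : g = h := by
  have : g⁻¹ * h = 1 := eq_one_of_commute fun f hf => by
    have := (hg ⟨f, hf⟩).symm.trans (hh ⟨f, hf⟩)
    simp only at this
    calc g⁻¹ * h * f = g⁻¹ * (h * f * h⁻¹) * h := by group
      _ = f * (g⁻¹ * h) := by rw [← this]; group
  rw [inv_mul_eq_one] at this
  exact this

/-- The orientation-preserving automorphisms of `F` are the conjugations by elements of
`EndPer`. -/
noncomputable def endPerEquiv : EndPer ≃* AutPlusF :=
  MulEquiv.ofBijective
    (MonoidHom.mk' (fun h => (⟨conjAut h, h, h.2.1, inducedBy_conjAut h⟩ : AutPlusF)) (by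
      intro g h
      refine Subtype.ext (MulEquiv.ext fun f => Subtype.ext ?_)
      change (g * h : ℝ ≃o ℝ) * f * (g * h : ℝ ≃o ℝ)⁻¹ = g * (h * f * (h : ℝ ≃o ℝ)⁻¹) * (g : ℝ ≃o ℝ)⁻¹
      group))
    ⟨by
      intro g h hgh
      have : conjAut g = conjAut h := congrArg Subtype.val hgh
      exact Subtype.ext (inducedBy_unique (inducedBy_conjAut g) (this ▸ inducedBy_conjAut h)),
    by
      rintro ⟨φ, h, hh, hφ⟩
      refine ⟨⟨h, mem_endPer_of_inducedBy hh hφ⟩, Subtype.ext (MulEquiv.ext fun f => Subtype.ext ?_)⟩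
      exact (hφ f).symm⟩

theorem inducedBy_endPerEquiv (h : EndPer) : InducedBy (endPerEquiv h : MulAut ThompsonF) h :=
  inducedBy_conjAut h

theorem inducedBy_endPerEquiv_symm (φ : AutPlusF) :
    InducedBy (φ : MulAut ThompsonF) (endPerEquiv.symm φ : EndPer) := by
  have := inducedBy_endPerEquiv (endPerEquiv.symm φ)
  rwa [MulEquiv.apply_symm_apply] at this

theorem conj_injective : Function.Injective (MulAut.conj : ThompsonF →* MulAut ThompsonF) := by
  intro f g hfg
  have hf : InducedBy (MulAut.conj f) f := fun _ => rfl
  have hg : InducedBy (MulAut.conj f) g := by rw [hfg]; exact fun _ => rfl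
  exact Subtype.ext (inducedBy_unique hf hg)

/-! ### The circle maps at the ends -/

/-- The homeomorphism of the circle induced by a map that commutes with `x ↦ x + 1`. -/
theorem exists_circle_homeomorph {f : ℝ ≃o ℝ} (hf : ∀ x, f (x + 1) = f x + 1) :
    ∃ g : AddCircle (1 : ℝ) ≃ₜ AddCircle (1 : ℝ),
      ∀ x : ℝ, g (x : AddCircle (1 : ℝ)) = (f x : AddCircle (1 : ℝ)) := by
  have key : ∀ f : ℝ ≃o ℝ, (∀ x, f (x + 1) = f x + 1) →
      ∃ g : AddCircle (1 : ℝ) → AddCircle (1 : ℝ), Continuous g ∧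
        ∀ x : ℝ, g (x : AddCircle (1 : ℝ)) = (f x : AddCircle (1 : ℝ)) := by
    intro f hf
    have hp : Function.Periodic (fun x : ℝ => (f x : AddCircle (1 : ℝ))) 1 := fun x => by
      simp only [hf, AddCircle.coe_add, AddCircle.coe_period, add_zero]
    refine ⟨hp.lift, ?_, fun x => hp.lift_coe x⟩
    refine (QuotientAddGroup.isQuotientMap_mk _).continuous_iff.2 ?_
    exact (AddCircle.continuous_mk' 1).comp f.continuous
  have hf' : ∀ x, f⁻¹ (x + 1) = f⁻¹ x + 1 := fun x => by
    rw [inv_apply_eq_iff, hf, RelIso.apply_inv_self]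
  obtain ⟨g, hg, hgf⟩ := key f hf
  obtain ⟨g', hg', hgf'⟩ := key f⁻¹ hf'
  refine ⟨⟨⟨g, g', fun x => ?_, fun x => ?_⟩, hg, hg'⟩, hgf⟩
  · induction x using QuotientAddGroup.induction_on with
    | H x => exact (congrArg g' (hgf x)).trans ((hgf' _).trans (by rw [RelIso.inv_apply_self]))
  · induction x using QuotientAddGroup.induction_on with
    | H x => exact (congrArg g (hgf' x)).trans ((hgf _).trans (by rw [RelIso.apply_inv_self]))

/-- A map that commutes with `x ↦ x + 1` near `∞` agrees there with one that does so everywhere. -/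
theorem exists_periodic_eq {h : ℝ ≃o ℝ} (hh : h ∈ evPer) (hPL : h ∈ PL2Plus) :
    ∃ f ∈ PL2Plus, (∀ x, f (x + 1) = f x + 1) ∧ ∃ M : ℝ, ∀ x, M < x → f x = h x := by
  obtain ⟨M, hM⟩ := evPer_add_int hh
  -- Shift `x` beyond `M`, apply `h`, shift back. By periodicity beyond `M` every sufficiently large
  -- shift gives the same value, which is `hF`.
  let F : ℝ → ℝ := fun x => h (x + (⌈M - x⌉₊ + 1 : ℕ)) - (⌈M - x⌉₊ + 1 : ℕ)
  have hF : ∀ (x : ℝ) (n : ℕ), M < x + n → F x = h (x + n) - n := by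
    intro x n hn
    have h0 : M < x + (⌈M - x⌉₊ + 1 : ℕ) := by
      have := Nat.le_ceil (M - x)
      push_cast; linarith
    have := hM (x + n) ((⌈M - x⌉₊ + 1 : ℕ) - n : ℤ) hn (by push_cast at h0 ⊢; linarith)
    have e : x + n + (((⌈M - x⌉₊ + 1 : ℕ) - n : ℤ) : ℝ) = x + (⌈M - x⌉₊ + 1 : ℕ) := by
      push_cast; ring
    rw [e] at this
    simp only [F]
    rw [this]
    push_cast; ring
  have hmono : StrictMono F := by
    intro x y hxy
    obtain ⟨n, hn⟩ := exists_nat_gt (M - x)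
    rw [hF x n (by linarith), hF y n (by linarith)]
    have := h.strictMono (show x + n < y + n by linarith)
    linarith
  let G : ℝ → ℝ := fun y => h⁻¹ (y + (⌈h M - y⌉₊ + 1 : ℕ)) - (⌈h M - y⌉₊ + 1 : ℕ)
  have hFG : Function.RightInverse G F := by
    intro y
    have h0 : h M < y + (⌈h M - y⌉₊ + 1 : ℕ) := by
      have := Nat.le_ceil (h M - y)
      push_cast; linarith
    have h1 : M < h⁻¹ (y + (⌈h M - y⌉₊ + 1 : ℕ)) := by
      rw [← h.lt_iff_lt, RelIso.apply_inv_self]; exact h0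
    rw [hF (G y) (⌈h M - y⌉₊ + 1)] <;> simp only [G, sub_add_cancel]
    · rw [RelIso.apply_inv_self, add_sub_cancel_right]
    · exact h1
  refine ⟨StrictMono.orderIsoOfRightInverse F hmono G hFG, ?_, fun x => ?_, M, fun x hx => ?_⟩
  · refine isPL2_of_eventuallyEq fun x => ?_
    obtain ⟨n, hn⟩ := exists_nat_gt (M - x + 1)
    refine ⟨(affIso 0 (-(n : ℤ) : ℤ) * h * affIso 0 (n : ℤ) : ℝ ≃o ℝ),
      PL2Plus.mul_mem (PL2Plus.mul_mem (affIso_mem 0 (isDyadic_int _)) hPL)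
        (affIso_mem 0 (isDyadic_int _)), ?_⟩
    filter_upwards [Ioi_mem_nhds (show x - 1 < x by linarith)] with y hy
    have hy : x - 1 < y := hy
    refine (hF y n (by linarith)).trans ?_
    simp [sub_eq_add_neg]
  · change F (x + 1) = F x + 1
    obtain ⟨n, hn⟩ := exists_nat_gt (M - x)
    rw [hF x n (by linarith), hF (x + 1) n (by linarith), show x + 1 + n = x + n + (1 : ℤ) by
      push_cast; ring, hM _ 1 (by linarith) (by push_cast; linarith)]
    push_cast; ring
  · change F x = h x
    rw [hF x 0 (by simpa using hx)]; simp

theorem exists_thompsonT_top {h : ℝ ≃o ℝ} (hh : h ∈ EndPer) :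
    ∃ g : ThompsonT, ∃ M : ℝ, ∀ x : ℝ, M < x →
      (g : AddCircle (1 : ℝ) ≃ₜ AddCircle (1 : ℝ)) (x : AddCircle (1 : ℝ)) = (h x : AddCircle (1 : ℝ)) := by
  obtain ⟨f, hf, hf1, M, hM⟩ := exists_periodic_eq hh.2.1 hh.1
  obtain ⟨g, hg⟩ := exists_circle_homeomorph hf1
  exact ⟨⟨g, f, hf, hf1, hg⟩, M, fun x hx => by rw [← hM x hx]; exact hg x⟩

theorem exists_thompsonT_bot {h : ℝ ≃o ℝ} (hh : h ∈ EndPer) :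
    ∃ g : ThompsonT, ∃ M : ℝ, ∀ x : ℝ, x < -M →
      (g : AddCircle (1 : ℝ) ≃ₜ AddCircle (1 : ℝ)) (x : AddCircle (1 : ℝ)) = (h x : AddCircle (1 : ℝ)) := by
  obtain ⟨f, hf, hf1, M, hM⟩ := exists_periodic_eq hh.2.2 (reflect_mem hh.1)
  have hf2 : ∀ x, reflect f (x + 1) = reflect f x + 1 := fun x => by
    have := hf1 (-(x + 1))
    rw [show -(x + 1) + 1 = -x by ring] at this
    rw [reflect_apply, reflect_apply]; linarith
  obtain ⟨g, hg⟩ := exists_circle_homeomorph hf2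
  refine ⟨⟨g, reflect f, reflect_mem hf, hf2, hg⟩, M, fun x hx => (hg x).trans ?_⟩
  rw [reflect_apply, hM (-x) (by linarith), reflect_apply, neg_neg, neg_neg]

theorem coe_eq_coe_iff_exists_int {x y : ℝ} :
    (x : AddCircle (1 : ℝ)) = (y : AddCircle (1 : ℝ)) ↔ ∃ n : ℤ, y = x + n := by
  rw [eq_comm, ← sub_eq_zero, ← AddCircle.coe_sub, AddCircle.coe_eq_zero_iff]
  refine exists_congr fun n => ?_
  rw [zsmul_one, eq_sub_iff_add_eq, eq_comm, add_comm]

theorem circle_ext_top {g g' : ThompsonT} {M : ℝ} (h : ∀ x : ℝ, M < x →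
    (g : AddCircle (1 : ℝ) ≃ₜ AddCircle (1 : ℝ)) (x : AddCircle (1 : ℝ)) =
      (g' : AddCircle (1 : ℝ) ≃ₜ AddCircle (1 : ℝ)) (x : AddCircle (1 : ℝ))) : g = g' := by
  refine Subtype.ext (Homeomorph.ext fun x => ?_)
  induction x using QuotientAddGroup.induction_on with
  | H x =>
    obtain ⟨n, hn⟩ := exists_nat_gt (M - x)
    have := h (x + n) (by linarith)
    have e : ((x + n : ℝ) : AddCircle (1 : ℝ)) = (x : AddCircle (1 : ℝ)) :=
      (coe_eq_coe_iff_exists_int.2 ⟨n, by simp⟩).symm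
    rw [e] at this
    exact this

theorem circle_ext_bot {g g' : ThompsonT} {M : ℝ} (h : ∀ x : ℝ, x < -M →
    (g : AddCircle (1 : ℝ) ≃ₜ AddCircle (1 : ℝ)) (x : AddCircle (1 : ℝ)) =
      (g' : AddCircle (1 : ℝ) ≃ₜ AddCircle (1 : ℝ)) (x : AddCircle (1 : ℝ))) : g = g' := by
  refine Subtype.ext (Homeomorph.ext fun x => ?_)
  induction x using QuotientAddGroup.induction_on with
  | H x =>
    obtain ⟨n, hn⟩ := exists_nat_gt (M + x)
    have := h (x - n) (by linarith)
    have e : ((x - n : ℝ) : AddCircle (1 : ℝ)) = (x : AddCircle (1 : ℝ)) :=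
      coe_eq_coe_iff_exists_int.2 ⟨n, by simp⟩
    rw [e] at this
    exact this

/-- The circle map induced near `∞`. -/
noncomputable def topMap : EndPer →* ThompsonT :=
  MonoidHom.mk' (fun h => (exists_thompsonT_top h.2).choose) (by
    intro g h
    obtain ⟨M, hM⟩ := (exists_thompsonT_top (g * h).2).choose_spec
    obtain ⟨M1, hM1⟩ := (exists_thompsonT_top g.2).choose_spec
    obtain ⟨M2, hM2⟩ := (exists_thompsonT_top h.2).choose_spec
    -- The reals beyond any bound cover the circle, so the chosen circle map is unique, and it
    -- suffices to compare far out.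
    refine circle_ext_top (M := max M (max M2 ((h : ℝ ≃o ℝ)⁻¹ M1))) fun x hx => ?_
    have h1 : M < x := (le_max_left _ _).trans_lt hx
    have h2 : M2 < x := ((le_max_left _ _).trans (le_max_right _ _)).trans_lt hx
    have h3 := ((le_max_right _ _).trans (le_max_right _ _)).trans_lt hx
    have h4 : M1 < (h : ℝ ≃o ℝ) x := by
      have := (h : ℝ ≃o ℝ).strictMono h3
      rwa [RelIso.apply_inv_self] at this
    rw [hM x h1]
    refine Eq.trans ?_ (congrArg _ (hM2 x h2)).symm
    exact (hM1 _ h4).symm)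

theorem topMap_spec (h : EndPer) : ∃ M : ℝ, ∀ x : ℝ, M < x →
    (topMap h : AddCircle (1 : ℝ) ≃ₜ AddCircle (1 : ℝ)) (x : AddCircle (1 : ℝ)) =
      ((h : ℝ ≃o ℝ) x : AddCircle (1 : ℝ)) :=
  (exists_thompsonT_top h.2).choose_spec

/-- The circle map induced near `-∞`. -/
noncomputable def botMap : EndPer →* ThompsonT :=
  MonoidHom.mk' (fun h => (exists_thompsonT_bot h.2).choose) (by
    intro g h
    obtain ⟨M, hM⟩ := (exists_thompsonT_bot (g * h).2).choose_spec
    obtain ⟨M1, hM1⟩ := (exists_thompsonT_bot g.2).choose_spec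
    obtain ⟨M2, hM2⟩ := (exists_thompsonT_bot h.2).choose_spec
    refine circle_ext_bot (M := max M (max M2 (-(h : ℝ ≃o ℝ)⁻¹ (-M1)))) fun x hx => ?_
    rw [lt_neg] at hx
    have h1 : M < -x := (le_max_left _ _).trans_lt hx
    have h2 : M2 < -x := ((le_max_left _ _).trans (le_max_right _ _)).trans_lt hx
    have h3 := ((le_max_right _ _).trans (le_max_right _ _)).trans_lt hx
    have h4 : (h : ℝ ≃o ℝ) x < -M1 := by
      have := (h : ℝ ≃o ℝ).strictMono (neg_lt_neg_iff.1 h3)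
      rwa [RelIso.apply_inv_self] at this
    rw [hM x (lt_neg.1 h1)]
    refine Eq.trans ?_ (congrArg _ (hM2 x (lt_neg.1 h2))).symm
    exact (hM1 _ h4).symm)

theorem botMap_spec (h : EndPer) : ∃ M : ℝ, ∀ x : ℝ, x < -M →
    (botMap h : AddCircle (1 : ℝ) ≃ₜ AddCircle (1 : ℝ)) (x : AddCircle (1 : ℝ)) =
      ((h : ℝ ≃o ℝ) x : AddCircle (1 : ℝ)) :=
  (exists_thompsonT_bot h.2).choose_spec

/-- Far out `h x - x` is an integer. On a period `[K, K + 1)` monotonicity and `h (K + 1) = h K + 1`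
confine it to a single value, and periodicity extends this. -/
theorem evTrans_of_coe_eq {h : ℝ ≃o ℝ} (hh : h ∈ evPer) {M : ℝ}
    (hM : ∀ x : ℝ, M < x → (x : AddCircle (1 : ℝ)) = (h x : AddCircle (1 : ℝ))) : EvTrans h := by
  obtain ⟨N, hN⟩ := evPer_add_int hh
  obtain ⟨K, hK⟩ := exists_nat_gt (max M N)
  have hKM : M < K := (le_max_left _ _).trans_lt hK
  have hKN : N < K := (le_max_right _ _).trans_lt hK
  obtain ⟨m, hm⟩ := coe_eq_coe_iff_exists_int.1 (hM K hKM)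
  have key : ∀ x : ℝ, K ≤ x → x < K + 1 → h x = x + m := by
    intro x h1 h2
    obtain ⟨n, hn⟩ := coe_eq_coe_iff_exists_int.1 (hM x (hKM.trans_le h1))
    have h3 := h.monotone h1
    have h4 := h.strictMono h2
    have h5 := hN K 1 hKN (by push_cast; linarith)
    push_cast at h5
    rw [h5] at h4
    rw [hn, hm] at h3 h4
    have h6 : ((n - m : ℤ) : ℝ) < ((1 : ℤ) : ℝ) := by push_cast; linarith
    have h7 : ((-1 : ℤ) : ℝ) < ((n - m : ℤ) : ℝ) := by push_cast; linarith
    rw [Int.cast_lt] at h6 h7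
    rw [hn, show n = m by omega]
  refine ⟨K, m, fun x hx => ?_⟩
  have h1 := Int.floor_le (x - K)
  have h2 := Int.lt_floor_add_one (x - K)
  have h3 := hN (x - ⌊x - K⌋) ⌊x - K⌋ (by linarith) (by linarith)
  rw [key (x - ⌊x - K⌋) (by linarith) (by linarith), sub_add_cancel] at h3
  rw [h3]; ring

theorem mem_thompsonF_of_maps_eq_one {h : EndPer} (h1 : topMap h = 1) (h2 : botMap h = 1) :
    (h : ℝ ≃o ℝ) ∈ ThompsonF := by
  obtain ⟨M, hM⟩ := topMap_spec h
  obtain ⟨N, hN⟩ := botMap_spec h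
  rw [h1] at hM
  rw [h2] at hN
  refine mem_thompsonF_iff.2 ⟨h.2.1, evTrans_of_coe_eq h.2.2.1 hM,
    evTrans_of_coe_eq h.2.2.2 (M := N) fun x hx => ?_⟩
  have := hN (-x) (by linarith)
  rw [reflect_apply, AddCircle.coe_neg, ← this]
  exact (neg_neg (x : AddCircle (1 : ℝ))).symm

theorem maps_eq_one_of_mem {h : EndPer} (hh : (h : ℝ ≃o ℝ) ∈ ThompsonF) :
    topMap h = 1 ∧ botMap h = 1 := by
  obtain ⟨-, K, k, l, -, h1, h2⟩ := hh
  obtain ⟨M, hM⟩ := topMap_spec h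
  obtain ⟨N, hN⟩ := botMap_spec h
  constructor
  · refine circle_ext_top (M := max K M) fun x hx => ?_
    rw [hM x ((le_max_right _ _).trans_lt hx), h1 x ((le_max_left _ _).trans_lt hx)]
    exact (coe_eq_coe_iff_exists_int.2 ⟨k, rfl⟩).symm
  · refine circle_ext_bot (M := max K N) fun x hx => ?_
    rw [lt_neg] at hx
    rw [hN x (lt_neg.1 ((le_max_right _ _).trans_lt hx)),
      h2 x (lt_neg.1 ((le_max_left _ _).trans_lt hx))]
    exact (coe_eq_coe_iff_exists_int.2 ⟨l, rfl⟩).symm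


/-! ### Verification of the relators

The generators are evaluated on intervals `[a / 1048576, b / 1048576]` with integers `a ≤ b` on which they
are affine. A word is trivial on such an interval if each of its letters is affine on the interval
reached so far, and the end points return to where they started. -/

/-- Comparison of constructor indices evaluates quickly in the kernel, where the relators are
checked. -/
instance : DecidableEq Gen := fun i j =>
  decidable_of_iff (i.ctorIdx = j.ctorIdx) (by cases i <;> cases j <;> simp [Gen.ctorIdx])

/-- The point that divides `[a / 1048576, b / 1048576]` in the ratio `θ : 1 - θ`. -/
noncomputable def pt (a b : ℤ) (θ : ℝ) : ℝ := (a + θ * (b - a)) / 1048576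

/-- `unit0` on an interval. -/
def unit0Z (a b : ℤ) : Option (ℤ × ℤ) :=
  if b ≤ 262144 then some (2 * a, 2 * b)
  else if 262144 ≤ a ∧ b ≤ 524288 then some (a + 262144, b + 262144)
  else if 524288 ≤ a ∧ a % 2 = 0 ∧ b % 2 = 0 then some ((a + 1048576) / 2, (b + 1048576) / 2)
  else none

/-- `unit1` on an interval. -/
def unit1Z (a b : ℤ) : Option (ℤ × ℤ) :=
  if b ≤ 524288 then some (a, b)
  else if 524288 ≤ a then
    match unit0Z (2 * a - 1048576) (2 * b - 1048576) with
    | none => none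
    | some (c, d) => if c % 2 = 0 ∧ d % 2 = 0 then some (524288 + c / 2, 524288 + d / 2) else none
  else none

/-- The periodic extension of a map of the unit interval, on an interval. -/
def perZ (u : ℤ → ℤ → Option (ℤ × ℤ)) (a b : ℤ) : Option (ℤ × ℤ) :=
  if b ≤ (a / 1048576 + 1) * 1048576 then
    match u (a - a / 1048576 * 1048576) (b - a / 1048576 * 1048576) with
    | none => none
    | some (c, d) => some (c + a / 1048576 * 1048576, d + a / 1048576 * 1048576)
  else none

/-- The generators on an interval. -/
def fwd : Gen → ℤ → ℤ → Option (ℤ × ℤ)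
  | .x0, a, b => some (a + 1048576, b + 1048576)
  | .x1, a, b => if b ≤ 0 then some (a, b)
      else if 0 ≤ a ∧ b ≤ 1048576 then some (2 * a, 2 * b)
      else if 1048576 ≤ a then some (a + 1048576, b + 1048576) else none
  | .y0, a, b => if b ≤ 0 then some (a, b) else if 0 ≤ a then perZ unit0Z a b else none
  | .y1, a, b => if b ≤ 0 then some (a, b) else if 0 ≤ a then perZ unit1Z a b else none
  | .s, a, b => if b ≤ 0 then some (a, b)
      else if 0 ≤ a ∧ b ≤ 524288 then some (2 * a, 2 * b)
      else if 524288 ≤ a then some (a + 524288, b + 524288) else none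
  | .z0, a, b => if 0 ≤ a then some (a, b) else if b ≤ 0 then perZ unit0Z a b else none
  | .z1, a, b => if 0 ≤ a then some (a, b) else if b ≤ 0 then perZ unit1Z a b else none
  | .t, a, b => if 0 ≤ a then some (a, b)
      else if -524288 ≤ a ∧ b ≤ 0 then some (2 * a, 2 * b)
      else if b ≤ -524288 then some (a - 524288, b - 524288) else none

/-- The inverse of `unit0` at a point. -/
def unit0InvZ (v : ℤ) : ℤ :=
  if v ≤ 524288 then v / 2 else if v ≤ 786432 then v - 262144 else 2 * v - 1048576

/-- The inverse of `unit1` at a point. -/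
def unit1InvZ (v : ℤ) : ℤ := if v ≤ 524288 then v else 524288 + unit0InvZ (2 * v - 1048576) / 2

/-- The inverses of the generators at a point. -/
def bwd : Gen → ℤ → ℤ
  | .x0, v => v - 1048576
  | .x1, v => if v ≤ 0 then v else if v ≤ 2097152 then v / 2 else v - 1048576
  | .y0, v => if v ≤ 0 then v else v / 1048576 * 1048576 + unit0InvZ (v % 1048576)
  | .y1, v => if v ≤ 0 then v else v / 1048576 * 1048576 + unit1InvZ (v % 1048576)
  | .s, v => if v ≤ 0 then v else if v ≤ 1048576 then v / 2 else v - 524288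
  | .z0, v => if 0 ≤ v then v else v / 1048576 * 1048576 + unit0InvZ (v % 1048576)
  | .z1, v => if 0 ≤ v then v else v / 1048576 * 1048576 + unit1InvZ (v % 1048576)
  | .t, v => if 0 ≤ v then v else if -1048576 ≤ v then v / 2 else v + 524288

/-- The condition that makes the generators commute with translations in the direction `σ`. -/
def guard : SignType → ℤ → ℤ → Bool
  | .zero, _, _ => true
  | .pos, a, _ => 1048576 ≤ a
  | .neg, _, b => b ≤ -1048576

/-- A letter on an interval. -/
def stepZ (σ : SignType) (l : Gen × Bool) (p : ℤ × ℤ) : Option (ℤ × ℤ) :=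
  if p.1 ≤ p.2 then
    match l.2 with
    | true => if guard σ p.1 p.2 then fwd l.1 p.1 p.2 else none
    -- The value of `bwd` is only a guess: `fwd` has to return the given interval. Hence only `fwd`
    -- needs a proof of correctness.
    | false =>
      if bwd l.1 p.1 ≤ bwd l.1 p.2 ∧ guard σ (bwd l.1 p.1) (bwd l.1 p.2) = true ∧
        fwd l.1 (bwd l.1 p.1) (bwd l.1 p.2) = some p
      then some (bwd l.1 p.1, bwd l.1 p.2) else none
  else none

/-- Application to an integer that is evaluated first. -/
def withEval {α : Type*} (x : ℤ) (k : ℤ → α) : α :=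
  match x with
  | .ofNat 0 => k 0
  | .ofNat (n + 1) => k (.ofNat (n + 1))
  | .negSucc 0 => k (-1)
  | .negSucc (n + 1) => k (.negSucc (n + 1))

/-- Whether the word `w` maps the interval `q` affinely to the interval `p`, up to a subdivision.
The first argument bounds the number of steps. -/
def runZ (σ : SignType) : ℕ → List (Gen × Bool) → ℤ × ℤ → ℤ × ℤ → Bool
  | 0, _, _, _ => false
  | _ + 1, [], p, q => p = q
  | n + 1, l :: w, p, q => match stepZ σ l q with
    | some q' => withEval q'.1 fun c => withEval q'.2 fun d => runZ σ n w p (c, d)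
    -- The letter is not accepted on the whole interval. Source and target are halved at
    -- corresponding midpoints, which must lie on the grid.
    | none => decide ((p.1 + p.2) % 2 = 0) && decide ((q.1 + q.2) % 2 = 0) &&
        withEval ((p.1 + p.2) / 2) fun m => withEval ((q.1 + q.2) / 2) fun c =>
          runZ σ n (l :: w) (p.1, m) (q.1, c) && runZ σ n (l :: w) (m, p.2) (c, q.2)

/-- Whether the word `w` is trivial. -/
def checkZ (w : List (Gen × Bool)) : Bool :=
  runZ 0 100 w (-4194304, 4194304) (-4194304, 4194304) &&
    runZ 1 100 w (4194304, 5242880) (4194304, 5242880) &&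
    runZ (-1) 100 w (-5242880, -4194304) (-5242880, -4194304)

/-- The list of all relators. -/
def relList : List (FreeGroup Gen) :=
  [f1 x₀ x₁, f2 x₀ x₁,
   comm y₀ z₀, comm y₀ z₁, comm y₀ t, comm y₁ z₀, comm y₁ z₁, comm y₁ t,
   comm s z₀, comm s z₁, comm s t,
   f1 y₀ y₁,
   f2 y₀ y₁,
   t1 y₀ y₁ s * (x₁ ^ 4 * x₀⁻¹ ^ 3 * x₁⁻¹ * x₀ ^ 2 * x₁⁻¹ * x₀ * x₁⁻¹)⁻¹,
   t2 y₀ y₁ s * (x₁ ^ 8 * x₀⁻¹ ^ 7 * x₁⁻¹ * x₀ ^ 2 * x₁⁻¹ * x₀ * x₁⁻¹ * x₀ * x₁⁻¹ * x₀ ^ 2 *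
     x₁⁻¹ * x₀ * x₁⁻¹)⁻¹,
   t3 y₀ y₁ s * (x₁ ^ 5 * x₀⁻¹ ^ 3 * x₁ ^ 2 * x₀⁻¹ * x₁ * x₀⁻¹ ^ 3 * x₁⁻¹ * x₀ ^ 2 * x₁⁻¹ * x₀ *
     x₁⁻¹ * x₀ * x₁⁻¹ * x₀ ^ 2 * x₁⁻¹ * x₀ * x₁⁻¹ ^ 2)⁻¹,
   t4 s * (x₁ ^ 2 * x₀⁻¹ * x₁⁻¹ * x₀)⁻¹,
   f1 z₀ z₁,
   f2 z₀ z₁,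
   t1 z₀ z₁ t * (x₀ * x₁ * x₀⁻¹ * x₁ ^ 2 * x₀⁻¹ ^ 2 * x₁ * x₀ * x₁⁻¹ * x₀ * x₁⁻¹ * x₀ * x₁⁻¹ *
     x₀⁻¹ ^ 2)⁻¹,
   t2 z₀ z₁ t * (x₀ * x₁ * x₀⁻¹ * x₁ * x₀ * x₁⁻¹ * x₀⁻¹ * x₁ ^ 2 * x₀⁻¹ * x₁⁻¹ * x₀ * x₁⁻¹ *
     x₀⁻¹)⁻¹,
   t3 z₀ z₁ t * (x₀ * x₁ * x₀⁻¹ * x₁ ^ 2 * x₀⁻¹ ^ 2 * x₁ * x₀⁻¹ * x₁ * x₀⁻¹ * x₁ * x₀⁻¹ *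
     x₁ ^ 2 * x₀⁻¹ * x₁ * x₀⁻¹ * x₁⁻¹ * x₀ * x₁⁻¹ * x₀ * x₁⁻¹ * x₀ * x₁⁻¹ * x₀ ^ 2 * x₁⁻¹ * x₀ *
     x₁⁻¹ * x₀ * x₁⁻¹ * x₀ * x₁⁻¹ * x₀⁻¹ ^ 2)⁻¹,
   t4 t * (x₀ * x₁ * x₀⁻¹ * x₁ * x₀ * x₁⁻¹ * x₀⁻¹ ^ 2)⁻¹,
   y₀ * x₀ * y₀⁻¹ * (x₀ * x₁ * x₀⁻¹ * x₁ * x₀ * x₁⁻¹ ^ 2)⁻¹,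
   y₀ * x₁ * y₀⁻¹ * (x₁ ^ 3 * x₀⁻¹ * x₁ * x₀⁻¹ ^ 3 * x₁ * x₀ * x₁⁻¹ ^ 2 * x₀ ^ 3 * x₁⁻¹ ^ 2)⁻¹,
   y₁ * x₀ * y₁⁻¹ * (x₀ * x₁ * x₀⁻¹ * x₁ * x₀⁻¹ * x₁ * x₀ * x₁⁻¹ ^ 2 * x₀ * x₁⁻¹)⁻¹,
   y₁ * x₁ * y₁⁻¹ * (x₁ ^ 2 * x₀⁻¹ * x₁ * x₀⁻¹ * x₁ * x₀⁻¹ ^ 2 * x₁ ^ 2 * x₀⁻¹ ^ 2 * x₁ * x₀ *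
     x₁⁻¹ ^ 2 * x₀ * x₁⁻¹ * x₀ ^ 3 * x₁⁻¹ ^ 2 * x₀ * x₁⁻¹)⁻¹,
   s * x₀ * s⁻¹ * (x₁ ^ 2 * x₀⁻¹ * x₁⁻¹ * x₀ ^ 2 * x₁⁻¹)⁻¹,
   s * x₁ * s⁻¹ * (x₁ ^ 2 * x₀⁻¹ * x₁ * x₀ * x₁⁻¹ * x₀⁻¹ * x₁⁻¹ * x₀)⁻¹,
   z₀ * x₀ * z₀⁻¹ * (x₀ * x₁ ^ 2 * x₀⁻¹ * x₁⁻¹ * x₀ * x₁⁻¹)⁻¹,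
   z₀ * x₁ * z₀⁻¹ * x₁⁻¹,
   z₁ * x₀ * z₁⁻¹ * (x₀ * x₁ * x₀⁻¹ * x₁ ^ 2 * x₀⁻¹ * x₁⁻¹ * x₀ * x₁⁻¹ * x₀ * x₁⁻¹)⁻¹,
   z₁ * x₁ * z₁⁻¹ * x₁⁻¹,
   t * x₀ * t⁻¹ * (x₀ * x₁ * x₀ * x₁ * x₀⁻¹ * x₁⁻¹ * x₀ * x₁⁻¹ * x₀⁻¹)⁻¹,
   t * x₁ * t⁻¹ * x₁⁻¹]

/-- This computation is the verification of all relators. The grid `2 ^ (-20)` is fine enough for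
all subdivisions that occur. -/
theorem checkZ_relList : relList.all (fun r => checkZ r.toWord) = true := by decide +kernel

theorem nodup_relList : relList.Nodup := by decide +kernel

theorem mem_relList_iff {r : FreeGroup Gen} : r ∈ relList ↔ r ∈ relators := by
  simp only [relList, relators, kernelRelators, commutationRelators, liftedRelators,
    actionRelators, Set.mem_union, Set.mem_insert_iff, Set.mem_singleton_iff, List.mem_cons,
    List.not_mem_nil, or_false, or_assoc]

theorem ncard_relators : relators.ncard = 35 := by
  have h : relators = (relList.toFinset : Set (FreeGroup Gen)) := by
    ext r
    rw [Finset.mem_coe, List.mem_toFinset, mem_relList_iff]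
  rw [h, Set.ncard_coe_finset, List.toFinset_card_of_nodup nodup_relList]
  rfl

/-! ### Soundness of the evaluation on intervals -/

section Spec

variable {a b c d : ℤ} {θ : ℝ}

theorem le_pt (hab : a ≤ b) (h0 : 0 ≤ θ) {m : ℤ} (hm : m ≤ a) : (m : ℝ) / 1048576 ≤ pt a b θ := by
  have h1 : (a : ℝ) ≤ b := by exact_mod_cast hab
  have h2 : (m : ℝ) ≤ a := by exact_mod_cast hm
  rw [pt]
  gcongr
  nlinarith [mul_nonneg h0 (sub_nonneg.2 h1)]

theorem pt_le (hab : a ≤ b) (h1 : θ ≤ 1) {m : ℤ} (hm : b ≤ m) : pt a b θ ≤ (m : ℝ) / 1048576 := by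
  have h2 : (a : ℝ) ≤ b := by exact_mod_cast hab
  have h3 : (b : ℝ) ≤ m := by exact_mod_cast hm
  rw [pt]
  gcongr
  nlinarith [mul_nonneg (sub_nonneg.2 h1) (sub_nonneg.2 h2)]

theorem unit0_of_le {u : ℝ} (h : u ≤ 1 / 4) : unit0 u = 2 * u := if_pos h

theorem unit0_of_mem {u : ℝ} (h : 1 / 4 ≤ u) (h' : u ≤ 1 / 2) : unit0 u = u + 1 / 4 := by
  rw [unit0, if_pos h']
  split_ifs
  · linarith
  · rfl

theorem unit0_of_ge {u : ℝ} (h : 1 / 2 ≤ u) : unit0 u = (u + 1) / 2 := by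
  rw [unit0, if_neg (by linarith)]
  split_ifs
  · linarith
  · rfl

theorem unit1_of_le {u : ℝ} (h : u ≤ 1 / 2) : unit1 u = u := if_pos h

theorem unit1_of_ge {u : ℝ} (h : 1 / 2 ≤ u) : unit1 u = 1 / 2 + unit0 (2 * u - 1) / 2 := by
  rcases h.eq_or_lt with rfl | h
  · norm_num [unit1, unit0]
  · exact if_neg (not_le.2 h)

theorem unit0Z_spec (hab : a ≤ b) (h : unit0Z a b = some (c, d)) (h0 : 0 ≤ θ) (h1 : θ ≤ 1) :
    unit0Iso (pt a b θ) = pt c d θ := by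
  rw [unit0Iso_apply]
  unfold unit0Z at h
  split_ifs at h with h2 h3 h4 <;> simp only [Option.some.injEq, Prod.mk.injEq] at h
  · obtain ⟨rfl, rfl⟩ := h
    rw [unit0_of_le ((pt_le hab h1 h2).trans (by norm_num))]
    simp only [pt]; push_cast; ring
  · obtain ⟨rfl, rfl⟩ := h
    rw [unit0_of_mem (le_trans (by norm_num) (le_pt hab h0 h3.1))
      ((pt_le hab h1 h3.2).trans (by norm_num))]
    simp only [pt]; push_cast; ring
  · obtain ⟨rfl, rfl⟩ := h
    rw [unit0_of_ge (le_trans (by norm_num) (le_pt hab h0 h4.1))]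
    obtain ⟨k, rfl⟩ : ∃ k, a = 2 * k := ⟨a / 2, by omega⟩
    obtain ⟨l, rfl⟩ : ∃ l, b = 2 * l := ⟨b / 2, by omega⟩
    rw [show (2 * k + 1048576) / 2 = k + 524288 by omega,
      show (2 * l + 1048576) / 2 = l + 524288 by omega]
    simp only [pt]; push_cast; ring

theorem unit1Z_spec (hab : a ≤ b) (h : unit1Z a b = some (c, d)) (h0 : 0 ≤ θ) (h1 : θ ≤ 1) :
    unit1Iso (pt a b θ) = pt c d θ := by
  rw [unit1Iso_apply]
  unfold unit1Z at h
  split_ifs at h with h2 h3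
  · simp only [Option.some.injEq, Prod.mk.injEq] at h
    obtain ⟨rfl, rfl⟩ := h
    exact unit1_of_le ((pt_le hab h1 h2).trans (by norm_num))
  · rcases hu : unit0Z (2 * a - 1048576) (2 * b - 1048576) with _ | ⟨e, f⟩
    · simp [hu] at h
    · simp only [hu] at h
      split_ifs at h with h4
      simp only [Option.some.injEq, Prod.mk.injEq] at h
      obtain ⟨rfl, rfl⟩ := h
      have := unit0Z_spec (by omega) hu h0 h1
      rw [unit0Iso_apply] at this
      rw [unit1_of_ge (le_trans (by norm_num) (le_pt hab h0 h3)),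
        show 2 * pt a b θ - 1 = pt (2 * a - 1048576) (2 * b - 1048576) θ by
          simp only [pt]; push_cast; ring, this]
      obtain ⟨k, rfl⟩ : ∃ k, e = 2 * k := ⟨e / 2, by omega⟩
      obtain ⟨l, rfl⟩ : ∃ l, f = 2 * l := ⟨f / 2, by omega⟩
      rw [show 2 * k / 2 = k by omega, show 2 * l / 2 = l by omega]
      simp only [pt]; push_cast; ring

theorem perZ_spec {u : ℤ → ℤ → Option (ℤ × ℤ)} {U : ℝ ≃o ℝ} (hU0 : U 0 = 0) (hU1 : U 1 = 1)
    (hu : ∀ {a b c d : ℤ}, a ≤ b → u a b = some (c, d) → U (pt a b θ) = pt c d θ)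
    (hab : a ≤ b) (h : perZ u a b = some (c, d)) (h0 : 0 ≤ θ) (h1 : θ ≤ 1) :
    perIso U hU0 hU1 (pt a b θ) = pt c d θ := by
  unfold perZ at h
  split_ifs at h with h2
  rcases hv : u (a - a / 1048576 * 1048576) (b - a / 1048576 * 1048576) with _ | ⟨e, f⟩
  · simp [hv] at h
  · simp only [hv, Option.some.injEq, Prod.mk.injEq] at h
    obtain ⟨rfl, rfl⟩ := h
    generalize hn : a / 1048576 = n at *
    have hv := hu (by omega) hv
    rw [perIso_of_mem hU0 hU1 n, show pt a b θ - n = pt (a - n * 1048576) (b - n * 1048576) θ by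
      simp only [pt]; push_cast; ring, hv]
    · simp only [pt]; push_cast; ring
    · refine le_trans ?_ (le_pt hab h0 (show n * 1048576 ≤ a by omega))
      push_cast; linarith
    · refine (pt_le hab h1 h2).trans ?_
      push_cast; linarith

theorem fwd_spec (i : Gen) (hab : a ≤ b) (h : fwd i a b = some (c, d)) (h0 : 0 ≤ θ) (h1 : θ ≤ 1) :
    genIso i (pt a b θ) = pt c d θ := by
  have hle : ∀ m : ℤ, b ≤ m → pt a b θ ≤ (m : ℝ) / 1048576 := fun m hm => pt_le hab h1 hm
  have hge : ∀ m : ℤ, m ≤ a → (m : ℝ) / 1048576 ≤ pt a b θ := fun m hm => le_pt hab h0 hm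
  have hy : ∀ {u : ℤ → ℤ → Option (ℤ × ℤ)} {p : ℝ ≃o ℝ} (hp : affIso 0 0 0 = p 0),
      (perZ u a b = some (c, d) → p (pt a b θ) = pt c d θ) →
      (if b ≤ 0 then some (a, b) else if 0 ≤ a then perZ u a b else none) = some (c, d) →
      glue 0 (affIso 0 0) p hp (pt a b θ) = pt c d θ := by
    intro u p hp h2 h3
    split_ifs at h3 with h4 h5
    · simp only [Option.some.injEq, Prod.mk.injEq] at h3
      obtain ⟨rfl, rfl⟩ := h3
      rw [glue_of_le _ ((hle 0 h4).trans (by norm_num))]; simp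
    · rw [glue_of_ge _ (le_trans (by norm_num) (hge 0 h5)), h2 h3]
  have hz : ∀ {u : ℤ → ℤ → Option (ℤ × ℤ)} {p : ℝ ≃o ℝ} (hp : p 0 = affIso 0 0 0),
      (perZ u a b = some (c, d) → p (pt a b θ) = pt c d θ) →
      (if 0 ≤ a then some (a, b) else if b ≤ 0 then perZ u a b else none) = some (c, d) →
      glue 0 p (affIso 0 0) hp (pt a b θ) = pt c d θ := by
    intro u p hp h2 h3
    split_ifs at h3 with h4 h5
    · simp only [Option.some.injEq, Prod.mk.injEq] at h3
      obtain ⟨rfl, rfl⟩ := h3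
      rw [glue_of_ge _ (le_trans (by norm_num) (hge 0 h4))]; simp
    · rw [glue_of_le _ ((hle 0 h5).trans (by norm_num)), h2 h3]
  have hp0 : perZ unit0Z a b = some (c, d) → per0 (pt a b θ) = pt c d θ := fun h =>
    perZ_spec _ _ (fun hab h => unit0Z_spec hab h h0 h1) hab h h0 h1
  have hp1 : perZ unit1Z a b = some (c, d) → per1 (pt a b θ) = pt c d θ := fun h =>
    perZ_spec _ _ (fun hab h => unit1Z_spec hab h h0 h1) hab h h0 h1
  cases i <;> simp only [fwd] at h
  · simp only [Option.some.injEq, Prod.mk.injEq] at h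
    obtain ⟨rfl, rfl⟩ := h
    rw [genIso_x0]
    simp only [pt]; push_cast; ring
  · split_ifs at h with h2 h3 h4 <;> simp only [Option.some.injEq, Prod.mk.injEq] at h <;>
      obtain ⟨rfl, rfl⟩ := h
    · exact genIso_x1_of_nonpos ((hle 0 h2).trans (by norm_num))
    · rw [genIso_x1_of_mem (le_trans (by norm_num) (hge 0 h3.1))
        ((hle _ h3.2).trans (by norm_num))]
      simp only [pt]; push_cast; ring
    · rw [genIso_x1_of_ge (le_trans (by norm_num) (hge _ h4))]
      simp only [pt]; push_cast; ring
  · exact hy (by simp [per0_zero]) hp0 h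
  · exact hy (by simp [per1_zero]) hp1 h
  · split_ifs at h with h2 h3 h4 <;> simp only [Option.some.injEq, Prod.mk.injEq] at h <;>
      obtain ⟨rfl, rfl⟩ := h <;> simp only [genIso]
    · rw [glue_of_le _ ((hle 0 h2).trans (by norm_num))]; simp
    · rw [glue_of_ge _ (le_trans (by norm_num) (hge 0 h3.1)),
        glue_of_le _ ((hle _ h3.2).trans (by norm_num))]
      simp only [pt, affIso_apply]; push_cast; norm_num; ring
    · have := hge _ h4
      norm_num at this
      rw [glue_of_ge _ (by linarith), glue_of_ge _ (by linarith)]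
      simp only [pt, affIso_apply]; push_cast; norm_num; ring
  · exact hz (by simp [per0_zero]) hp0 h
  · exact hz (by simp [per1_zero]) hp1 h
  · split_ifs at h with h2 h3 h4 <;> simp only [Option.some.injEq, Prod.mk.injEq] at h <;>
      obtain ⟨rfl, rfl⟩ := h <;> simp only [genIso]
    · rw [glue_of_ge _ (le_trans (by norm_num) (hge 0 h2))]; simp
    · rw [glue_of_le _ ((hle 0 h3.2).trans (by norm_num)),
        glue_of_ge _ (le_trans (by norm_num) (hge _ h3.1))]
      simp only [pt, affIso_apply]; push_cast; norm_num; ring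
    · have := hle _ h4
      norm_num at this
      rw [glue_of_le _ (by linarith), glue_of_le _ (by linarith)]
      simp only [pt, affIso_apply]; push_cast; norm_num; ring

/-- The guard keeps the interval beyond `1` or below `-1`, where the generators commute with unit
steps away from `0`. One check thus covers all translates; for `σ = 0` nothing is shifted. -/
theorem genIso_shift (σ : SignType) (i : Gen) (hab : a ≤ b) (hg : guard σ a b = true) (h0 : 0 ≤ θ)
    (h1 : θ ≤ 1) (j : ℕ) :
    genIso i (pt a b θ + ((σ : ℤ) : ℝ) * j) = genIso i (pt a b θ) + ((σ : ℤ) : ℝ) * j := by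
  cases σ
  · simp
  · have h2 : b ≤ -1048576 := by simpa [guard] using hg
    have h3 := pt_le hab h1 h2
    norm_num at h3
    simp only [SignType.neg_eq_neg_one, SignType.coe_neg, SignType.coe_one, Int.cast_neg,
      Int.cast_one, neg_one_mul]
    induction j with
    | zero => simp
    | succ j ih =>
      have hj : (0 : ℝ) ≤ j := by positivity
      push_cast
      have := genIso_sub_one_of_le i (x := pt a b θ + -j) (by linarith)
      rw [ih] at this
      rw [show pt a b θ + -((j : ℝ) + 1) = pt a b θ + -j - 1 by ring, this]; ring
  · have h2 : 1048576 ≤ a := by simpa [guard] using hg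
    have h3 := le_pt hab h0 h2
    norm_num at h3
    simp only [SignType.pos_eq_one, SignType.coe_one, Int.cast_one, one_mul]
    induction j with
    | zero => simp
    | succ j ih =>
      have hj : (0 : ℝ) ≤ j := by positivity
      push_cast
      have := genIso_add_one_of_le i (x := pt a b θ + j) (by linarith)
      rw [ih] at this
      rw [← add_assoc, this]; ring

/-- The order automorphism named by a letter. -/
noncomputable def letterIso (l : Gen × Bool) : ℝ ≃o ℝ :=
  cond l.2 (genIso l.1) (genIso l.1)⁻¹

theorem stepZ_spec (σ : SignType) (l : Gen × Bool) {p q : ℤ × ℤ} (h : stepZ σ l p = some q)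
    (h0 : 0 ≤ θ) (h1 : θ ≤ 1) (j : ℕ) :
    letterIso l (pt p.1 p.2 θ + ((σ : ℤ) : ℝ) * j) = pt q.1 q.2 θ + ((σ : ℤ) : ℝ) * j := by
  obtain ⟨i, e⟩ := l
  by_cases hp : p.1 ≤ p.2
  · cases e <;> simp only [stepZ, if_pos hp] at h <;> split_ifs at h with h2
    · obtain ⟨h3, h4, h5⟩ := h2
      simp only [Option.some.injEq] at h
      subst h
      simp only [letterIso, cond_false]
      rw [inv_apply_eq_iff, genIso_shift σ i h3 h4 h0 h1, fwd_spec i h3 h5 h0 h1]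
    · simp only [letterIso, cond_true]
      rw [genIso_shift σ i hp h2 h0 h1, fwd_spec i hp h h0 h1]
  · simp [stepZ, if_neg hp] at h

/-- The action of words: the product of two letters stands for first the one, then the other. -/
noncomputable def wordAct : FreeGroup Gen →* (ℝ ≃o ℝ) := FreeGroup.lift fun i => (genIso i)⁻¹

theorem wordAct_mk_cons (l : Gen × Bool) (w : List (Gen × Bool)) :
    wordAct (FreeGroup.mk (l :: w)) = (letterIso l)⁻¹ * wordAct (FreeGroup.mk w) := by
  obtain ⟨i, e⟩ := l
  cases e <;> simp [wordAct, letterIso]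

/-- The case distinction only makes the kernel compute the integer before it is used. -/
theorem withEval_eq {α : Type*} (x : ℤ) (k : ℤ → α) : withEval x k = k x := by
  unfold withEval
  split <;> rfl

/-- A word `l :: w` acts as `l⁻¹` after `w`, so it takes `p` to `q` if `w` takes `p` to the image of
`q` under `l`. Letters are therefore consumed by moving the target `q`, while `p` is merely
subdivided. -/
theorem runZ_spec (σ : SignType) (n : ℕ) (w : List (Gen × Bool)) (p q : ℤ × ℤ)
    (h : runZ σ n w p q = true) (h0 : 0 ≤ θ) (h1 : θ ≤ 1) (j : ℕ) :
    wordAct (FreeGroup.mk w) (pt p.1 p.2 θ + ((σ : ℤ) : ℝ) * j) =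
      pt q.1 q.2 θ + ((σ : ℤ) : ℝ) * j := by
  induction n generalizing w p q θ with
  | zero => simp [runZ] at h
  | succ n ih =>
    rcases w with _ | ⟨l, w⟩
    · simp only [runZ, decide_eq_true_eq] at h
      subst h
      rw [← FreeGroup.one_eq_mk, map_one, RelIso.one_apply]
    · rw [runZ] at h
      rcases hs : stepZ σ l q with _ | q'
      · simp only [hs, withEval_eq, Bool.and_eq_true, decide_eq_true_eq] at h
        obtain ⟨⟨h2, h3⟩, h4, h5⟩ := h
        obtain ⟨p1, p2⟩ := p
        obtain ⟨q1, q2⟩ := q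
        simp only at *
        obtain ⟨m, hm⟩ : ∃ m, p1 + p2 = 2 * m := ⟨(p1 + p2) / 2, by omega⟩
        obtain ⟨m', hm'⟩ : ∃ m', q1 + q2 = 2 * m' := ⟨(q1 + q2) / 2, by omega⟩
        rw [hm, hm', Int.mul_ediv_cancel_left _ two_ne_zero,
          Int.mul_ediv_cancel_left _ two_ne_zero] at h4 h5
        have e1 : (p1 : ℝ) + p2 = 2 * m := by exact_mod_cast hm
        have e2 : (q1 : ℝ) + q2 = 2 * m' := by exact_mod_cast hm'
        -- The ratio `θ` becomes `2 * θ` in the left half and `2 * θ - 1` in the right half.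
        rcases le_total θ (1 / 2) with hθ | hθ
        · have := ih _ _ _ h4 (θ := 2 * θ) (by linarith) (by linarith)
          simp only [pt] at this ⊢
          rw [show (p1 : ℝ) + θ * (p2 - p1) = p1 + 2 * θ * (m - p1) by linear_combination θ * e1,
            this]
          linear_combination (-θ / 1048576) * e2
        · have := ih _ _ _ h5 (θ := 2 * θ - 1) (by linarith) (by linarith)
          simp only [pt] at this ⊢
          rw [show (p1 : ℝ) + θ * (p2 - p1) = m + (2 * θ - 1) * (p2 - m) by
            linear_combination (1 - θ) * e1, this]
          linear_combination (-(1 - θ) / 1048576) * e2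
      · simp only [hs, withEval_eq] at h
        rw [wordAct_mk_cons, RelIso.mul_apply, ih _ _ _ h h0 h1, inv_apply_eq_iff,
          stepZ_spec σ l hs h0 h1]

/-- The line is covered by `[-4, 4]`, the translates of `[4, 5]` to the right and those of `[-5,
-4]` to the left. -/
theorem checkZ_spec {w : List (Gen × Bool)} (h : checkZ w = true) :
    wordAct (FreeGroup.mk w) = 1 := by
  simp only [checkZ, Bool.and_eq_true] at h
  obtain ⟨⟨h1, h2⟩, h3⟩ := h
  ext x
  rw [RelIso.one_apply]
  rcases le_total x (-4) with hx | hx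
  · have e1 := Nat.floor_le (show 0 ≤ -4 - x by linarith)
    have e2 := Nat.lt_floor_add_one (-4 - x)
    have := runZ_spec _ _ _ _ _ h3 (θ := x + ⌊-4 - x⌋₊ + 5) (by linarith) (by linarith) ⌊-4 - x⌋₊
    have e3 : pt (-5242880) (-4194304) (x + ⌊-4 - x⌋₊ + 5) + (((-1 : SignType) : ℤ) : ℝ) * ⌊-4 - x⌋₊
        = x := by
      simp only [pt, SignType.coe_neg, SignType.coe_one]
      push_cast; ring
    simpa only [e3] using this
  rcases le_total x 4 with hx' | hx'
  · have := runZ_spec _ _ _ _ _ h1 (θ := (x + 4) / 8) (by linarith) (by linarith) 0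
    have e3 : pt (-4194304) 4194304 ((x + 4) / 8) + (((0 : SignType) : ℤ) : ℝ) * (0 : ℕ) = x := by
      simp only [pt]
      push_cast; ring
    simpa only [e3] using this
  · have e1 := Nat.floor_le (show 0 ≤ x - 4 by linarith)
    have e2 := Nat.lt_floor_add_one (x - 4)
    have := runZ_spec _ _ _ _ _ h2 (θ := x - 4 - ⌊x - 4⌋₊) (by linarith) (by linarith) ⌊x - 4⌋₊
    have e3 : pt 4194304 5242880 (x - 4 - ⌊x - 4⌋₊) + (((1 : SignType) : ℤ) : ℝ) * ⌊x - 4⌋₊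
        = x := by
      simp only [pt, SignType.coe_one]
      push_cast; ring
    simpa only [e3] using this

end Spec

theorem wordAct_eq_one {r : FreeGroup Gen} (hr : r ∈ relators) : wordAct r = 1 := by
  have h := List.all_eq_true.1 checkZ_relList r (mem_relList_iff.2 hr)
  rw [← FreeGroup.mk_toWord (x := r)]
  exact checkZ_spec h


/-! ### The identification of the line with the open unit interval -/

/-- The piecewise linear version of `x ↦ 2 ^ x`. -/
noncomputable def expo (x : ℝ) : ℝ := (2 : ℝ) ^ ⌊x⌋ * (1 + Int.fract x)

theorem expo_of_mem (n : ℤ) {x : ℝ} (hx : n ≤ x) (hx' : x ≤ n + 1) :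
    expo x = (2 : ℝ) ^ n * (1 + (x - n)) := by
  rcases hx'.eq_or_lt with rfl | hx'
  · have : ⌊(n : ℝ) + 1⌋ = n + 1 := by simp
    rw [expo, Int.fract, this, zpow_add₀ (by norm_num)]
    push_cast; ring
  · have : ⌊x⌋ = n := Int.floor_eq_iff.2 ⟨hx, hx'⟩
    rw [expo, Int.fract, this]

theorem expo_add_int (x : ℝ) (n : ℤ) : expo (x + n) = (2 : ℝ) ^ n * expo x := by
  rw [expo, expo, Int.floor_add_intCast, Int.fract_add_intCast, zpow_add₀ (by norm_num)]
  ring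

theorem expo_add_one (x : ℝ) : expo (x + 1) = 2 * expo x := by
  simpa using expo_add_int x 1

theorem expo_zero : expo 0 = 1 := by simp [expo]

theorem expo_pos (x : ℝ) : 0 < expo x := by
  have := Int.fract_nonneg x
  unfold expo; positivity

theorem expo_strictMono : StrictMono expo := by
  intro x y hxy
  have hx1 := Int.fract_lt_one x
  have hy0 := Int.fract_nonneg y
  rcases (Int.floor_le_floor hxy.le).eq_or_lt with h | h
  · have : Int.fract x < Int.fract y := by rw [Int.fract, Int.fract, h]; linarith
    unfold expo
    rw [h]
    gcongr
  · have h1 : (2 : ℝ) ^ (⌊x⌋ + 1) ≤ 2 ^ ⌊y⌋ := zpow_le_zpow_right₀ (by norm_num) h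
    rw [zpow_add₀ (by norm_num), zpow_one] at h1
    have h2 : (0 : ℝ) < 2 ^ ⌊x⌋ := by positivity
    have h3 : (0 : ℝ) < 2 ^ ⌊y⌋ := by positivity
    unfold expo
    nlinarith

theorem exists_expo_eq {y : ℝ} (hy : 0 < y) : ∃ x, expo x = y := by
  obtain ⟨n, h1, h2⟩ := exists_mem_Ico_zpow hy (one_lt_two (α := ℝ))
  have h0 : (0 : ℝ) < 2 ^ n := by positivity
  rw [zpow_add₀ (by norm_num), zpow_one] at h2
  refine ⟨n + (y / 2 ^ n - 1), ?_⟩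
  rw [expo_of_mem n]
  · field_simp; ring
  · have : 1 ≤ y / 2 ^ n := by rwa [le_div_iff₀ h0, one_mul]
    linarith
  · have : y / 2 ^ n ≤ 2 := by rw [div_le_iff₀ h0]; linarith
    linarith

/-- A piecewise linear homeomorphism from the line onto the open unit interval that conjugates
`x₀, x₁` to `unit0, unit1`. -/
noncomputable def psi (x : ℝ) : ℝ := if x ≤ 0 then expo x / 2 else 1 - expo (-x) / 2

theorem psi_of_nonpos {x : ℝ} (hx : x ≤ 0) : psi x = expo x / 2 := if_pos hx

theorem psi_of_nonneg {x : ℝ} (hx : 0 ≤ x) : psi x = 1 - expo (-x) / 2 := by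
  rcases hx.eq_or_lt with rfl | hx
  · rw [psi_of_nonpos le_rfl, neg_zero, expo_zero]; norm_num
  · exact if_neg (not_le.2 hx)

theorem psi_zero : psi 0 = 1 / 2 := by rw [psi_of_nonpos le_rfl, expo_zero]

theorem psi_strictMono : StrictMono psi := by
  intro x y hxy
  rcases le_total y 0 with hy | hy
  · rw [psi_of_nonpos hy, psi_of_nonpos (hxy.le.trans hy)]
    have := expo_strictMono hxy
    linarith
  · rw [psi_of_nonneg hy]
    rcases le_total x 0 with hx | hx
    · rw [psi_of_nonpos hx]
      have h1 := expo_strictMono.monotone hx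
      have h2 := expo_strictMono.monotone (show -y ≤ 0 by linarith)
      have h3 : expo x + expo (-y) < 2 := by
        rcases hx.eq_or_lt with rfl | hx
        · have := expo_strictMono (show -y < 0 by linarith)
          rw [expo_zero] at *; linarith
        · have := expo_strictMono hx
          rw [expo_zero] at *; linarith
      linarith
    · rw [psi_of_nonneg hx]
      have := expo_strictMono (show -y < -x by linarith)
      linarith

theorem psi_pos (x : ℝ) : 0 < psi x := by
  have := psi_strictMono.monotone (min_le_left x 0)
  rw [psi_of_nonpos (min_le_right x 0)] at this
  have h2 := expo_pos (min x 0)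
  linarith

theorem psi_lt_one (x : ℝ) : psi x < 1 := by
  have := psi_strictMono.monotone (le_max_left x 0)
  rw [psi_of_nonneg (le_max_right x 0)] at this
  have h2 := expo_pos (-max x 0)
  linarith

theorem exists_psi_eq {y : ℝ} (h0 : 0 < y) (h1 : y < 1) : ∃ x, psi x = y := by
  rcases le_total y (1 / 2) with h | h
  · obtain ⟨x, hx⟩ := exists_expo_eq (show 0 < 2 * y by linarith)
    refine ⟨x, ?_⟩
    rw [psi_of_nonpos, hx]
    · ring
    · rw [← expo_strictMono.le_iff_le, hx, expo_zero]; linarith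
  · obtain ⟨x, hx⟩ := exists_expo_eq (show 0 < 2 * (1 - y) by linarith)
    refine ⟨-x, ?_⟩
    rw [psi_of_nonneg, neg_neg, hx]
    · ring
    · rw [Left.nonneg_neg_iff, ← expo_strictMono.le_iff_le, hx, expo_zero]; linarith

theorem psi_of_mem_neg {x : ℝ} (h : -1 ≤ x) (h' : x ≤ 0) : psi x = (2 + x) / 4 := by
  rw [psi_of_nonpos h', expo_of_mem (-1) (by simpa using h) (by simpa using h')]
  norm_num; ring

theorem psi_of_mem_pos {x : ℝ} (h : 0 ≤ x) (h' : x ≤ 1) : psi x = (2 + x) / 4 := by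
  rw [psi_of_nonneg h, expo_of_mem (-1) (by simpa using h') (by simpa using h)]
  norm_num; ring

theorem psi_add_one_of_nonneg {x : ℝ} (h : 0 ≤ x) : psi (x + 1) = (psi x + 1) / 2 := by
  have h1 := expo_add_one (-(x + 1))
  rw [show -(x + 1) + 1 = -x by ring] at h1
  rw [psi_of_nonneg (by linarith), psi_of_nonneg h, h1]
  ring

/-- The pieces of `unit0` correspond to `x ≤ -1`, where the distance of `psi x` to `0` doubles, to
`[-1, 0]`, where `psi` has constant slope `1 / 4`, and to `x ≥ 0`, where the distance to `1` is
halved. -/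
theorem psi_add_one (x : ℝ) : psi (x + 1) = unit0 (psi x) := by
  rcases le_total x (-1) with h1 | h1
  · have h2 : psi x ≤ 1 / 4 := by
      refine (psi_strictMono.monotone h1).trans ?_
      rw [psi_of_mem_neg le_rfl (by norm_num)]; norm_num
    rw [unit0_of_le h2, psi_of_nonpos (by linarith), psi_of_nonpos (by linarith), expo_add_one]
    ring
  rcases le_total x 0 with h0 | h0
  · rw [psi_of_mem_neg h1 h0, psi_of_mem_pos (by linarith) (by linarith),
      unit0_of_mem (by linarith) (by linarith)]
    ring
  · have h2 : 1 / 2 ≤ psi x := by rw [← psi_zero]; exact psi_strictMono.monotone h0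
    rw [unit0_of_ge h2, psi_add_one_of_nonneg h0]

theorem psi_genIso_x1 (x : ℝ) : psi (genIso .x1 x) = unit1 (psi x) := by
  rcases le_total x 0 with h0 | h0
  · rw [genIso_x1_of_nonpos h0, unit1_of_le]
    rw [← psi_zero]; exact psi_strictMono.monotone h0
  have h2 : 1 / 2 ≤ psi x := by rw [← psi_zero]; exact psi_strictMono.monotone h0
  rw [unit1_of_ge h2]
  rcases le_total x 1 with h1 | h1
  · rw [genIso_x1_of_mem h0 h1, psi_of_mem_pos h0 h1]
    rcases le_total x (1 / 2) with h | h
    · rw [psi_of_mem_pos (by linarith) (by linarith), unit0_of_le (by linarith)]; ring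
    · rw [unit0_of_mem (by linarith) (by linarith), show 2 * x = (2 * x - 1) + 1 by ring,
        psi_add_one_of_nonneg (by linarith), psi_of_mem_pos (by linarith) (by linarith)]
      ring
  · have h3 : 3 / 4 ≤ psi x := by
      refine le_trans ?_ (psi_strictMono.monotone h1)
      rw [psi_of_mem_pos (by norm_num) le_rfl]; norm_num
    rw [genIso_x1_of_ge h1, unit0_of_ge (by linarith), psi_add_one_of_nonneg h0]
    ring

theorem per0_psi (x : ℝ) : per0 (psi x) = psi (x + 1) := by
  have h : ⌊psi x⌋ = 0 := Int.floor_eq_zero_iff.2 ⟨(psi_pos x).le, psi_lt_one x⟩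
  rw [per0_apply, Int.fract, h, psi_add_one]; simp

theorem per1_psi (x : ℝ) : per1 (psi x) = psi (genIso .x1 x) := by
  have h : ⌊psi x⌋ = 0 := Int.floor_eq_zero_iff.2 ⟨(psi_pos x).le, psi_lt_one x⟩
  rw [per1_apply, Int.fract, h, psi_genIso_x1]; simp

/-! ### Transport of admissible maps through `psi` -/

theorem isPL2_of_unit_pieces {f : ℝ → ℝ} (h : ∀ n : ℤ, ∃ (k : ℤ) (c : ℝ), IsDyadic c ∧
    ∀ x : ℝ, n ≤ x → x ≤ n + 1 → f x = (2 : ℝ) ^ k * x + c) : IsPL2 f := by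
  choose K C hC hf using h
  refine isPL2_of_eventuallyEq_sides fun x => ?_
  have hfl := Int.floor_le x
  have hlt := Int.lt_floor_add_one x
  rcases hfl.eq_or_lt with hx | hx
  · refine Or.inr ⟨hx ▸ isDyadic_int _, ⟨_, isPL2_affine (K (⌊x⌋ - 1)) (hC (⌊x⌋ - 1)), ?_⟩,
      ⟨_, isPL2_affine (K ⌊x⌋) (hC ⌊x⌋), ?_⟩⟩
    · filter_upwards [Icc_mem_nhdsLE (show x - 1 < x by linarith)] with y hy
      refine hf _ y ?_ ?_ <;> push_cast <;> linarith [hy.1, hy.2]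
    · filter_upwards [Icc_mem_nhdsGE (show x < x + 1 by linarith)] with y hy
      exact hf _ y (by linarith [hy.1]) (by linarith [hy.2])
  · refine Or.inl ⟨_, isPL2_affine (K ⌊x⌋) (hC ⌊x⌋), ?_⟩
    filter_upwards [Ioo_mem_nhds hx hlt] with y hy
    exact hf _ y hy.1.le hy.2.le

theorem isPL2_psi : IsPL2 psi := by
  refine isPL2_of_unit_pieces fun n => ?_
  rcases lt_or_ge n 0 with hn | hn
  · have hn' : (n : ℝ) + 1 ≤ 0 := by exact_mod_cast hn
    refine ⟨n - 1, (2 : ℝ) ^ (n - 1) * (1 - n : ℤ), (isDyadic_int _).two_zpow_mul _,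
      fun x hx hx' => ?_⟩
    rw [psi_of_nonpos (by linarith), expo_of_mem n hx hx', zpow_sub₀ (by norm_num)]
    push_cast; ring
  · have hn' : (0 : ℝ) ≤ n := by exact_mod_cast hn
    refine ⟨-n - 2, 1 + (2 : ℝ) ^ (-n - 2) * (-(2 + n) : ℤ), ?_, fun x hx hx' => ?_⟩
    · exact IsDyadic.add (by simpa using isDyadic_int 1) ((isDyadic_int _).two_zpow_mul _)
    rw [psi_of_nonneg (by linarith), expo_of_mem (-n - 1) (by push_cast; linarith)
      (by push_cast; linarith), zpow_sub₀ (by norm_num), zpow_sub₀ (by norm_num)]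
    push_cast; norm_num; ring

/-- A map of the unit interval that is admissible and fixes the end points comes from an element
of `F`. -/
theorem exists_thompsonF_psi {g : ℝ ≃o ℝ} (hg : g ∈ PL2Plus) (h0 : g 0 = 0) (h1 : g 1 = 1) :
    ∃ f ∈ ThompsonF, ∀ x, psi (f x) = g (psi x) := by
  have hinj := psi_strictMono.injective
  have hinv : ∀ y, 0 < y → y < 1 → psi (Function.invFun psi y) = y := fun y a b =>
    Function.invFun_eq (exists_psi_eq a b)
  have hlinv : ∀ x, Function.invFun psi (psi x) = x := Function.leftInverse_invFun hinj
  have hrange : ∀ (g : ℝ ≃o ℝ), g 0 = 0 → g 1 = 1 → ∀ x, 0 < g (psi x) ∧ g (psi x) < 1 := by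
    intro g h0 h1 x
    exact ⟨by simpa [h0] using g.strictMono (psi_pos x),
      by simpa [h1] using g.strictMono (psi_lt_one x)⟩
  have h0' : g⁻¹ 0 = 0 := inv_apply_eq_iff.2 h0.symm
  have h1' : g⁻¹ 1 = 1 := inv_apply_eq_iff.2 h1.symm
  have key : ∀ (g : ℝ ≃o ℝ), g 0 = 0 → g 1 = 1 → ∀ x,
      psi (Function.invFun psi (g (psi x))) = g (psi x) := fun g h0 h1 x =>
    hinv _ (hrange g h0 h1 x).1 (hrange g h0 h1 x).2
  let f : ℝ ≃o ℝ := StrictMono.orderIsoOfRightInverse (fun x => Function.invFun psi (g (psi x)))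
    (fun x y hxy => by
      simp only
      rw [← psi_strictMono.lt_iff_lt, key g h0 h1, key g h0 h1]
      exact g.strictMono (psi_strictMono hxy))
    (fun y => Function.invFun psi (g⁻¹ (psi y)))
    (fun y => by
      simp only
      rw [key g⁻¹ h0' h1', RelIso.apply_inv_self, hlinv])
  have hf : ∀ x, psi (f x) = g (psi x) := key g h0 h1
  have hψ := isPL2_psi.locPL2
  have hg' := IsPL2.locPL2 hg
  refine ⟨f, ⟨LocPL2.isPL2 ⟨fun x => ?_, fun x => ?_, fun x hx => ?_⟩, ?_⟩, hf⟩
  -- The map `f` is `psi⁻¹ ∘ g ∘ psi`. As `psi` is not onto the line, the composition is carried out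
  -- on germs.
  · have e := AffGerm.inverse isSide_nhdsGE hlinv (hψ.right (f x))
    rw [hf x] at e
    exact AffGerm.comp isSide_nhdsGE (f := Function.invFun psi) (g := fun y => g (psi y))
      (AffGerm.comp isSide_nhdsGE (hψ.right x) (hg'.right _)) e
  · have e := AffGerm.inverse isSide_nhdsLE hlinv (hψ.left (f x))
    rw [hf x] at e
    exact AffGerm.comp isSide_nhdsLE (f := Function.invFun psi) (g := fun y => g (psi y))
      (AffGerm.comp isSide_nhdsLE (hψ.left x) (hg'.left _)) e
  · have d1 : ¬ IsDyadic (psi x) := by rwa [isPL2_psi.isDyadic_iff]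
    have d2 : ¬ IsDyadic (f x) := by
      rwa [← isPL2_psi.isDyadic_iff, hf, IsPL2.isDyadic_iff hg]
    have e := AffGerm.inverse isSide_nhds hlinv (hψ.full (f x) d2)
    rw [hf x] at e
    exact AffGerm.comp isSide_nhds (f := Function.invFun psi) (g := fun y => g (psi y))
      (AffGerm.comp isSide_nhds (hψ.full x hx) (hg'.full _ d1)) e
  · obtain ⟨k, c, -, hk⟩ := hg'.left 1
    obtain ⟨l, c', -, hl⟩ := hg'.right 0
    obtain ⟨u, hu, hu'⟩ := mem_nhdsLE_iff_exists_Ioc_subset.1 hk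
    obtain ⟨v, hv, hv'⟩ := mem_nhdsGE_iff_exists_Ico_subset.1 hl
    have ek : g 1 = (2 : ℝ) ^ k * 1 + c := hu' ⟨hu, le_rfl⟩
    have el : g 0 = (2 : ℝ) ^ l * 0 + c' := hv' ⟨le_rfl, hv⟩
    rw [h1] at ek
    rw [h0] at el
    obtain ⟨p, hp⟩ := exists_psi_eq (y := max u (1 / 2)) (by positivity)
      (max_lt hu (by norm_num))
    obtain ⟨q, hq⟩ := exists_psi_eq (y := min v (1 / 2)) (lt_min hv (by norm_num))
      ((min_le_right _ _).trans_lt (by norm_num))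
    -- Slope `2 ^ k` of `g` at `1` multiplies `1 - psi x = expo (-x) / 2` by `2 ^ k`, which
    -- translates `x` by `-k`; slope `2 ^ l` at `0` translates by `l`. The slack `|k| + |l|` keeps
    -- the translated point on the same side of `0`, where the same formula for `psi` holds.
    refine ⟨max 1 (max (|p|) |q|) + |(k : ℝ)| + |(l : ℝ)|, -k, l, by positivity,
      fun x hx => ?_, fun x hx => ?_⟩
    · have b1 := abs_nonneg (k : ℝ)
      have b2 := abs_nonneg (l : ℝ)
      have b3 : |p| ≤ max 1 (max (|p|) |q|) := (le_max_left _ _).trans (le_max_right _ _)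
      have b4 : 1 ≤ max 1 (max (|p|) |q|) := le_max_left _ _
      have b5 := le_abs_self p
      have b6 := le_abs_self (k : ℝ)
      have hux : u < psi x := by
        have := psi_strictMono (show p < x by linarith)
        rw [hp] at this
        exact (le_max_left _ _).trans_lt this
      have hgx : g (psi x) = (2 : ℝ) ^ k * psi x + c := hu' ⟨hux, (psi_lt_one x).le⟩
      apply hinj
      rw [hf x, hgx, psi_of_nonneg (show 0 ≤ x by linarith),
        psi_of_nonneg (show 0 ≤ x + ((-k : ℤ) : ℝ) by push_cast; linarith),
        show -(x + ((-k : ℤ) : ℝ)) = -x + (k : ℤ) by push_cast; ring, expo_add_int]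
      linarith
    · have b1 := abs_nonneg (k : ℝ)
      have b2 := abs_nonneg (l : ℝ)
      have b3 : |q| ≤ max 1 (max (|p|) |q|) := (le_max_right _ _).trans (le_max_right _ _)
      have b4 : 1 ≤ max 1 (max (|p|) |q|) := le_max_left _ _
      have b5 := neg_abs_le q
      have b6 := le_abs_self (l : ℝ)
      have hvx : psi x < v := by
        have := psi_strictMono (show x < q by linarith)
        rw [hq] at this
        exact this.trans_le (min_le_left _ _)
      have hgx : g (psi x) = (2 : ℝ) ^ l * psi x + c' := hv' ⟨(psi_pos x).le, hvx⟩
      apply hinj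
      rw [hf x, hgx, psi_of_nonpos (show x ≤ 0 by linarith),
        psi_of_nonpos (show x + (l : ℝ) ≤ 0 by linarith), expo_add_int]
      linarith


/-! ### Homomorphisms out of `F` -/

/-- The first generator of `F`. -/
noncomputable def genA : ThompsonF := ⟨(genIso .x0)⁻¹, ThompsonF.inv_mem genIso_x0_mem⟩

/-- The second generator of `F`. -/
noncomputable def genB : ThompsonF := ⟨(genIso .x1)⁻¹, ThompsonF.inv_mem genIso_x1_mem⟩

theorem map_f1 {G H : Type*} [Group G] [Group H] (φ : G →* H) (a b : G) :
    φ (f1 a b) = f1 (φ a) (φ b) := by simp [f1, comm]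

theorem map_f2 {G H : Type*} [Group G] [Group H] (φ : G →* H) (a b : G) :
    φ (f2 a b) = f2 (φ a) (φ b) := by simp [f2, comm]

theorem f1_genIso : f1 (genIso .x0)⁻¹ (genIso .x1)⁻¹ = 1 := by
  have := wordAct_eq_one (r := f1 x₀ x₁) (by simp [relators, kernelRelators])
  simpa [map_f1, wordAct] using this

theorem f2_genIso : f2 (genIso .x0)⁻¹ (genIso .x1)⁻¹ = 1 := by
  have := wordAct_eq_one (r := f2 x₀ x₁) (by simp [relators, kernelRelators])
  simpa [map_f2, wordAct] using this

/-- `F` is presented by its two relators. -/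
theorem exists_hom_of_relators {G : Type*} [Group G] {a b : G} (h1 : f1 a b = 1)
    (h2 : f2 a b = 1) : ∃ φ : ThompsonF →* G, φ genA = a ∧ φ genB = b := by
  -- `D` will be the graph of the homomorphism. Its generators satisfy the two relators in both
  -- coordinates, so by the faithfulness of normal forms its projection to the line is injective,
  -- with image `F`.
  let D : Subgroup (G × (ℝ ≃o ℝ)) :=
    Subgroup.closure {(a, (genIso .x0)⁻¹), (b, (genIso .x1)⁻¹)}
  let S : G × (ℝ ≃o ℝ) →* (ℝ ≃o ℝ) := MonoidHom.snd _ _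
  have hDmap : D.map S = ThompsonF := by
    rw [MonoidHom.map_closure, Set.image_pair, ← genF_eq]; rfl
  have e1 : f1 (a, (genIso .x0)⁻¹) (b, (genIso .x1)⁻¹) = (1 : G × (ℝ ≃o ℝ)) :=
    Prod.ext ((map_f1 (MonoidHom.fst G (ℝ ≃o ℝ)) _ _).trans h1)
      ((map_f1 (MonoidHom.snd G (ℝ ≃o ℝ)) _ _).trans f1_genIso)
  have e2 : f2 (a, (genIso .x0)⁻¹) (b, (genIso .x1)⁻¹) = (1 : G × (ℝ ≃o ℝ)) :=
    Prod.ext ((map_f2 (MonoidHom.fst G (ℝ ≃o ℝ)) _ _).trans h2)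
      ((map_f2 (MonoidHom.snd G (ℝ ≃o ℝ)) _ _).trans f2_genIso)
  let p : D →* ThompsonF := (S.comp D.subtype).codRestrict ThompsonF fun d =>
    hDmap ▸ Subgroup.mem_map_of_mem S d.2
  have hp : Function.Bijective p := by
    constructor
    · rw [injective_iff_map_eq_one]
      intro d hd
      exact Subtype.ext (eq_one_of_map_eq_one S rfl rfl e1 e2 d.2 (congrArg Subtype.val hd))
    · rintro ⟨f, hf⟩
      rw [← hDmap] at hf
      obtain ⟨d, hd, rfl⟩ := hf
      exact ⟨⟨d, hd⟩, rfl⟩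
  let E := MulEquiv.ofBijective p hp
  refine ⟨(MonoidHom.fst G (ℝ ≃o ℝ)).comp (D.subtype.comp E.symm.toMonoidHom), ?_, ?_⟩
  · have : E.symm genA = ⟨(a, (genIso .x0)⁻¹), Subgroup.subset_closure (by simp)⟩ := by
      rw [MulEquiv.symm_apply_eq]; rfl
    simp [this]
  · have : E.symm genB = ⟨(b, (genIso .x1)⁻¹), Subgroup.subset_closure (by simp)⟩ := by
      rw [MulEquiv.symm_apply_eq]; rfl
    simp [this]

theorem closure_genA_genB : Subgroup.closure {genA, genB} = ⊤ := by
  rw [eq_top_iff]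
  rintro ⟨f, hf⟩ -
  have h : (Subgroup.closure {genA, genB}).map ThompsonF.subtype = ThompsonF := by
    rw [MonoidHom.map_closure, Set.image_pair]; exact genF_eq
  have hf' := hf
  rw [← h] at hf'
  obtain ⟨g, hg, hgf⟩ := hf'
  have : g = ⟨f, hf⟩ := Subtype.ext hgf
  exact this ▸ hg

/-! ### Groups that satisfy the relators of `T` -/

section TGroup

variable {Q : Type*} [Group Q] {a b r : Q} (φ : ThompsonF →* Q) (hφa : φ genA = a)
  (hφb : φ genB = b)

include hφa hφb

theorem range_eq_closure : φ.range = Subgroup.closure {a, b} := by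
  rw [MonoidHom.range_eq_map, ← closure_genA_genB, MonoidHom.map_closure, Set.image_pair, hφa, hφb]

/-- Elements of `F` that fix `0` are conjugated into the image of `F`. -/
theorem conj_mem_range (h1 : t1 a b r = 1) (h3 : t3 a b r = 1) (h4 : t4 r = 1) {f : ThompsonF}
    (hf : (f : ℝ ≃o ℝ) 0 = 0) : r * φ f * r ∈ φ.range := by
  have ha : a ∈ φ.range := ⟨_, hφa⟩
  have hb : b ∈ φ.range := ⟨_, hφb⟩
  have hr : r⁻¹ = r := inv_eq_of_mul_eq_one_right (by rw [← pow_two]; exact h4)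
  -- The elements of `F` whose image is conjugated by `r` into the image of `F`. They form a
  -- subgroup, so four generators suffice: the doublings at `0` and `1` and their mirror images.
  let S : Subgroup (ℝ ≃o ℝ) :=
    ((φ.range.comap (MulAut.conj r).toMonoidHom).comap φ).map ThompsonF.subtype
  have hS : ∀ f : ThompsonF, r * φ f * r ∈ φ.range → (f : ℝ ≃o ℝ) ∈ S := fun f hf =>
    ⟨f, by simpa [hr] using hf, rfl⟩
  have hS' : ∀ f : ThompsonF, (f : ℝ ≃o ℝ) ∈ S → r * φ f * r ∈ φ.range := by
    rintro f ⟨f', hf', hff'⟩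
    obtain rfl : f' = f := Subtype.ext hff'
    simpa [hr] using hf'
  have r2 : r * r = 1 := by rw [← pow_two]; exact h4
  have hrr : ∀ x, r * (r * x) = x := fun x => by rw [← mul_assoc, r2, one_mul]
  -- the two relations that exchange the halves of the circle
  have k1 : r * (a ^ 2 * b⁻¹ * a⁻¹) * r = b := by
    have : b⁻¹ * (r * (a ^ 2 * b⁻¹ * a⁻¹) * r) = 1 := by rw [← h1, t1]; group
    exact (inv_mul_eq_one.1 this).symm
  have k1' : r * b * r = a ^ 2 * b⁻¹ * a⁻¹ := by
    have := congrArg (fun z => r * z * r) k1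
    simpa only [mul_assoc, hrr, r2, mul_one] using this.symm
  have k3 : r * (a ^ 3 * b⁻¹ * a⁻¹ ^ 2) * r = b ^ 2 * (a⁻¹ * b⁻¹ * a) * b⁻¹ := by
    have : b⁻¹ ^ 2 * (r * (a ^ 3 * b⁻¹ * a⁻¹ ^ 2) * r) * (b * a⁻¹ * b * a) = 1 := by
      rw [← h3, t3]; group
    rw [mul_eq_one_iff_eq_inv, inv_pow, inv_mul_eq_iff_eq_mul] at this
    rw [this]; group
  have p0 : dbl 0 ∈ S := by
    have e : dbl 0 = (genB⁻¹ : ThompsonF) := by rw [dbl_zero]; simp [genB]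
    rw [e]
    refine hS _ ?_
    rw [map_inv, hφb]
    have : r * b⁻¹ * r = (r * b * r)⁻¹ := by simp [hr, mul_assoc]
    rw [this, k1']
    exact inv_mem (mul_mem (mul_mem (pow_mem ha 2) (inv_mem hb)) (inv_mem ha))
  have n0 : reflect (dbl 0) ∈ S := by
    have e : reflect (dbl 0) = (genA ^ 2 * genB⁻¹ * genA⁻¹ : ThompsonF) := by
      ext x
      simp only [genA, genB, Subgroup.coe_mul, Subgroup.coe_inv, Subgroup.coe_pow, inv_inv,
        RelIso.mul_apply, reflect_apply, genIso_x0_inv_pow, genIso_x0]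
      rcases le_total x (-1) with h | h
      · rw [dbl_of_ge (by push_cast; linarith), genIso_x1_of_nonpos (by linarith)]; push_cast; ring
      rcases le_total x 0 with h' | h'
      · rw [dbl_of_mem (by push_cast; linarith) (by push_cast; linarith),
          genIso_x1_of_mem (by linarith) (by linarith)]
        push_cast; ring
      · rw [dbl_of_le (by push_cast; linarith), genIso_x1_of_ge (by linarith)]; push_cast; ring
    rw [e]
    refine hS _ ?_
    simp only [map_mul, map_pow, map_inv, hφa, hφb]
    rw [k1]
    exact hb
  have n1 : reflect (dbl 1) ∈ S := by
    have e : reflect (dbl 1) = (genA ^ 3 * genB⁻¹ * genA⁻¹ ^ 2 : ThompsonF) := by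
      ext x
      simp only [genA, genB, Subgroup.coe_mul, Subgroup.coe_inv, Subgroup.coe_pow, inv_inv,
        RelIso.mul_apply, reflect_apply, genIso_x0_inv_pow, genIso_x0_pow]
      rcases le_total x (-2) with h | h
      · rw [dbl_of_ge (by push_cast; linarith), genIso_x1_of_nonpos (by push_cast; linarith)]
        push_cast; ring
      rcases le_total x (-1) with h' | h'
      · rw [dbl_of_mem (by push_cast; linarith) (by push_cast; linarith),
          genIso_x1_of_mem (by push_cast; linarith) (by push_cast; linarith)]
        push_cast; ring
      · rw [dbl_of_le (by push_cast; linarith), genIso_x1_of_ge (by push_cast; linarith)]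
        push_cast; ring
    rw [e]
    refine hS _ ?_
    simp only [map_mul, map_pow, map_inv, hφa, hφb]
    rw [k3]
    exact mul_mem (mul_mem (pow_mem hb 2) (mul_mem (mul_mem (inv_mem ha) (inv_mem hb)) ha))
      (inv_mem hb)
  have p1 : dbl 1 ∈ S := by
    have e : dbl 1 = (genA⁻¹ * genB⁻¹ * genA : ThompsonF) := by
      ext x
      have hx : (genIso .x0)⁻¹ x = x - 1 := by rw [inv_apply_eq_iff, genIso_x0]; ring
      simp only [genA, genB, Subgroup.coe_mul, Subgroup.coe_inv, inv_inv, RelIso.mul_apply,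
        genIso_x0, dbl_apply, hx]
      push_cast; ring
    rw [e]
    refine hS _ ?_
    simp only [map_mul, map_inv, hφa, hφb]
    -- No relator gives the conjugate of `a⁻¹ * b⁻¹ * a` directly. It is solved for from `k3`,
    -- because the conjugate of `b` is known from `k1'`.
    have k4 : r * (b ^ 2 * (a⁻¹ * b⁻¹ * a) * b⁻¹) * r = a ^ 3 * b⁻¹ * a⁻¹ ^ 2 := by
      rw [← k3]; simp only [mul_assoc, hrr, r2, mul_one]
    have k5 : r * (a⁻¹ * b⁻¹ * a) * r =
        (r * b * r)⁻¹ * (r * b * r)⁻¹ * (r * (b ^ 2 * (a⁻¹ * b⁻¹ * a) * b⁻¹) * r) * (r * b * r) := by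
      simp only [mul_inv_rev, hr, mul_assoc, hrr, pow_two, inv_mul_cancel_left]
    rw [k5, k4, k1']
    have m1 : a ^ 2 * b⁻¹ * a⁻¹ ∈ φ.range :=
      mul_mem (mul_mem (pow_mem ha 2) (inv_mem hb)) (inv_mem ha)
    exact mul_mem (mul_mem (mul_mem (inv_mem m1) (inv_mem m1)) (mul_mem (mul_mem (pow_mem ha 3)
      (inv_mem hb)) (pow_mem (inv_mem ha) 2))) m1
  have hpos : posF ≤ S := by
    rw [posF, Subgroup.closure_le]
    rintro x (rfl | rfl)
    exacts [p0, p1]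
  have hneg : negF ≤ S := by
    rw [negF, Subgroup.closure_le]
    rintro x (rfl | rfl)
    exacts [n0, n1]
  refine hS' f ?_
  have c1 : (1 : ℝ ≃o ℝ) 0 = (f : ℝ ≃o ℝ) 0 := by rw [hf]; rfl
  have c2 : (f : ℝ ≃o ℝ) 0 = (1 : ℝ ≃o ℝ) 0 := c1.symm
  have d0 : IsDyadic 0 := by simpa using isDyadic_int 0
  obtain ⟨hPL, M, k, l, hM, hk, hl⟩ := f.2
  have g1 : glue 0 1 f c1 ∈ posF := by
    refine mem_posF ⟨glue_mem c1 d0 PL2Plus.one_mem hPL, M, k, 0, hM, fun x hx => ?_,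
      fun x hx => ?_⟩ fun x hx => ?_
    · rw [glue_of_ge c1 (by linarith), hk x hx]
    · rw [glue_of_le c1 (by linarith)]; simp
    · rw [glue_of_le c1 hx]; rfl
  have g2 : glue 0 f 1 c2 ∈ negF := by
    refine mem_negF ⟨glue_mem c2 d0 hPL PL2Plus.one_mem, M, 0, l, hM, fun x hx => ?_,
      fun x hx => ?_⟩ fun x hx => ?_
    · rw [glue_of_ge c2 (by linarith)]; simp
    · rw [glue_of_le c2 (by linarith), hl x hx]
    · rw [glue_of_ge c2 hx]; rfl
  -- A map that fixes `0` is the product of its restrictions to the two half-lines.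
  have e : (f : ℝ ≃o ℝ) = glue 0 f 1 c2 * glue 0 1 f c1 := by
    ext x
    rw [RelIso.mul_apply]
    rcases le_total x 0 with hx | hx
    · rw [glue_of_le c1 hx, RelIso.one_apply, glue_of_le c2 hx]
    · rw [glue_of_ge c1 hx, glue_of_ge c2]
      · rfl
      · rw [← hf]; exact (f : ℝ ≃o ℝ).monotone hx
  rw [e]
  exact S.mul_mem (hneg g2) (hpos g1)

/-- The group is the union of two double cosets of the image of `F`. -/
theorem mem_double_coset (h1 : t1 a b r = 1) (h2 : t2 a b r = 1) (h3 : t3 a b r = 1)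
    (h4 : t4 r = 1) {q : Q} (hq : q ∈ Subgroup.closure {a, b, r}) :
    q ∈ φ.range ∨ ∃ h ∈ φ.range, ∃ h' ∈ φ.range, q = h * r * h' := by
  have ha : a ∈ φ.range := ⟨_, hφa⟩
  have hb : b ∈ φ.range := ⟨_, hφb⟩
  have r2 : r * r = 1 := by rw [← pow_two]; exact h4
  have hr : r⁻¹ = r := inv_eq_of_mul_eq_one_right r2
  let D : Set Q := {q | q ∈ φ.range ∨ ∃ h ∈ φ.range, ∃ h' ∈ φ.range, q = h * r * h'}
  have Dl : ∀ h ∈ φ.range, ∀ q ∈ D, h * q ∈ D := by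
    rintro h hh q (hq | ⟨k, hk, k', hk', rfl⟩)
    · exact Or.inl (mul_mem hh hq)
    · exact Or.inr ⟨h * k, mul_mem hh hk, k', hk', by group⟩
  have Dr : ∀ h ∈ φ.range, ∀ q ∈ D, q * h ∈ D := by
    rintro h hh q (hq | ⟨k, hk, k', hk', rfl⟩)
    · exact Or.inl (mul_mem hq hh)
    · exact Or.inr ⟨k, hk, k' * h, mul_mem hk' hh, by group⟩
  have Di : ∀ q ∈ D, q⁻¹ ∈ D := by
    rintro q (hq | ⟨k, hk, k', hk', rfl⟩)
    · exact Or.inl (inv_mem hq)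
    · exact Or.inr ⟨k'⁻¹, inv_mem hk', k⁻¹, inv_mem hk, by simp [hr, mul_assoc]⟩
  -- The relator `t2` reads `r a r = b a⁻² r b a⁻¹`.
  have hara : r * a * r ∈ D := by
    refine Or.inr ⟨b * a⁻¹ ^ 2, mul_mem hb (pow_mem (inv_mem ha) 2), b * a⁻¹,
      mul_mem hb (inv_mem ha), ?_⟩
    have : b⁻¹ * r * a ^ 2 * b⁻¹ * (r * a * r) * a = 1 := by rw [← h2, t2]; group
    have e : r * a * r = (b⁻¹ * r * a ^ 2 * b⁻¹)⁻¹ * a⁻¹ := by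
      rw [eq_inv_mul_iff_mul_eq, eq_inv_iff_mul_eq_one]; exact this
    rw [e]; simp [hr, mul_assoc]
  have split : ∀ x y : Q, r * (x * y) * r = (r * x * r) * (r * y * r) := fun x y => by
    have hrr : ∀ x, r * (r * x) = x := fun x => by rw [← mul_assoc, r2, one_mul]
    simp only [mul_assoc, hrr]
  have rinv : ∀ x : Q, r * x⁻¹ * r = (r * x * r)⁻¹ := fun x => by simp [hr, mul_assoc]
  have hposf : ∀ f : ThompsonF, 0 < (f : ℝ ≃o ℝ) 0 → r * φ f * r ∈ D := by
    intro f hf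
    have hd : IsDyadic ((f : ℝ ≃o ℝ) 0) :=
      (IsPL2.isDyadic_iff f.2.1 0).2 (by simpa using isDyadic_int 0)
    obtain ⟨g, hg, hg1⟩ := exists_posF_eq_one hd hf
    let g' : ThompsonF := ⟨g, posF_le hg⟩
    -- Here `g f` takes `0` to `1`, and `genA` takes `1` back to `0`. Thus `f` is `genA⁻¹` between
    -- two elements that fix `0`; after conjugation by `r` the outer factors lie in the image of
    -- `F`, and the middle one is the inverse of `r a r`.
    have e : φ f = φ g'⁻¹ * (φ genA)⁻¹ * φ (genA * g' * f) := by
      rw [← map_inv, ← map_mul, ← map_mul]; congr 1; group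
    rw [e, split, split, hφa, rinv a]
    refine Dr _ (conj_mem_range φ hφa hφb h1 h3 h4 ?_) _ (Dl _ (conj_mem_range φ hφa hφb h1 h3 h4 ?_)
      _ (Di _ hara))
    · simp only [genA, g', Subgroup.coe_mul, RelIso.mul_apply, hg1]
      rw [inv_apply_eq_iff, genIso_x0]; norm_num
    · exact posF_apply_of_nonpos (posF.inv_mem hg) le_rfl
  have hall : ∀ f : ThompsonF, r * φ f * r ∈ D := by
    intro f
    rcases lt_trichotomy ((f : ℝ ≃o ℝ) 0) 0 with hf | hf | hf
    · have h5 : 0 < ((f⁻¹ : ThompsonF) : ℝ ≃o ℝ) 0 := by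
        have := ((f : ℝ ≃o ℝ)⁻¹).strictMono hf
        rwa [RelIso.inv_apply_self] at this
      have h6 := Di _ (hposf _ h5)
      rwa [map_inv, rinv, inv_inv] at h6
    · exact Or.inl (conj_mem_range φ hφa hφb h1 h3 h4 hf)
    · exact hposf f hf
  -- The one nontrivial closure property: `(h r k) r = h (r k r)` for `k` in the image of `F`.
  have Drr : ∀ q ∈ D, q * r ∈ D := by
    rintro q (hq | ⟨k, hk, k', ⟨f, rfl⟩, rfl⟩)
    · exact Or.inr ⟨q, hq, 1, one_mem _, by simp⟩
    · have := Dl k hk _ (hall f)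
      simpa only [mul_assoc] using this
  change q ∈ D
  induction hq using Subgroup.closure_induction_right with
  | one => exact Or.inl (one_mem _)
  | mul_right x hx y hy ih =>
    rcases hy with rfl | rfl | rfl
    exacts [Dr _ ha _ ih, Dr _ hb _ ih, Drr _ ih]
  | mul_inv_cancel x hx y hy ih =>
    rcases hy with rfl | rfl | rfl
    · exact Dr _ (inv_mem ha) _ ih
    · exact Dr _ (inv_mem hb) _ ih
    · rw [hr]; exact Drr _ ih

variable (Θ : Q →* ThompsonT)
  (hΘa : ∀ x : ℝ, (Θ a : AddCircle (1 : ℝ) ≃ₜ AddCircle (1 : ℝ)) (x : AddCircle (1 : ℝ)) =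
    (per0⁻¹ x : ℝ))
  (hΘb : ∀ x : ℝ, (Θ b : AddCircle (1 : ℝ) ≃ₜ AddCircle (1 : ℝ)) (x : AddCircle (1 : ℝ)) =
    (per1⁻¹ x : ℝ))

include hΘa hΘb

/-- On the arc `(0, 1)` of the circle the image of `F` acts as `F` does on the line, transported by
`psi`; on the generators this is `per0_psi` and `per1_psi`. -/
theorem map_psi (f : ThompsonF) (x : ℝ) :
    (Θ (φ f) : AddCircle (1 : ℝ) ≃ₜ AddCircle (1 : ℝ)) (psi x : AddCircle (1 : ℝ)) =
      (psi ((f : ℝ ≃o ℝ) x) : ℝ) := by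
  have hf : f ∈ Subgroup.closure {genA, genB} := by rw [closure_genA_genB]; trivial
  induction hf using Subgroup.closure_induction generalizing x with
  | mem f hf =>
    rcases hf with rfl | rfl
    · rw [hφa, hΘa]
      have e : (genA : ℝ ≃o ℝ) x = x - 1 := by
        simp only [genA]; rw [inv_apply_eq_iff, genIso_x0]; ring
      rw [e, inv_apply_eq_iff.2 (?_ : psi x = per0 (psi (x - 1)))]
      rw [per0_psi, sub_add_cancel]
    · rw [hφb, hΘb]
      rw [inv_apply_eq_iff.2 (?_ : psi x = per1 (psi ((genB : ℝ ≃o ℝ) x)))]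
      rw [per1_psi]
      simp [genB]
  | one => simp
  | mul f g _ _ hf hg =>
    rw [map_mul, map_mul]
    exact (congrArg _ (hg x)).trans (hf _)
  | inv f _ hf =>
    have h2 := hf ((f : ℝ ≃o ℝ)⁻¹ x)
    rw [RelIso.apply_inv_self] at h2
    rw [map_inv, map_inv, ← h2]
    exact (Θ (φ f) : AddCircle (1 : ℝ) ≃ₜ AddCircle (1 : ℝ)).symm_apply_apply _

theorem map_zero_circle (f : ThompsonF) :
    (Θ (φ f) : AddCircle (1 : ℝ) ≃ₜ AddCircle (1 : ℝ)) ((0 : ℝ) : AddCircle (1 : ℝ)) =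
      ((0 : ℝ) : AddCircle (1 : ℝ)) := by
  have hf : f ∈ Subgroup.closure {genA, genB} := by rw [closure_genA_genB]; trivial
  induction hf using Subgroup.closure_induction with
  | mem f hf =>
    rcases hf with rfl | rfl
    · rw [hφa, hΘa, inv_apply_eq_iff.2 per0_zero.symm]
    · rw [hφb, hΘb, inv_apply_eq_iff.2 per1_zero.symm]
  | one => simp
  | mul f g _ _ hf hg =>
    rw [map_mul, map_mul]
    exact (congrArg _ hg).trans hf
  | inv f _ hf =>
    rw [map_inv, map_inv]
    conv_lhs => rw [← hf]
    exact (Θ (φ f) : AddCircle (1 : ℝ) ≃ₜ AddCircle (1 : ℝ)).symm_apply_apply _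

variable (hΘr : ∀ x : ℝ, (Θ r : AddCircle (1 : ℝ) ≃ₜ AddCircle (1 : ℝ)) (x : AddCircle (1 : ℝ)) =
    (x + 1 / 2 : ℝ))

include hΘr

/-- The six relators of `T` suffice. -/
theorem eq_one_of_map_thompsonT_eq_one (h1 : t1 a b r = 1) (h2 : t2 a b r = 1)
    (h3 : t3 a b r = 1) (h4 : t4 r = 1) {q : Q} (hq : q ∈ Subgroup.closure {a, b, r})
    (hΘ : Θ q = 1) : q = 1 := by
  have hψ : ∀ x y : ℝ, (psi x : AddCircle (1 : ℝ)) = (psi y : ℝ) → x = y := by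
    intro x y hxy
    have hx : psi x ∈ Set.Ico (0 : ℝ) (0 + 1) := ⟨(psi_pos x).le, by simpa using psi_lt_one x⟩
    have hy : psi y ∈ Set.Ico (0 : ℝ) (0 + 1) := ⟨(psi_pos y).le, by simpa using psi_lt_one y⟩
    have : Fact ((0 : ℝ) < 1) := ⟨one_pos⟩
    exact psi_strictMono.injective ((AddCircle.coe_eq_coe_iff_of_mem_Ico hx hy).1 hxy)
  rcases mem_double_coset φ hφa hφb h1 h2 h3 h4 hq with ⟨f, rfl⟩ | ⟨_, ⟨f, rfl⟩, _, ⟨f', rfl⟩, rfl⟩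
  · have : f = 1 := by
      refine Subtype.ext (RelIso.ext fun x => ?_)
      have h5 := map_psi φ hφa hφb Θ hΘa hΘb f x
      rw [hΘ] at h5
      exact (hψ _ _ h5).symm
    rw [this, map_one]
  · exfalso
    -- The factor `f'` fixes the circle point `0`, `r` moves it to `1 / 2 = psi 0`, and `f` moves
    -- that within the open arc. The product therefore cannot be trivial.
    have h5 : (Θ (φ f * r * φ f') : AddCircle (1 : ℝ) ≃ₜ AddCircle (1 : ℝ))
        ((0 : ℝ) : AddCircle (1 : ℝ)) = (psi ((f : ℝ ≃o ℝ) 0) : ℝ) := by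
      rw [map_mul, map_mul]
      refine (congrArg (Θ (φ f) * Θ r : ThompsonT).1
        (map_zero_circle φ hφa hφb Θ hΘa hΘb f')).trans ?_
      refine (congrArg (Θ (φ f) : AddCircle (1 : ℝ) ≃ₜ AddCircle (1 : ℝ)) (hΘr 0)).trans ?_
      rw [zero_add, ← psi_zero]
      exact map_psi φ hφa hφb Θ hΘa hΘb f 0
    rw [hΘ] at h5
    obtain ⟨n, hn⟩ := coe_eq_coe_iff_exists_int.1 (show ((0 : ℝ) : AddCircle (1 : ℝ)) =
      (psi ((f : ℝ ≃o ℝ) 0) : ℝ) from h5)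
    have h6 := psi_pos ((f : ℝ ≃o ℝ) 0)
    have h7 := psi_lt_one ((f : ℝ ≃o ℝ) 0)
    rw [hn, zero_add] at h6 h7
    have h8 : 0 < n := by exact_mod_cast h6
    have h9 : n < 1 := by exact_mod_cast h7
    omega

/-- The images of `a, b, r` generate `T`. -/
theorem exists_map_eq (g : ThompsonT) : ∃ q ∈ Subgroup.closure {a, b, r}, Θ q = g := by
  have hrange : φ.range ≤ Subgroup.closure {a, b, r} := by
    rw [range_eq_closure φ hφa hφb]
    exact Subgroup.closure_mono (by intro x; simp; tauto)
  have hr : r ∈ Subgroup.closure {a, b, r} := Subgroup.subset_closure (by simp)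
  -- The stabilizer of `0` in `T` is the image of `F`: a lift, corrected by an integer, preserves
  -- `[0, 1]` and comes from `F` through `psi`.
  have fix : ∀ g : ThompsonT, (g : AddCircle (1 : ℝ) ≃ₜ AddCircle (1 : ℝ))
      ((0 : ℝ) : AddCircle (1 : ℝ)) = ((0 : ℝ) : AddCircle (1 : ℝ)) → ∃ f, Θ (φ f) = g := by
    rintro ⟨g, u, hu, hu1, hgu⟩ h0
    have h0 : g ((0 : ℝ) : AddCircle (1 : ℝ)) = ((0 : ℝ) : AddCircle (1 : ℝ)) := h0
    rw [hgu] at h0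
    obtain ⟨n, hn⟩ := coe_eq_coe_iff_exists_int.1 h0
    have hn : u 0 = -n := by linarith
    have hu1' := hu1 0
    rw [zero_add] at hu1'
    obtain ⟨f, hf, hfu⟩ := exists_thompsonF_psi (g := affIso 0 n * u)
      (PL2Plus.mul_mem (affIso_mem 0 (isDyadic_int n)) hu) (by simp [hn]) (by simp [hu1', hn])
    refine ⟨⟨f, hf⟩, Subtype.ext (Homeomorph.ext fun x => ?_)⟩
    induction x using QuotientAddGroup.induction_on with
    | H x =>
      have ex : ((Int.fract x : ℝ) : AddCircle (1 : ℝ)) = (x : AddCircle (1 : ℝ)) :=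
        coe_eq_coe_iff_exists_int.2 ⟨⌊x⌋, (Int.fract_add_floor x).symm⟩
      change (Θ (φ ⟨f, hf⟩) : AddCircle (1 : ℝ) ≃ₜ AddCircle (1 : ℝ)) (x : AddCircle (1 : ℝ)) =
        g (x : AddCircle (1 : ℝ))
      rw [← ex]
      rcases (Int.fract_nonneg x).eq_or_lt with hx | hx
      · rw [← hx, map_zero_circle φ hφa hφb Θ hΘa hΘb, hgu, hn]
        exact coe_eq_coe_iff_exists_int.2 ⟨-n, by simp⟩
      · obtain ⟨y, hy⟩ := exists_psi_eq hx (Int.fract_lt_one x)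
        rw [← hy, map_psi φ hφa hφb Θ hΘa hΘb, hfu, hgu]
        exact (coe_eq_coe_iff_exists_int.2 ⟨n, by simp⟩).symm
  obtain ⟨u, hu, hu1, hgu⟩ := g.2
  have hd : IsDyadic (u 0) := (IsPL2.isDyadic_iff hu 0).2 (by simpa using isDyadic_int 0)
  have ex : ((Int.fract (u 0) : ℝ) : AddCircle (1 : ℝ)) = (u 0 : AddCircle (1 : ℝ)) :=
    coe_eq_coe_iff_exists_int.2 ⟨⌊u 0⌋, (Int.fract_add_floor (u 0)).symm⟩
  rcases (Int.fract_nonneg (u 0)).eq_or_lt with hx | hx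
  · obtain ⟨f, hf⟩ := fix g (by rw [hgu, ← ex, ← hx])
    exact ⟨φ f, hrange ⟨f, rfl⟩, hf⟩
  · obtain ⟨y, hy⟩ := exists_psi_eq hx (Int.fract_lt_one _)
    have hyd : IsDyadic y := by
      rw [← isPL2_psi.isDyadic_iff, hy, Int.fract]
      exact hd.sub (isDyadic_int _)
    obtain ⟨f, hf, hf0⟩ := exists_thompsonF_apply_zero hyd
    have h5 := map_psi φ hφa hφb Θ hΘa hΘb ⟨f, hf⟩ 0
    rw [psi_zero] at h5
    -- Since `f` takes `0` to `y`, its circle map takes `1 / 2` to `psi y`, which is `g 0` modulo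
    -- `1`. Hence `f⁻¹ g` takes `0` to `1 / 2`, and the half turn takes this to `0`.
    have h6 : (Θ (r * (φ ⟨f, hf⟩)⁻¹) * g : ThompsonT).1 ((0 : ℝ) : AddCircle (1 : ℝ)) =
        ((0 : ℝ) : AddCircle (1 : ℝ)) := by
      rw [map_mul, map_inv]
      have h7 : (g : AddCircle (1 : ℝ) ≃ₜ AddCircle (1 : ℝ)) ((0 : ℝ) : AddCircle (1 : ℝ)) =
          (Θ (φ ⟨f, hf⟩) : AddCircle (1 : ℝ) ≃ₜ AddCircle (1 : ℝ))
            ((1 / 2 : ℝ) : AddCircle (1 : ℝ)) := by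
        rw [h5, hgu, ← ex, ← hy]
        exact congrArg (fun z : ℝ => (psi z : AddCircle (1 : ℝ))) hf0.symm
      refine (congrArg (Θ r * (Θ (φ ⟨f, hf⟩))⁻¹ : ThompsonT).1 h7).trans ?_
      refine (congrArg (Θ r : AddCircle (1 : ℝ) ≃ₜ AddCircle (1 : ℝ)) ((Θ (φ ⟨f, hf⟩) :
        AddCircle (1 : ℝ) ≃ₜ AddCircle (1 : ℝ)).symm_apply_apply _)).trans ?_
      rw [hΘr]
      exact coe_eq_coe_iff_exists_int.2 ⟨-1, by norm_num⟩
    obtain ⟨f', hf'⟩ := fix _ h6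
    refine ⟨(r * (φ ⟨f, hf⟩)⁻¹)⁻¹ * φ f', mul_mem (inv_mem (mul_mem hr (inv_mem (hrange ⟨_, rfl⟩))))
      (hrange ⟨_, rfl⟩), ?_⟩
    rw [map_mul, hf', map_inv, inv_mul_cancel_left]

end TGroup


/-! ### The presented group -/

/-- The maps named by the generators, as elements of `EndPer`. -/
noncomputable def genEnd (i : Gen) : EndPer :=
  ⟨genIso i, genIso_mem i, ⟨1, fun _ hx => genIso_add_one_of_le i hx.le⟩, ⟨1, fun x hx => by
    have := genIso_sub_one_of_le i (x := -x) (by linarith)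
    rw [reflect_apply, reflect_apply, show -(x + 1) = -x - 1 by ring, this]
    ring⟩⟩

theorem lift_genEnd_eq_one {r : FreeGroup Gen} (hr : r ∈ relators) :
    FreeGroup.lift (fun i => (genEnd i)⁻¹) r = 1 := by
  refine Subtype.ext (Eq.trans ?_ (wordAct_eq_one hr))
  have : EndPer.subtype.comp (FreeGroup.lift fun i => (genEnd i)⁻¹) = wordAct := by
    ext i : 1
    simp [wordAct, genEnd]
  exact DFunLike.congr_fun this r

/-- The action of the presented group on the line. -/
noncomputable def toEndPer : PresentedGroup relators →* EndPer :=
  PresentedGroup.toGroup fun _ hr => lift_genEnd_eq_one hr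

theorem toEndPer_of (i : Gen) : toEndPer (PresentedGroup.of i) = (genEnd i)⁻¹ :=
  PresentedGroup.toGroup.of _

theorem mk_eq_one {r : FreeGroup Gen} (hr : r ∈ relators) : PresentedGroup.mk relators r = 1 :=
  PresentedGroup.one_of_mem hr

/-! ### The normal copy of `F` in the presented group -/

theorem exists_inclF : ∃ φ : ThompsonF →* PresentedGroup relators,
    φ genA = PresentedGroup.of .x0 ∧ φ genB = PresentedGroup.of .x1 := by
  refine exists_hom_of_relators ?_ ?_
  · have := mk_eq_one (r := f1 x₀ x₁) (by simp [relators, kernelRelators])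
    rwa [map_f1] at this
  · have := mk_eq_one (r := f2 x₀ x₁) (by simp [relators, kernelRelators])
    rwa [map_f2] at this

/-- The homomorphism from `F` to the presented group. -/
noncomputable def inclF : ThompsonF →* PresentedGroup relators := exists_inclF.choose

theorem inclF_genA : inclF genA = PresentedGroup.of .x0 := exists_inclF.choose_spec.1

theorem inclF_genB : inclF genB = PresentedGroup.of .x1 := exists_inclF.choose_spec.2

theorem toEndPer_inclF (f : ThompsonF) : (toEndPer (inclF f) : ℝ ≃o ℝ) = f := by
  have h : EndPer.subtype.comp (toEndPer.comp inclF) = ThompsonF.subtype := by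
    refine MonoidHom.eq_of_eqOn_dense closure_genA_genB ?_
    rintro _ (rfl | rfl)
    · simp only [MonoidHom.comp_apply, inclF_genA, toEndPer_of]; rfl
    · simp only [MonoidHom.comp_apply, inclF_genB, toEndPer_of]; rfl
  exact DFunLike.congr_fun h f

/-- The words that represent elements of the image of `F`. -/
noncomputable def wordsF : Subgroup (FreeGroup Gen) := inclF.range.comap (PresentedGroup.mk relators)

theorem x₀_mem_wordsF : x₀ ∈ wordsF := ⟨genA, inclF_genA⟩

theorem x₁_mem_wordsF : x₁ ∈ wordsF := ⟨genB, inclF_genB⟩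

theorem mem_wordsF_of_mul_inv {v w : FreeGroup Gen} (h : v * w⁻¹ ∈ relators) (hw : w ∈ wordsF) :
    v ∈ wordsF := by
  have h1 : v * w⁻¹ ∈ wordsF := ⟨1, by rw [mk_eq_one h, map_one]⟩
  exact (Subgroup.mul_mem_cancel_right _ (inv_mem hw)).1 h1

theorem conj_gen_mem_wordsF (i : Gen) :
    FreeGroup.of i * x₀ * (FreeGroup.of i)⁻¹ ∈ wordsF ∧
      FreeGroup.of i * x₁ * (FreeGroup.of i)⁻¹ ∈ wordsF := by
  have h0 := x₀_mem_wordsF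
  have h1 := x₁_mem_wordsF
  have hrel : actionRelators ⊆ relators := Set.subset_union_right
  cases i
  case x0 => exact ⟨mul_mem (mul_mem h0 h0) (inv_mem h0), mul_mem (mul_mem h0 h1) (inv_mem h0)⟩
  case x1 => exact ⟨mul_mem (mul_mem h1 h0) (inv_mem h1), mul_mem (mul_mem h1 h1) (inv_mem h1)⟩
  all_goals
    constructor
    all_goals
      -- The right-hand word is left open and is found by matching with the action relators.
      apply mem_wordsF_of_mul_inv
      · refine hrel ?_
        simp only [actionRelators, Set.mem_insert_iff, Set.mem_singleton_iff, mul_right_inj,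
          inv_inj]
        tauto
      repeat' first
        | exact h0
        | exact h1
        | apply mul_mem
        | apply inv_mem
        | apply pow_mem

/-- The presented group acts on `F` by conjugation. -/
noncomputable def actF : PresentedGroup relators →* MulAut ThompsonF :=
  AutPlusF.subtype.comp (endPerEquiv.toMonoidHom.comp toEndPer)

theorem actF_apply (g : PresentedGroup relators) (f : ThompsonF) :
    (actF g f : ℝ ≃o ℝ) = toEndPer g * f * (toEndPer g : ℝ ≃o ℝ)⁻¹ :=
  inducedBy_endPerEquiv (toEndPer g) f

/-- The action relators keep the conjugate in the image of `F`. Which element it is need not be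
computed, since its action on the line determines it. -/
theorem conj_inclF_of (i : Gen) (f : ThompsonF) :
    PresentedGroup.of i * inclF f * (PresentedGroup.of i)⁻¹ = inclF (actF (PresentedGroup.of i) f) := by
  have h : ⊤ ≤ (inclF.range.comap (MulAut.conj (PresentedGroup.of i)).toMonoidHom).comap inclF := by
    rw [← closure_genA_genB, Subgroup.closure_le]
    rintro _ (rfl | rfl)
    · rw [SetLike.mem_coe, Subgroup.mem_comap, inclF_genA]
      exact (conj_gen_mem_wordsF i).1
    · rw [SetLike.mem_coe, Subgroup.mem_comap, inclF_genB]
      exact (conj_gen_mem_wordsF i).2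
  obtain ⟨f', hf'⟩ : PresentedGroup.of i * inclF f * (PresentedGroup.of i)⁻¹ ∈ inclF.range :=
    h (Subgroup.mem_top f)
  rw [← hf']
  congr 1
  refine Subtype.ext ?_
  rw [actF_apply, ← toEndPer_inclF f', hf', ← toEndPer_inclF f, map_mul, map_mul, map_inv]
  rfl

/-- As `actF g` is an automorphism of `F`, the identity passes from `g` to `g⁻¹`. No action relators
for inverses of generators are needed. -/
theorem conj_inclF (g : PresentedGroup relators) (f : ThompsonF) :
    g * inclF f * g⁻¹ = inclF (actF g f) := by
  have hg : g ∈ Subgroup.closure (Set.range (PresentedGroup.of (rels := relators))) := by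
    rw [PresentedGroup.closure_range_of]; trivial
  induction hg using Subgroup.closure_induction generalizing f with
  | mem g hg =>
    obtain ⟨i, rfl⟩ := hg
    exact conj_inclF_of i f
  | one => simp
  | mul g h _ _ hg hh =>
    rw [map_mul, MulAut.mul_apply, ← hg, ← hh]; group
  | inv g _ hg =>
    have := hg (actF g⁻¹ f)
    rw [map_inv, MulAut.apply_inv_self] at this
    rw [← this, map_inv]; group

instance : inclF.range.Normal :=
  ⟨by rintro _ ⟨f, rfl⟩ g; exact ⟨_, (conj_inclF g f).symm⟩⟩

/-- The quotient of the presented group by the image of `F`. -/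
abbrev QuotF := PresentedGroup relators ⧸ inclF.range

/-- The words, evaluated in the quotient. -/
noncomputable def evalQ : FreeGroup Gen →* QuotF :=
  (QuotientGroup.mk' inclF.range).comp (PresentedGroup.mk relators)

theorem evalQ_surjective : Function.Surjective evalQ :=
  (QuotientGroup.mk'_surjective _).comp (PresentedGroup.mk_surjective _)

theorem evalQ_eq_one {r : FreeGroup Gen} (hr : r ∈ relators) : evalQ r = 1 := by
  rw [evalQ, MonoidHom.comp_apply, mk_eq_one hr, map_one]

theorem evalQ_x₀ : evalQ x₀ = 1 := (QuotientGroup.eq_one_iff _).2 x₀_mem_wordsF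

theorem evalQ_x₁ : evalQ x₁ = 1 := (QuotientGroup.eq_one_iff _).2 x₁_mem_wordsF

/-- The correcting words in `x₀, x₁` die in the quotient and leave the plain relators of `T`. -/
theorem evalQ_lifted :
    (f1 (evalQ y₀) (evalQ y₁) = 1 ∧ f2 (evalQ y₀) (evalQ y₁) = 1 ∧
      t1 (evalQ y₀) (evalQ y₁) (evalQ s) = 1 ∧ t2 (evalQ y₀) (evalQ y₁) (evalQ s) = 1 ∧
      t3 (evalQ y₀) (evalQ y₁) (evalQ s) = 1 ∧ t4 (evalQ s) = 1) ∧
    (f1 (evalQ z₀) (evalQ z₁) = 1 ∧ f2 (evalQ z₀) (evalQ z₁) = 1 ∧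
      t1 (evalQ z₀) (evalQ z₁) (evalQ t) = 1 ∧ t2 (evalQ z₀) (evalQ z₁) (evalQ t) = 1 ∧
      t3 (evalQ z₀) (evalQ z₁) (evalQ t) = 1 ∧ t4 (evalQ t) = 1) := by
  have h : ∀ r ∈ liftedRelators, evalQ r = 1 := fun r hr => evalQ_eq_one (Or.inl (Or.inr hr))
  simpa only [liftedRelators, Set.forall_mem_insert, Set.mem_singleton_iff, forall_eq, map_f1,
    map_f2, t1, t2, t3, t4, map_mul, map_inv, map_pow, evalQ_x₀, evalQ_x₁, one_pow, inv_one,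
    mul_one, and_assoc] using h

theorem commute_evalQ {v w : FreeGroup Gen} (hv : v ∈ ({y₀, y₁, s} : Set (FreeGroup Gen)))
    (hw : w ∈ ({z₀, z₁, t} : Set (FreeGroup Gen))) : Commute (evalQ v) (evalQ w) := by
  have h : comm v w ∈ relators := by
    refine Or.inl (Or.inl (Or.inr ?_))
    rcases hv with rfl | rfl | rfl <;> rcases hw with rfl | rfl | rfl <;>
      simp [commutationRelators]
  have h2 := evalQ_eq_one h
  simp only [comm, map_mul, map_inv] at h2
  rw [Commute, SemiconjBy]
  exact (mul_inv_eq_one.1 (by rwa [mul_inv_rev, ← mul_assoc]))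

/-- The two subgroups commute elementwise, so multiplication on their product is a homomorphism, and
its range contains the image of every generator. -/
theorem exists_mul_eq (q : QuotF) :
    ∃ v ∈ Subgroup.closure {evalQ y₀, evalQ y₁, evalQ s},
      ∃ w ∈ Subgroup.closure {evalQ z₀, evalQ z₁, evalQ t}, q = v * w := by
  have hc : ∀ v ∈ Subgroup.closure {evalQ y₀, evalQ y₁, evalQ s},
      ∀ w ∈ Subgroup.closure {evalQ z₀, evalQ z₁, evalQ t}, v * w = w * v := by
    intro v hv
    have h1 : Subgroup.closure {evalQ y₀, evalQ y₁, evalQ s} ≤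
        Subgroup.centralizer {evalQ z₀, evalQ z₁, evalQ t} := by
      rw [Subgroup.closure_le]
      intro v hv
      obtain ⟨v, hv', rfl⟩ : ∃ v' ∈ ({y₀, y₁, s} : Set (FreeGroup Gen)), evalQ v' = v := by
        rcases hv with rfl | rfl | rfl
        exacts [⟨_, by simp, rfl⟩, ⟨_, by simp, rfl⟩, ⟨_, by simp, rfl⟩]
      rw [SetLike.mem_coe, Subgroup.mem_centralizer_iff]
      rintro _ (rfl | rfl | rfl)
      exacts [(commute_evalQ hv' (by simp)).symm, (commute_evalQ hv' (by simp)).symm,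
        (commute_evalQ hv' (by simp)).symm]
    rw [← Subgroup.centralizer_closure] at h1
    exact fun w hw => (Subgroup.mem_centralizer_iff.1 (h1 hv) w hw).symm
  let Y := Subgroup.closure {evalQ y₀, evalQ y₁, evalQ s}
  let Z := Subgroup.closure {evalQ z₀, evalQ z₁, evalQ t}
  let p : Y × Z →* QuotF := Y.subtype.noncommCoprod Z.subtype fun v w => hc v v.2 w w.2
  have hY : ∀ v ∈ Y, v ∈ p.range := fun v hv => ⟨(⟨v, hv⟩, 1), mul_one v⟩
  have hZ : ∀ w ∈ Z, w ∈ p.range := fun w hw => ⟨(1, ⟨w, hw⟩), one_mul w⟩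
  have h : ⊤ ≤ p.range.comap evalQ := by
    rw [← FreeGroup.closure_range_of, Subgroup.closure_le]
    rintro _ ⟨i, rfl⟩
    rw [Subgroup.coe_comap, Set.mem_preimage, SetLike.mem_coe]
    cases i
    case x0 => rw [evalQ_x₀]; exact one_mem _
    case x1 => rw [evalQ_x₁]; exact one_mem _
    case y0 => exact hY _ (Subgroup.subset_closure (by simp))
    case y1 => exact hY _ (Subgroup.subset_closure (by simp))
    case s => exact hY _ (Subgroup.subset_closure (by simp))
    case z0 => exact hZ _ (Subgroup.subset_closure (by simp))
    case z1 => exact hZ _ (Subgroup.subset_closure (by simp))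
    case t => exact hZ _ (Subgroup.subset_closure (by simp))
  obtain ⟨w, rfl⟩ := evalQ_surjective q
  obtain ⟨⟨v, w⟩, hvw⟩ := h (Subgroup.mem_top w)
  exact ⟨v, v.2, w, w.2, hvw.symm⟩

/-! ### The action of the generators at the ends -/

/-- Each circle point is represented far out, where `h` agrees with the periodic map `u`. The
inverse appears because generators act through the inverses of their maps. -/
theorem topMap_inv_apply {h : EndPer} {u : ℝ ≃o ℝ} (hu : ∀ x, u (x + 1) = u x + 1) {M : ℝ}
    (hM : ∀ x, M < x → (h : ℝ ≃o ℝ) x = u x) (x : ℝ) :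
    (topMap h⁻¹ : AddCircle (1 : ℝ) ≃ₜ AddCircle (1 : ℝ)) (x : AddCircle (1 : ℝ)) =
      (u⁻¹ x : ℝ) := by
  have hun : ∀ (n : ℕ) (y : ℝ), u (y + n) = u y + n := by
    intro n y
    induction n with
    | zero => simp
    | succ n ih => push_cast; rw [← add_assoc, hu, ih, add_assoc]
  obtain ⟨N, hN⟩ := topMap_spec h
  have key : ∀ y : ℝ, (topMap h : AddCircle (1 : ℝ) ≃ₜ AddCircle (1 : ℝ))
      (y : AddCircle (1 : ℝ)) = (u y : ℝ) := by
    intro y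
    obtain ⟨n, hn⟩ := exists_nat_gt (max M N - y)
    have h1 : M < y + n := by linarith [le_max_left M N]
    have h2 : N < y + n := by linarith [le_max_right M N]
    have e : (y : AddCircle (1 : ℝ)) = ((y + n : ℝ) : AddCircle (1 : ℝ)) :=
      coe_eq_coe_iff_exists_int.2 ⟨n, by simp⟩
    rw [e, hN _ h2, hM _ h1, hun]
    exact coe_eq_coe_iff_exists_int.2 ⟨-n, by simp⟩
  rw [map_inv]
  have := key (u⁻¹ x)
  rw [RelIso.apply_inv_self] at this
  rw [← this]
  exact (topMap h : AddCircle (1 : ℝ) ≃ₜ AddCircle (1 : ℝ)).symm_apply_apply _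

theorem botMap_inv_apply {h : EndPer} {u : ℝ ≃o ℝ} (hu : ∀ x, u (x + 1) = u x + 1) {M : ℝ}
    (hM : ∀ x, x < M → (h : ℝ ≃o ℝ) x = u x) (x : ℝ) :
    (botMap h⁻¹ : AddCircle (1 : ℝ) ≃ₜ AddCircle (1 : ℝ)) (x : AddCircle (1 : ℝ)) =
      (u⁻¹ x : ℝ) := by
  have hun : ∀ (n : ℕ) (y : ℝ), u (y - n) = u y - n := by
    intro n y
    induction n with
    | zero => simp
    | succ n ih =>
      have := hu (y - (n + 1 : ℕ))
      rw [show y - (n + 1 : ℕ) + 1 = y - n by push_cast; ring, ih] at this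
      push_cast at this ⊢
      linarith
  obtain ⟨N, hN⟩ := botMap_spec h
  have key : ∀ y : ℝ, (botMap h : AddCircle (1 : ℝ) ≃ₜ AddCircle (1 : ℝ))
      (y : AddCircle (1 : ℝ)) = (u y : ℝ) := by
    intro y
    obtain ⟨n, hn⟩ := exists_nat_gt (y - min M (-N))
    have h1 : y - n < M := by linarith [min_le_left M (-N)]
    have h2 : y - n < -N := by linarith [min_le_right M (-N)]
    have e : (y : AddCircle (1 : ℝ)) = ((y - n : ℝ) : AddCircle (1 : ℝ)) :=
      coe_eq_coe_iff_exists_int.2 ⟨-n, by simp [sub_eq_add_neg]⟩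
    rw [e, hN _ h2, hM _ h1, hun]
    exact coe_eq_coe_iff_exists_int.2 ⟨n, by simp⟩
  rw [map_inv]
  have := key (u⁻¹ x)
  rw [RelIso.apply_inv_self] at this
  rw [← this]
  exact (botMap h : AddCircle (1 : ℝ) ≃ₜ AddCircle (1 : ℝ)).symm_apply_apply _

theorem per0_add_one (x : ℝ) : per0 (x + 1) = per0 x + 1 := perIso_add_one _ _ _

theorem per1_add_one (x : ℝ) : per1 (x + 1) = per1 x + 1 := perIso_add_one _ _ _

theorem topMap_eq_one {h : EndPer} {M : ℝ} (hM : ∀ x, M < x → (h : ℝ ≃o ℝ) x = x) :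
    topMap h⁻¹ = 1 :=
  circle_ext_top (M := 0) fun x _ =>
    topMap_inv_apply (u := 1) (fun _ => rfl) (fun x hx => hM x hx) x

theorem botMap_eq_one {h : EndPer} {M : ℝ} (hM : ∀ x, x < M → (h : ℝ ≃o ℝ) x = x) :
    botMap h⁻¹ = 1 :=
  circle_ext_top (M := 0) fun x _ =>
    botMap_inv_apply (u := 1) (fun _ => rfl) (fun x hx => hM x hx) x

/-- The action of the quotient near `∞`. -/
noncomputable def topQ : QuotF →* ThompsonT :=
  QuotientGroup.lift _ (topMap.comp toEndPer) (by
    rintro _ ⟨f, rfl⟩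
    exact (maps_eq_one_of_mem (by rw [toEndPer_inclF]; exact f.2)).1)

/-- The action of the quotient near `-∞`. -/
noncomputable def botQ : QuotF →* ThompsonT :=
  QuotientGroup.lift _ (botMap.comp toEndPer) (by
    rintro _ ⟨f, rfl⟩
    exact (maps_eq_one_of_mem (by rw [toEndPer_inclF]; exact f.2)).2)

theorem topQ_evalQ (i : Gen) : topQ (evalQ (FreeGroup.of i)) = topMap (genEnd i)⁻¹ := by
  rw [← toEndPer_of]; rfl

theorem botQ_evalQ (i : Gen) : botQ (evalQ (FreeGroup.of i)) = botMap (genEnd i)⁻¹ := by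
  rw [← toEndPer_of]; rfl

theorem topQ_y₀ (x : ℝ) : (topQ (evalQ y₀) : AddCircle (1 : ℝ) ≃ₜ AddCircle (1 : ℝ))
    (x : AddCircle (1 : ℝ)) = (per0⁻¹ x : ℝ) := by
  rw [topQ_evalQ]
  refine topMap_inv_apply per0_add_one (M := 0) (fun y hy => ?_) x
  simp only [genEnd, genIso, glue_of_ge _ hy.le]

theorem topQ_y₁ (x : ℝ) : (topQ (evalQ y₁) : AddCircle (1 : ℝ) ≃ₜ AddCircle (1 : ℝ))
    (x : AddCircle (1 : ℝ)) = (per1⁻¹ x : ℝ) := by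
  rw [topQ_evalQ]
  refine topMap_inv_apply per1_add_one (M := 0) (fun y hy => ?_) x
  simp only [genEnd, genIso, glue_of_ge _ hy.le]

theorem topQ_s (x : ℝ) : (topQ (evalQ s) : AddCircle (1 : ℝ) ≃ₜ AddCircle (1 : ℝ))
    (x : AddCircle (1 : ℝ)) = (x + 1 / 2 : ℝ) := by
  rw [topQ_evalQ, topMap_inv_apply (u := affIso 0 (1 / 2)) (M := 1 / 2) ?_ (fun y hy => ?_)]
  · refine coe_eq_coe_iff_exists_int.2 ⟨1, ?_⟩
    rw [inv_apply_eq_iff.2 (show x = affIso 0 (1 / 2) (x - 1 / 2) by simp)]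
    push_cast; ring
  · intro x; simp; ring
  · simp only [genEnd, genIso]
    rw [glue_of_ge _ (by linarith), glue_of_ge _ hy.le]

theorem botQ_z₀ (x : ℝ) : (botQ (evalQ z₀) : AddCircle (1 : ℝ) ≃ₜ AddCircle (1 : ℝ))
    (x : AddCircle (1 : ℝ)) = (per0⁻¹ x : ℝ) := by
  rw [botQ_evalQ]
  refine botMap_inv_apply per0_add_one (M := 0) (fun y hy => ?_) x
  simp only [genEnd, genIso, glue_of_le _ hy.le]

theorem botQ_z₁ (x : ℝ) : (botQ (evalQ z₁) : AddCircle (1 : ℝ) ≃ₜ AddCircle (1 : ℝ))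
    (x : AddCircle (1 : ℝ)) = (per1⁻¹ x : ℝ) := by
  rw [botQ_evalQ]
  refine botMap_inv_apply per1_add_one (M := 0) (fun y hy => ?_) x
  simp only [genEnd, genIso, glue_of_le _ hy.le]

theorem botQ_t (x : ℝ) : (botQ (evalQ t) : AddCircle (1 : ℝ) ≃ₜ AddCircle (1 : ℝ))
    (x : AddCircle (1 : ℝ)) = (x + 1 / 2 : ℝ) := by
  rw [botQ_evalQ, botMap_inv_apply (u := affIso 0 (-1 / 2)) (M := -1 / 2) ?_ (fun y hy => ?_)]
  · rw [inv_apply_eq_iff.2 (show x = affIso 0 (-1 / 2) (x + 1 / 2) by simp; ring)]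
  · intro x; simp; ring
  · simp only [genEnd, genIso]
    rw [glue_of_le _ (by linarith), glue_of_le _ hy.le]

theorem botQ_eq_one {q : QuotF} (hq : q ∈ Subgroup.closure {evalQ y₀, evalQ y₁, evalQ s}) :
    botQ q = 1 := by
  suffices Subgroup.closure {evalQ y₀, evalQ y₁, evalQ s} ≤ botQ.ker from this hq
  rw [Subgroup.closure_le]
  rintro _ (rfl | rfl | rfl)
  all_goals
    refine (botQ_evalQ _).trans (botMap_eq_one (M := 0) fun x hx => ?_)
    simp [genEnd, genIso, glue_of_le _ hx.le]

theorem topQ_eq_one {q : QuotF} (hq : q ∈ Subgroup.closure {evalQ z₀, evalQ z₁, evalQ t}) :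
    topQ q = 1 := by
  suffices Subgroup.closure {evalQ z₀, evalQ z₁, evalQ t} ≤ topQ.ker from this hq
  rw [Subgroup.closure_le]
  rintro _ (rfl | rfl | rfl)
  all_goals
    refine (topQ_evalQ _).trans (topMap_eq_one (M := 0) fun x hx => ?_)
    simp [genEnd, genIso, glue_of_ge _ hx.le]

/-- In `q = v * w` the end at `∞` sees only `v` and the end at `-∞` only `w`, so the presentation of
`T` applies to each factor. -/
theorem quotF_eq_one {q : QuotF} (h1 : topQ q = 1) (h2 : botQ q = 1) : q = 1 := by
  obtain ⟨v, hv, w, hw, rfl⟩ := exists_mul_eq q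
  rw [map_mul, topQ_eq_one hw, mul_one] at h1
  rw [map_mul, botQ_eq_one hv, one_mul] at h2
  obtain ⟨⟨a1, a2, a3, a4, a5, a6⟩, b1, b2, b3, b4, b5, b6⟩ := evalQ_lifted
  obtain ⟨φ, hφa, hφb⟩ := exists_hom_of_relators a1 a2
  obtain ⟨χ, hχa, hχb⟩ := exists_hom_of_relators b1 b2
  rw [eq_one_of_map_thompsonT_eq_one φ hφa hφb topQ topQ_y₀ topQ_y₁ topQ_s a3 a4 a5 a6 hv h1,
    eq_one_of_map_thompsonT_eq_one χ hχa hχb botQ botQ_z₀ botQ_z₁ botQ_t b3 b4 b5 b6 hw h2, one_mul]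

theorem exists_quotF (g g' : ThompsonT) : ∃ q : QuotF, topQ q = g ∧ botQ q = g' := by
  obtain ⟨⟨a1, a2, -⟩, b1, b2, -⟩ := evalQ_lifted
  obtain ⟨φ, hφa, hφb⟩ := exists_hom_of_relators a1 a2
  obtain ⟨χ, hχa, hχb⟩ := exists_hom_of_relators b1 b2
  obtain ⟨v, hv, hvg⟩ := exists_map_eq φ hφa hφb topQ topQ_y₀ topQ_y₁ topQ_s g
  obtain ⟨w, hw, hwg⟩ := exists_map_eq χ hχa hχb botQ botQ_z₀ botQ_z₁ botQ_t g'
  exact ⟨v * w, by rw [map_mul, hvg, topQ_eq_one hw, mul_one],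
    by rw [map_mul, hwg, botQ_eq_one hv, one_mul]⟩

theorem exists_toEndPer (g g' : ThompsonT) :
    ∃ p, topMap (toEndPer p) = g ∧ botMap (toEndPer p) = g' := by
  obtain ⟨q, h1, h2⟩ := exists_quotF g g'
  obtain ⟨p, rfl⟩ := QuotientGroup.mk'_surjective _ q
  exact ⟨p, h1, h2⟩

/-! ### The main theorem -/

/-- A short five lemma: an element of the kernel is trivial in the quotient, hence comes from `F`,
where the map is the inclusion. For surjectivity, an element with the same circle maps is corrected
by an element of `F`. -/
theorem toEndPer_bijective : Function.Bijective toEndPer := by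
  constructor
  · rw [injective_iff_map_eq_one]
    intro p hp
    have h1 : (QuotientGroup.mk' inclF.range p : QuotF) = 1 := by
      refine quotF_eq_one ?_ ?_
      · change topMap (toEndPer p) = 1
        rw [hp, map_one]
      · change botMap (toEndPer p) = 1
        rw [hp, map_one]
    obtain ⟨f, rfl⟩ := (QuotientGroup.eq_one_iff _).1 h1
    have h2 := toEndPer_inclF f
    rw [hp] at h2
    rw [show f = 1 from Subtype.ext h2.symm, map_one]
  · intro h
    obtain ⟨p, h1, h2⟩ := exists_toEndPer (topMap h) (botMap h)
    have h3 : (((toEndPer p)⁻¹ * h : EndPer) : ℝ ≃o ℝ) ∈ ThompsonF := by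
      refine mem_thompsonF_of_maps_eq_one ?_ ?_
      · rw [map_mul, map_inv, h1, inv_mul_cancel]
      · rw [map_mul, map_inv, h2, inv_mul_cancel]
    refine ⟨p * inclF ⟨_, h3⟩, ?_⟩
    have h4 : toEndPer (inclF ⟨_, h3⟩) = (toEndPer p)⁻¹ * h := Subtype.ext (toEndPer_inclF _)
    rw [map_mul, h4, mul_inv_cancel_left]

/-- The pair of circle maps at the two ends. -/
noncomputable def endMaps : AutPlusF →* ThompsonT × ThompsonT :=
  (topMap.prod botMap).comp endPerEquiv.symm.toMonoidHom

theorem endMaps_apply (φ : AutPlusF) :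
    endMaps φ = (topMap (endPerEquiv.symm φ), botMap (endPerEquiv.symm φ)) := rfl

theorem endMaps_surjective : Function.Surjective endMaps := by
  rintro ⟨g, g'⟩
  obtain ⟨p, h1, h2⟩ := exists_toEndPer g g'
  refine ⟨endPerEquiv (toEndPer p), ?_⟩
  rw [endMaps_apply, MulEquiv.symm_apply_apply, h1, h2]

theorem endMaps_ker : endMaps.ker.map AutPlusF.subtype =
    (MulAut.conj : ThompsonF →* MulAut ThompsonF).range := by
  ext φ
  constructor
  · rintro ⟨φ, hφ, rfl⟩
    have h := inducedBy_endPerEquiv_symm φ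
    rw [SetLike.mem_coe, MonoidHom.mem_ker, endMaps_apply, Prod.mk_eq_one] at hφ
    have hF := mem_thompsonF_of_maps_eq_one hφ.1 hφ.2
    exact ⟨⟨_, hF⟩, MulEquiv.ext fun f => Subtype.ext (h f).symm⟩
  · rintro ⟨f, rfl⟩
    refine ⟨endPerEquiv ⟨f, thompsonF_le_endPer f.2⟩, ?_, ?_⟩
    · rw [SetLike.mem_coe, MonoidHom.mem_ker, endMaps_apply, MulEquiv.symm_apply_apply,
        Prod.mk_eq_one]
      exact maps_eq_one_of_mem f.2
    · exact MulEquiv.ext fun f' => Subtype.ext (inducedBy_endPerEquiv _ f')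

theorem endMaps_spec (φ : AutPlusF) {h : ℝ ≃o ℝ} (hφ : InducedBy (φ : MulAut ThompsonF) h) :
    ∃ M : ℝ,
      (∀ x : ℝ, M < x → ((endMaps φ).1 : AddCircle (1 : ℝ) ≃ₜ AddCircle (1 : ℝ))
        (x : AddCircle (1 : ℝ)) = (h x : AddCircle (1 : ℝ))) ∧
      (∀ x : ℝ, x < -M → ((endMaps φ).2 : AddCircle (1 : ℝ) ≃ₜ AddCircle (1 : ℝ))
        (x : AddCircle (1 : ℝ)) = (h x : AddCircle (1 : ℝ))) := by
  obtain rfl := inducedBy_unique (inducedBy_endPerEquiv_symm φ) hφ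
  obtain ⟨M, hM⟩ := topMap_spec (endPerEquiv.symm φ)
  obtain ⟨N, hN⟩ := botMap_spec (endPerEquiv.symm φ)
  exact ⟨max M N, fun x hx => hM x ((le_max_left _ _).trans_lt hx),
    fun x hx => hN x (hx.trans_le (neg_le_neg (le_max_right _ _)))⟩

end ThompsonAut

/-- Words are read with maps composed from left to right, so that the product `g * h` of two
generators stands for "first `g`, then `h`"; accordingly the generator `i` is the automorphism
`f ↦ g⁻¹ ∘ f ∘ g`, where `g` is the map `ThompsonAut.genMap i`. -/
theorem mainTheorem2 :
    ThompsonAut.relators.ncard = 35 ∧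
    (∃ e : PresentedGroup ThompsonAut.relators ≃* ThompsonAut.AutPlusF,
      ∀ i : ThompsonAut.Gen, ∃ g : ℝ ≃o ℝ, (∀ x : ℝ, g x = ThompsonAut.genMap i x) ∧
        ThompsonAut.InducedBy (e (PresentedGroup.of i) : MulAut ThompsonAut.ThompsonF) g⁻¹) ∧
    Function.Injective (MulAut.conj : ThompsonAut.ThompsonF →* MulAut ThompsonAut.ThompsonF) ∧
    ∃ π : ThompsonAut.AutPlusF →* ThompsonAut.ThompsonT × ThompsonAut.ThompsonT,
      Function.Surjective π ∧
      π.ker.map ThompsonAut.AutPlusF.subtype =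
        (MulAut.conj : ThompsonAut.ThompsonF →* MulAut ThompsonAut.ThompsonF).range ∧
      ∀ (φ : ThompsonAut.AutPlusF), ∀ h ∈ ThompsonAut.PL2Plus,
        ThompsonAut.InducedBy (φ : MulAut ThompsonAut.ThompsonF) h →
        ∃ M : ℝ,
          (∀ x : ℝ, M < x → ((π φ).1 : AddCircle (1 : ℝ) ≃ₜ AddCircle (1 : ℝ))
            (x : AddCircle (1 : ℝ)) = (h x : AddCircle (1 : ℝ))) ∧
          (∀ x : ℝ, x < -M → ((π φ).2 : AddCircle (1 : ℝ) ≃ₜ AddCircle (1 : ℝ))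
            (x : AddCircle (1 : ℝ)) = (h x : AddCircle (1 : ℝ))) := by
  refine ⟨ThompsonAut.ncard_relators,
    ⟨(MulEquiv.ofBijective _ ThompsonAut.toEndPer_bijective).trans ThompsonAut.endPerEquiv,
      fun i => ⟨ThompsonAut.genIso i, ThompsonAut.genIso_apply i, ?_⟩⟩,
    ThompsonAut.conj_injective, ThompsonAut.endMaps, ThompsonAut.endMaps_surjective,
    ThompsonAut.endMaps_ker, fun φ h _ hφ => ThompsonAut.endMaps_spec φ hφ⟩
  have h := ThompsonAut.inducedBy_endPerEquiv (ThompsonAut.toEndPer (PresentedGroup.of i))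
  rw [ThompsonAut.toEndPer_of] at h
  rw [MulEquiv.trans_apply, MulEquiv.ofBijective_apply, ThompsonAut.toEndPer_of]
  exact h
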